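/- **Setting.** A schema is a finite set of relation names, each with a finite tuple of attributes $\mathrm{att}(R)$. Constants and variables come from disjoint countably infinite sets. A database $D$ is a finite set of facts $R(c_1,\dots,c_n)$ with constants $c_i$. A functional dependency (FD) $R:X\to Y$ with $X,Y\subseteq\mathrm{att}(R)$ holds in $D$ if any two $R$-facts of $D$ that agree on $X$ agree on $Y$. For a set $\Sigma$ of FDs, $\Sigma_R$ is the set of its FDs over $R$. The set $\Sigma$ *has an LHS chain* if for any two FDs $R:X_1\to Y_1$ and $R:X_2\to Y_2$ of $\Sigma$ (over the same $R$), $X_1\subseteq X_2$ or $X_2\subseteq X_1$. It is *canonical* if none of its FDs is redundant, no attribute in any of its FDs is redundant (i.e. removing the FD, respectively the attribute, always gives an inequivalent set), and it has at most one FD $R:X\to Y$ for each $R$ and $X$. The FD $R:X\to Y$ is a key if $X\cup Y=\mathrm{att}(R)$; a *set of primary keys* consists of keys only, at most one per relation name. A *repair* of $D$ w.r.t. $\Sigma$ is an inclusion-maximal subset of $D$ that satisfies $\Sigma$. An *SJFCQ* $Q$ is a Boolean conjunctive query (a finite set of atoms) that mentions no relation name twice. $\mathsf{RelFreq}(\Sigma,Q)$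 is the problem: given a database $D$, compute the rational number $$\mathsf{rfreq}_Q(D,\Sigma)=\frac{\#\{\text{repairs of }D\text{ w.r.t. }\Sigma\text{ that entail }Q\}}{\#\{\text{repairs of }D\text{ w.r.t. }\Sigma\}}.$$ Cook reducible means reducible by a polynomial-time Turing reduction (an oracle algorithm whose running time is polynomial in the size of the input database; the schemas, sets of FDs and queries are fixed). **Safety.** Let $\Sigma$ be a canonical set of FDs with an LHS chain, let $Q$ be an SJFCQ with $R$-atom $\alpha$, and let $R:X_1\to Y_1,\dots,R:X_n\to Y_n$ with $X_1\subsetneq\dots\subsetneq X_n$ be the FDs of $\Sigma_R$. The *primary FD* of $\alpha$ is the FD $R:X_i\to Y_i$ with the least $i$ such that $\alpha$ has a variable at some attribute of $X_i\cup Y_i$, if there is one. The *primary prefix* consists of the FDs that precede the primary FD, and of all FDs of $\Sigma_R$ if there is no primary FD. The *primary-lhs positions* of $\alpha$ are those of the attributes in $X_i$, and all positions if there is no primary FD; $\mathrm{pvar}_\Sigma(\alpha)$ is the set of variables of $\alpha$ at primary-lhs positions. A *liaison variable* is a variable with more than one occurrence in $Q$. The *complex part* $\mathrm{comp}_\Sigma(Q)$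 is the set of atoms $\alpha$ of $Q$ that have a constant or a liaison variable at some non-primary-lhs position whose attribute lies in no $X\cup Y$ with $R:X\to Y$ in the primary prefix. $Q_{x\mapsto c}$ is $Q$ with the variable $x$ replaced by the constant $c$. The $\Sigma$-*safe* queries are defined inductively: $Q$ is $\Sigma$-safe if 1. $\mathrm{comp}_\Sigma(Q)=\emptyset$; or 2. $Q=Q_1\cup Q_2$ with $Q_1,Q_2$ nonempty, without common atoms or variables, and both $\Sigma$-safe; or 3. $\mathrm{comp}_\Sigma(Q)\ne\emptyset$, some variable $x$ of $Q$ is in $\mathrm{pvar}_\Sigma(\alpha)$ for every $\alpha\in\mathrm{comp}_\Sigma(Q)$, and $Q_{x\mapsto c}$ is $\Sigma$-safe for some constant $c$; or 4. some $\alpha\in\mathrm{comp}_\Sigma(Q)$ has $\mathrm{pvar}_\Sigma(\alpha)=\emptyset$ and a primary FD $R:X\to Y$, a variable $x$ occurs in $\alpha$ at an attribute of $Y$, and $Q_{x\mapsto c}$ is $\Sigma$-safe for some constant $c$. **Theorem.** Let $\Sigma$ be a canonical set of FDs with an LHS chain, and let $Q$ be an SJFCQ that is not $\Sigma$-safe.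 Then there exist a canonical set $\Sigma'$ of primary keys (possibly over another schema) and an SJFCQ $Q'$ that is not $\Sigma'$-safe such that $\mathsf{RelFreq}(\Sigma',Q')$ is Cook reducible to $\mathsf{RelFreq}(\Sigma,Q)$. -/

import Mathlib

/-! ## Relational databases, functional dependencies, repairs -/

namespace CQA

/-- A relational schema: finitely many relation names `R`, each with an arity.
The attributes of `R` are the elements of `Fin (arity R)`. -/
structure Schema where
  numRel : ℕ
  arity : Fin numRel → ℕ

variable {S : Schema}

/-- A fact `R(c₁,…,cₙ)`; the countably infinite set of constants is `ℕ`. -/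
structure Fact (S : Schema) where
  rel : Fin S.numRel
  val : Fin (S.arity rel) → ℕ
  deriving DecidableEq

/-- A database is a finite set of facts. -/
abbrev Database (S : Schema) := Finset (Fact S)

/-- A functional dependency `R : X → Y` with `X`, `Y` sets of attributes of `R`. -/
structure FD (S : Schema) where
  rel : Fin S.numRel
  lhs : Finset (Fin (S.arity rel))
  rhs : Finset (Fin (S.arity rel))
  deriving DecidableEq

/-- A set of FDs over `S` (automatically finite, as there are finitely many FDs over `S`). -/
abbrev FDSet (S : Schema) := Set (FD S)

/-- `D ⊨ R : X → Y`: any two `R`-facts of `D` that agree on `X` agree on `Y`. -/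
def FD.SatisfiedBy (φ : FD S) (D : Database S) : Prop :=
  ∀ a b : Fin (S.arity φ.rel) → ℕ, Fact.mk φ.rel a ∈ D → Fact.mk φ.rel b ∈ D →
    (∀ A ∈ φ.lhs, a A = b A) → ∀ B ∈ φ.rhs, a B = b B

/-- `D ⊨ F`. -/
def Consistent (F : FDSet S) (D : Database S) : Prop := ∀ φ ∈ F, φ.SatisfiedBy D

/-- Two sets of FDs are equivalent if they are satisfied by the same databases. -/
def Equivalent (F G : FDSet S) : Prop := ∀ D : Database S, Consistent F D ↔ Consistent G D

/-- `F` has a left-hand side chain. -/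
def LHSChain (F : FDSet S) : Prop :=
  ∀ (R : Fin S.numRel) (X₁ Y₁ X₂ Y₂ : Finset (Fin (S.arity R))),
    FD.mk R X₁ Y₁ ∈ F → FD.mk R X₂ Y₂ ∈ F → X₁ ⊆ X₂ ∨ X₂ ⊆ X₁

/-- `F` is canonical: no FD is redundant, no attribute of an FD is redundant, and no two FDs
over the same relation name have the same left-hand side. -/
structure Canonical (F : FDSet S) : Prop where
  no_redundant_fd : ∀ φ ∈ F, ¬ Equivalent (F \ {φ}) F
  no_redundant_lhs : ∀ φ ∈ F, ∀ A ∈ φ.lhs,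
    ¬ Equivalent (insert (FD.mk φ.rel (φ.lhs.erase A) φ.rhs) (F \ {φ})) F
  no_redundant_rhs : ∀ φ ∈ F, ∀ A ∈ φ.rhs,
    ¬ Equivalent (insert (FD.mk φ.rel φ.lhs (φ.rhs.erase A)) (F \ {φ})) F
  lhs_unique : ∀ (R : Fin S.numRel) (X Y Y' : Finset (Fin (S.arity R))),
    FD.mk R X Y ∈ F → FD.mk R X Y' ∈ F → Y = Y'

/-- An FD `R : X → Y` is a key if `X ∪ Y` consists of all the attributes of `R`. -/
def FD.IsKey (φ : FD S) : Prop := φ.lhs ∪ φ.rhs = Finset.univ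

/-- `F` is a set of primary keys: keys only, at most one per relation name. -/
def PrimaryKeys (F : FDSet S) : Prop :=
  (∀ φ ∈ F, φ.IsKey) ∧ ∀ φ ∈ F, ∀ ψ ∈ F, φ.rel = ψ.rel → φ = ψ

/-- The repairs of `D` w.r.t. `F`: the inclusion-maximal consistent subsets of `D`. -/
def repairs (F : FDSet S) (D : Database S) : Set (Database S) :=
  {E | E ⊆ D ∧ Consistent F E ∧ ∀ E' : Database S, E ⊂ E' → E' ⊆ D → ¬ Consistent F E'}

/-! ## Conjunctive queries -/

/-- A term is a constant or a variable (variables are named by natural numbers as well). -/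
inductive Term where
  | const (c : ℕ)
  | var (x : ℕ)
  deriving DecidableEq

/-- `t_{x ↦ c}`. -/
def Term.subst (x c : ℕ) : Term → Term
  | .const d => .const d
  | .var y => if y = x then .const c else .var y

/-- The constant denoted by a term under an assignment of constants to variables. -/
def Term.eval (h : ℕ → ℕ) : Term → ℕ
  | .const d => d
  | .var y => h y

/-- A relational atom `R(t₁,…,tₙ)`. -/
structure Atom (S : Schema) where
  rel : Fin S.numRel
  args : Fin (S.arity rel) → Term
  deriving DecidableEq

/-- `α_{x ↦ c}`. -/
def Atom.subst (x c : ℕ) (α : Atom S) : Atom S := ⟨α.rel, fun A => (α.args A).subst x c⟩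

/-- A Boolean conjunctive query, given by its set of atoms. -/
abbrev CQ (S : Schema) := Finset (Atom S)

/-- No relation name is mentioned more than once. -/
def CQ.SelfJoinFree (Q : CQ S) : Prop := ∀ α ∈ Q, ∀ β ∈ Q, α.rel = β.rel → α = β

/-- `var(Q)`. -/
def CQ.vars (Q : CQ S) : Set ℕ := {x | ∃ α ∈ Q, ∃ A, α.args A = Term.var x}

/-- `Q_{x ↦ c}`. -/
def CQ.subst (x c : ℕ) (Q : CQ S) : CQ S := Finset.image (Atom.subst x c) Q

/-- `D ⊨ Q`: some homomorphism maps every atom of `Q` to a fact of `D`. -/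
def CQ.EntailedBy (Q : CQ S) (D : Database S) : Prop :=
  ∃ h : ℕ → ℕ, ∀ α ∈ Q, Fact.mk α.rel (fun A => (α.args A).eval h) ∈ D

/-- The relative frequency of `Q`: the proportion of repairs of `D` that entail `Q`. -/
noncomputable def relFreq (F : FDSet S) (Q : CQ S) (D : Database S) : ℚ :=
  ({E ∈ repairs F D | Q.EntailedBy E}.ncard : ℚ) / ((repairs F D).ncard : ℚ)

/-! ## Primary FDs, complex part, safety -/

/-- `R : X → Y` (with `R` the relation name of `α`) is the primary FD: it is the first FD of the
chain of `F_R` that mentions an attribute at which `α` has a variable. -/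
def IsPrimaryFD (F : FDSet S) (α : Atom S) (X Y : Finset (Fin (S.arity α.rel))) : Prop :=
  FD.mk α.rel X Y ∈ F ∧
  (∃ A ∈ X ∪ Y, ∃ x, α.args A = Term.var x) ∧
  ∀ X' Y' : Finset (Fin (S.arity α.rel)), FD.mk α.rel X' Y' ∈ F → X' ⊂ X →
    ∀ B ∈ X' ∪ Y', ∃ c, α.args B = Term.const c

/-- `R : X → Y` belongs to the primary prefix: it strictly precedes the primary FD in the chain
of `F_R`, or there is no primary FD. -/
def InPrimaryPrefix (F : FDSet S) (α : Atom S) (X Y : Finset (Fin (S.arity α.rel))) : Prop :=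
  FD.mk α.rel X Y ∈ F ∧
  ∀ X' Y' : Finset (Fin (S.arity α.rel)), IsPrimaryFD F α X' Y' → X ⊂ X'

/-- The position of attribute `A` is a primary-lhs position of `α`: `A` is in the left-hand side
of the primary FD, or there is no primary FD. -/
def PrimaryLhs (F : FDSet S) (α : Atom S) (A : Fin (S.arity α.rel)) : Prop :=
  ∀ X Y : Finset (Fin (S.arity α.rel)), IsPrimaryFD F α X Y → A ∈ X

/-- The variables that occur in `α` at primary-lhs positions. -/
def pvar (F : FDSet S) (α : Atom S) : Set ℕ := {x | ∃ A, PrimaryLhs F α A ∧ α.args A = Term.var x}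

/-- `x` is a liaison variable of `Q`: it has two distinct occurrences in `Q`. -/
def CQ.Liaison (Q : CQ S) (x : ℕ) : Prop :=
  ∃ p q : (α : Atom S) × Fin (S.arity α.rel), p ≠ q ∧ p.1 ∈ Q ∧ q.1 ∈ Q ∧
    p.1.args p.2 = Term.var x ∧ q.1.args q.2 = Term.var x

/-- The complex part of `Q` w.r.t. `F`. -/
def complexPart (F : FDSet S) (Q : CQ S) : Set (Atom S) :=
  {α | α ∈ Q ∧ ∃ A : Fin (S.arity α.rel),
    ¬ PrimaryLhs F α A ∧
    ((∃ c, α.args A = Term.const c) ∨ ∃ x, α.args A = Term.var x ∧ Q.Liaison x) ∧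
    ∀ X Y : Finset (Fin (S.arity α.rel)), InPrimaryPrefix F α X Y → A ∉ X ∪ Y}

/-- `Q` is safe w.r.t. `F`. -/
inductive Safe (F : FDSet S) : CQ S → Prop
  | base (Q : CQ S) : complexPart F Q = ∅ → Safe F Q
  | union (Q₁ Q₂ : CQ S) : Q₁.Nonempty → Q₂.Nonempty → Disjoint Q₁ Q₂ →
      Disjoint Q₁.vars Q₂.vars → Safe F Q₁ → Safe F Q₂ → Safe F (Q₁ ∪ Q₂)
  | lhs (Q : CQ S) (x c : ℕ) : complexPart F Q ≠ ∅ → x ∈ Q.vars →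
      (∀ α ∈ complexPart F Q, x ∈ pvar F α) → Safe F (Q.subst x c) → Safe F Q
  | rhs (Q : CQ S) (x c : ℕ) (α : Atom S) (X Y : Finset (Fin (S.arity α.rel)))
      (A : Fin (S.arity α.rel)) : α ∈ complexPart F Q → pvar F α = ∅ →
      IsPrimaryFD F α X Y → A ∈ Y → α.args A = Term.var x → Safe F (Q.subst x c) → Safe F Q

/-! ## Polynomial-time Turing (Cook) reductions between function problems

The machine model is a structured imperative language with oracle calls, whose variables hold
finite binary trees with natural numbers at the leaves. As in the logarithmic-cost measure for
random access machines, every operation is charged the sizes of its operands and of its result,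
where a natural number counts with the length of its binary expansion. A Turing machine
simulates this model with polynomial overhead and vice versa. -/

/-- Binary trees with natural numbers at the leaves. -/
inductive Val where
  | nat (n : ℕ)
  | pair (a b : Val)
  deriving DecidableEq

namespace Val

/-- The size of a value, natural numbers being written in binary. -/
def size : Val → ℕ
  | nat n => Nat.size n + 1
  | pair a b => a.size + b.size + 1

def fst : Val → Val
  | nat _ => nat 0
  | pair a _ => a

def snd : Val → Val
  | nat _ => nat 0
  | pair _ b => b

def toNat : Val → ℕ
  | nat n => n
  | pair _ _ => 0

def isPair : Val → Val
  | nat _ => nat 0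
  | pair _ _ => nat 1

/-- Lists are nested pairs that end in `nat 0`. -/
def ofList : List Val → Val
  | [] => nat 0
  | v :: l => pair v (ofList l)

theorem ofList_injective : Function.Injective ofList := by
  intro l
  induction l with
  | nil => intro m h; cases m with
    | nil => rfl
    | cons w m => simp [ofList] at h
  | cons v l ih => intro m h; cases m with
    | nil => simp [ofList] at h
    | cons w m =>
      simp only [ofList, pair.injEq] at h
      rw [h.1, ih h.2]

end Val

/-- The values of the program variables. -/
abbrev Store := ℕ → Val

/-- Expressions over the program variables. -/
inductive Expr where
  | var (x : ℕ)
  | lit (v : Val)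
  | pair (e f : Expr)
  | fst (e : Expr)
  | snd (e : Expr)
  | isPair (e : Expr)
  | eq (e f : Expr)
  | lt (e f : Expr)
  | add (e f : Expr)
  | sub (e f : Expr)
  | mul (e f : Expr)
  | div (e f : Expr)

namespace Expr

/-- The value of an expression; truth values are `nat 1` and `nat 0`, and in arithmetic a pair
counts as `0`. Subtraction is truncated, division is rounded down. -/
def eval (s : Store) : Expr → Val
  | var x => s x
  | lit v => v
  | pair e f => Val.pair (e.eval s) (f.eval s)
  | fst e => (e.eval s).fst
  | snd e => (e.eval s).snd
  | isPair e => (e.eval s).isPair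
  | eq e f => if e.eval s = f.eval s then Val.nat 1 else Val.nat 0
  | lt e f => if (e.eval s).toNat < (f.eval s).toNat then Val.nat 1 else Val.nat 0
  | add e f => Val.nat ((e.eval s).toNat + (f.eval s).toNat)
  | sub e f => Val.nat ((e.eval s).toNat - (f.eval s).toNat)
  | mul e f => Val.nat ((e.eval s).toNat * (f.eval s).toNat)
  | div e f => Val.nat ((e.eval s).toNat / (f.eval s).toNat)

/-- The number of steps charged for the evaluation of an expression: for each operation, one plus
the size of its result (the sizes of the operands are charged with the operands). -/
def cost (s : Store) : Expr → ℕ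
  | var x => (s x).size + 1
  | lit v => v.size + 1
  | pair e f => e.cost s + f.cost s + (eval s (pair e f)).size + 1
  | fst e => e.cost s + (eval s (fst e)).size + 1
  | snd e => e.cost s + (eval s (snd e)).size + 1
  | isPair e => e.cost s + (eval s (isPair e)).size + 1
  | eq e f => e.cost s + f.cost s + (eval s (eq e f)).size + 1
  | lt e f => e.cost s + f.cost s + (eval s (lt e f)).size + 1
  | add e f => e.cost s + f.cost s + (eval s (add e f)).size + 1
  | sub e f => e.cost s + f.cost s + (eval s (sub e f)).size + 1
  | mul e f => e.cost s + f.cost s + (eval s (mul e f)).size + 1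
  | div e f => e.cost s + f.cost s + (eval s (div e f)).size + 1

end Expr

/-- Oracle programs. `query x e` hands the value of `e` to the oracle and stores the answer
in `x`. -/
inductive Prog where
  | skip
  | assign (x : ℕ) (e : Expr)
  | query (x : ℕ) (e : Expr)
  | seq (p q : Prog)
  | ite (e : Expr) (p q : Prog)
  | loop (e : Expr) (p : Prog)

/-- A function problem: a set of instances, their representations by values (an instance may
have several representations, but distinct instances have none in common), and the value that is
asked for. -/
structure Problem where
  Inst : Type
  Repr : Val → Inst → Prop
  answer : Inst → Val
  repr_exists : ∀ i, ∃ v, Repr v i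
  repr_unique : ∀ v i j, Repr v i → Repr v j → i = j

/-- `Exec B p s s' t`: with an oracle for `B`, program `p` started in store `s` halts in store
`s'` after `t` steps. Only representations of instances of `B` may be handed to the oracle. -/
inductive Exec (B : Problem) : Prog → Store → Store → ℕ → Prop
  | skip (s : Store) : Exec B .skip s s 1
  | assign (s : Store) (x : ℕ) (e : Expr) :
      Exec B (.assign x e) s (Function.update s x (e.eval s)) (e.cost s + 1)
  | query (s : Store) (x : ℕ) (e : Expr) (i : B.Inst) : B.Repr (e.eval s) i →
      Exec B (.query x e) s (Function.update s x (B.answer i)) (e.cost s + (B.answer i).size + 1)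
  | seq (s s' s'' : Store) (p q : Prog) (t u : ℕ) :
      Exec B p s s' t → Exec B q s' s'' u → Exec B (.seq p q) s s'' (t + u + 1)
  | ite_true (s s' : Store) (e : Expr) (p q : Prog) (t : ℕ) : e.eval s ≠ Val.nat 0 →
      Exec B p s s' t → Exec B (.ite e p q) s s' (e.cost s + t + 1)
  | ite_false (s s' : Store) (e : Expr) (p q : Prog) (t : ℕ) : e.eval s = Val.nat 0 →
      Exec B q s s' t → Exec B (.ite e p q) s s' (e.cost s + t + 1)
  | loop_true (s s' s'' : Store) (e : Expr) (p : Prog) (t u : ℕ) : e.eval s ≠ Val.nat 0 →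
      Exec B p s s' t → Exec B (.loop e p) s' s'' u →
      Exec B (.loop e p) s s'' (e.cost s + t + u + 1)
  | loop_false (s : Store) (e : Expr) (p : Prog) : e.eval s = Val.nat 0 →
      Exec B (.loop e p) s s (e.cost s + 1)

/-- The initial store: the input is in variable `0`, and all other variables are `0`. -/
def initStore (v : Val) : Store := fun x => if x = 0 then v else Val.nat 0

/-- `A` is Cook reducible to `B`: some program with an oracle for `B` computes, on every
representation of every instance of `A`, the answer to that instance (left in variable `0`)
within a number of steps that is polynomial in the size of the representation. -/
def CookReducible (A B : Problem) : Prop :=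
  ∃ (p : Prog) (T : Polynomial ℕ), ∀ (i : A.Inst) (v : Val), A.Repr v i →
    ∃ (s : Store) (t : ℕ), Exec B p (initStore v) s t ∧ s 0 = A.answer i ∧ t ≤ T.eval v.size

/-! ## The problem `RelFreq` -/

/-- The encoding of the fact `R(c₁,…,cₙ)`. -/
def Fact.encode (f : Fact S) : Val :=
  Val.pair (Val.nat f.rel) (Val.ofList (List.ofFn fun A => Val.nat (f.val A)))

theorem Fact.encode_injective : Function.Injective (Fact.encode (S := S)) := by
  rintro ⟨R, a⟩ ⟨R', b⟩ h
  simp only [Fact.encode, Val.pair.injEq, Val.nat.injEq] at h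
  obtain ⟨h1, h2⟩ := h
  obtain rfl : R = R' := Fin.ext h1
  have h3 := List.ofFn_injective (Val.ofList_injective h2)
  have h4 : a = b := by
    funext A
    simpa using congrFun h3 A
  rw [h4]

/-- A database is represented by a list of its facts, in any order, possibly with
repetitions. -/
def DatabaseRepr (v : Val) (D : Database S) : Prop :=
  ∃ l : List (Fact S), l.toFinset = D ∧ v = Val.ofList (l.map Fact.encode)

/-- A nonnegative rational number is represented by its numerator and denominator in lowest
terms. -/
def encodeRat (q : ℚ) : Val := Val.pair (Val.nat q.num.toNat) (Val.nat q.den)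

/-- The problem `RelFreq(F, Q)`: given a database `D`, compute the relative frequency of `Q`. -/
noncomputable def RelFreq (F : FDSet S) (Q : CQ S) : Problem where
  Inst := Database S
  Repr := DatabaseRepr
  answer D := encodeRat (relFreq F Q D)
  repr_exists D := ⟨_, D.toList, D.toList_toFinset, rfl⟩
  repr_unique := by
    rintro v i j ⟨l, rfl, rfl⟩ ⟨m, rfl, h⟩
    rw [List.map_injective_iff.2 Fact.encode_injective (Val.ofList_injective h)]

end CQA

/-! The reduction is many-one: a database over the new schema is turned in polynomial time into a
database over the old schema with the same relative frequency, and the oracle is asked once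
(`cookReducible_of_map`).

The query is shrunk to a part to which no rule of safety applies. Consider subsets `P` of `Q` with a
partial assignment `τ` such that `P` under `τ` is not safe, shares no unassigned variable with the
other atoms, and every assigned variable has an occurrence where the constructed databases can only
contain its constant. If the number of atoms plus the number of unassigned variables is minimal,
each applicable rule would lead to safe queries only, so none applies (`exists_final_part`). Hence
every complex atom has a primary-lhs variable, no variable is a primary-lhs variable of all complex
atoms, and the query is connected.

Each relation of `P` is then split into one relation per governed attribute `A`, with the left-hand
side that determines `A` as its key (the other positions are padded by `0`), and one keyless
relation for all ungoverned attributes. Normally the governed attributes are those in the right-hand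
sides from the primary FD on. If the primary right-hand side has only variables that occur once, its
split atoms would not be complex; it then stores a code of the whole fact, so that the primary
left-hand side governs every attribute outside itself and the primary prefix. Either way a complex
atom yields a split atom whose key is the primary left-hand side and whose remaining position is
complex. So no rule applies to the split query either (`Split.final_query`), and it is not safe.

FDs constrain pairs of facts, so repairs are the maximal independent sets of a conflict graph; for
primary keys they choose one fact from each block. An old fact is put into the database if all its
projections are present, and two such facts conflict iff some of their projections are distinct
members of one block. Keys contain no governed attributes, so the values chosen by a repair can be
put in for the governed attributes without leaving the blocks. Therefore the repairs of the new
database correspond to pairs of a repair of the old one and a choice in the untouched blocks, and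
the second factor cancels in the quotient (`maxIndep_ratio`). Atoms outside `P` contribute one fixed
fact each, which is in no conflict (`correct_plan`). -/

namespace CQA

/-! ## Polynomially bounded programs -/

/-- `g` is given by a polynomial with natural coefficients. -/
def IsPoly (g : ℕ → ℕ) : Prop := ∃ T : Polynomial ℕ, ∀ n, g n = T.eval n

namespace IsPoly

theorem const (c : ℕ) : IsPoly fun _ => c := ⟨Polynomial.C c, fun n => by simp⟩

theorem id : IsPoly fun n => n := ⟨Polynomial.X, fun n => by simp⟩

theorem add {g h : ℕ → ℕ} (hg : IsPoly g) (hh : IsPoly h) : IsPoly fun n => g n + h n := by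
  obtain ⟨T, hT⟩ := hg
  obtain ⟨U, hU⟩ := hh
  exact ⟨T + U, fun n => by simp [hT, hU]⟩

theorem mul {g h : ℕ → ℕ} (hg : IsPoly g) (hh : IsPoly h) : IsPoly fun n => g n * h n := by
  obtain ⟨T, hT⟩ := hg
  obtain ⟨U, hU⟩ := hh
  exact ⟨T * U, fun n => by simp [hT, hU]⟩

theorem comp {g h : ℕ → ℕ} (hg : IsPoly g) (hh : IsPoly h) : IsPoly fun n => g (h n) := by
  obtain ⟨T, hT⟩ := hg
  obtain ⟨U, hU⟩ := hh
  exact ⟨T.comp U, fun n => by simp [hT, hU, Polynomial.eval_comp]⟩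

theorem mono {g : ℕ → ℕ} (hg : IsPoly g) {m n : ℕ} (h : m ≤ n) : g m ≤ g n := by
  obtain ⟨T, hT⟩ := hg
  rw [hT, hT]
  clear hT
  induction T using Polynomial.induction_on' with
  | add p q hp hq =>
    simp only [Polynomial.eval_add]
    exact Nat.add_le_add hp hq
  | monomial i a =>
    simp only [Polynomial.eval_monomial]
    gcongr

end IsPoly

theorem Expr.size_eval_le_cost (s : Store) (e : Expr) : (e.eval s).size ≤ e.cost s := by
  cases e <;> simp only [Expr.cost] <;> first | omega | (simp only [Expr.eval]; omega)

/-- `f` is computed in polynomial time by a program that reads its input from variable `0`,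
leaves its output there, and preserves all but finitely many variables. -/
def PF (B : Problem) (f : Val → Val) : Prop :=
  ∃ (p : Prog) (k : ℕ) (b : ℕ → ℕ), IsPoly b ∧ 0 < k ∧ ∀ s : Store, ∃ (s' : Store) (t : ℕ),
    Exec B p s s' t ∧ s' 0 = f (s 0) ∧ (∀ x, k ≤ x → s' x = s x) ∧
    t ≤ b (s 0).size ∧ (f (s 0)).size ≤ b (s 0).size

namespace PF

variable {B : Problem}

theorem of_expr {f : Val → Val} {b : ℕ → ℕ} (e : Expr) (hb : IsPoly b)
    (he : ∀ s, e.eval s = f (s 0)) (hc : ∀ s, e.cost s ≤ b (s 0).size) : PF B f := by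
  refine ⟨.assign 0 e, 1, fun n => b n + 1, hb.add (.const 1), one_pos, fun s =>
    ⟨_, _, Exec.assign s 0 e, ?_, ?_, ?_, ?_⟩⟩
  · simp [he]
  · intro x hx
    exact Function.update_of_ne (by omega) _ _
  · exact Nat.add_le_add_right (hc s) 1
  · rw [← he]
    exact (e.size_eval_le_cost s).trans ((hc s).trans (Nat.le_succ _))

protected theorem id : PF B fun v => v :=
  of_expr (.var 0) (b := fun n => n + 1) (.add .id (.const 1)) (fun _ => rfl)
    (fun _ => by simp [Expr.cost])

theorem const (v : Val) : PF B fun _ => v :=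
  of_expr (.lit v) (.const (v.size + 1)) (fun _ => rfl) (fun _ => by simp [Expr.cost])

theorem size_fst_le (v : Val) : v.fst.size ≤ v.size := by
  cases v <;> simp [Val.size, Val.fst]; omega

theorem size_snd_le (v : Val) : v.snd.size ≤ v.size := by
  cases v <;> simp [Val.size, Val.snd]; omega

theorem size_isPair_le (v : Val) : v.isPair.size ≤ 2 := by
  cases v <;> simp [Val.size, Val.isPair]

theorem fst₀ : PF B Val.fst :=
  of_expr (.fst (.var 0)) (b := fun n => 2 * n + 3) (.add (.mul (.const 2) .id) (.const 3))
    (fun _ => rfl) (fun s => by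
      have := size_fst_le (s 0)
      simp only [Expr.cost, Expr.eval]; omega)

theorem snd₀ : PF B Val.snd :=
  of_expr (.snd (.var 0)) (b := fun n => 2 * n + 3) (.add (.mul (.const 2) .id) (.const 3))
    (fun _ => rfl) (fun s => by
      have := size_snd_le (s 0)
      simp only [Expr.cost, Expr.eval]; omega)

theorem isPair₀ : PF B Val.isPair :=
  of_expr (.isPair (.var 0)) (b := fun n => n + 4) (.add .id (.const 4))
    (fun _ => rfl) (fun s => by
      have := size_isPair_le (s 0)
      simp only [Expr.cost, Expr.eval]; omega)

/-- The output bound in `PF` is needed here: it bounds the input of the second program, hence its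
running time. -/
theorem comp {f g : Val → Val} (hg : PF B g) (hf : PF B f) : PF B fun v => g (f v) := by
  obtain ⟨p, k, b, hb, hk, hp⟩ := hf
  obtain ⟨q, l, c, hc, hl, hq⟩ := hg
  refine ⟨.seq p q, max k l, fun n => b n + c (b n) + 1,
    (hb.add (hc.comp hb)).add (.const 1), by omega, fun s => ?_⟩
  obtain ⟨s₁, t₁, e₁, h₁, r₁, u₁, z₁⟩ := hp s
  obtain ⟨s₂, t₂, e₂, h₂, r₂, u₂, z₂⟩ := hq s₁
  rw [h₁] at h₂ u₂ z₂
  have := hc.mono z₁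
  refine ⟨s₂, _, Exec.seq _ _ _ _ _ _ _ e₁ e₂, h₂, fun x hx => ?_, by dsimp only; omega,
    by dsimp only; omega⟩
  rw [r₂ x (by omega), r₁ x (by omega)]

theorem fst {f : Val → Val} (hf : PF B f) : PF B fun v => (f v).fst := fst₀.comp hf

theorem snd {f : Val → Val} (hf : PF B f) : PF B fun v => (f v).snd := snd₀.comp hf

theorem isPair {f : Val → Val} (hf : PF B f) : PF B fun v => (f v).isPair := isPair₀.comp hf

/-- Both arguments are computed from the same input. The variables `m` and `m + 1` lie beyond those
that either program changes, so they safely hold the input and the first result. -/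
theorem binary {f g : Val → Val} (hf : PF B f) (hg : PF B g) (op : Expr → Expr → Expr)
    (F : Val → Val → Val) (he : ∀ s e₁ e₂, (op e₁ e₂).eval s = F (e₁.eval s) (e₂.eval s))
    (hcost : ∀ s e₁ e₂, (op e₁ e₂).cost s = e₁.cost s + e₂.cost s + ((op e₁ e₂).eval s).size + 1)
    (hF : ∀ a b, (F a b).size ≤ a.size + b.size + 2) : PF B fun v => F (f v) (g v) := by
  obtain ⟨p, k, b, hb, hk, hp⟩ := hf
  obtain ⟨q, l, c, hc, hl, hq⟩ := hg
  set m := max k l with hm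
  refine ⟨.seq (.assign m (.var 0)) (.seq p (.seq (.assign (m + 1) (.var 0))
    (.seq (.assign 0 (.var m)) (.seq q (.assign 0 (op (.var (m + 1)) (.var 0))))))), m + 2,
    fun n => 2 * n + 4 * b n + 3 * c n + 20, ?_, by omega, fun s => ?_⟩
  · exact (((IsPoly.const 2).mul .id).add ((IsPoly.const 4).mul hb) |>.add
      ((IsPoly.const 3).mul hc)).add (.const 20)
  obtain ⟨s₁, t₁, e₁, h₁, r₁, u₁, z₁⟩ := hp (Function.update s m (s 0))
  have hm0 : (0 : ℕ) ≠ m := by omega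
  rw [Function.update_of_ne hm0] at h₁ u₁ z₁
  obtain ⟨s₂, t₂, e₂, h₂, r₂, u₂, z₂⟩ := hq
    (Function.update (Function.update s₁ (m + 1) (s₁ 0)) 0 (s 0))
  rw [Function.update_self] at h₂ u₂ z₂
  have hs1m : s₁ m = s 0 := by rw [r₁ m (by omega)]; simp
  have hs2m : s₂ (m + 1) = f (s 0) := by
    rw [r₂ _ (by omega), Function.update_of_ne (by omega), Function.update_self, h₁]
  have x1 := Exec.assign (B := B) s m (.var 0)
  have x2 := Exec.assign (B := B) s₁ (m + 1) (.var 0)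
  have x3 := Exec.assign (B := B) (Function.update s₁ (m + 1) (s₁ 0)) 0 (.var m)
  have hv : (Function.update s₁ (m + 1) (s₁ 0)) m = s 0 := by
    rw [Function.update_of_ne (by omega), hs1m]
  simp only [Expr.eval, Expr.cost] at x1 x2 x3
  rw [hv] at x3
  have x4 := Exec.assign (B := B) s₂ 0 (op (.var (m + 1)) (.var 0))
  rw [hcost, he] at x4
  simp only [Expr.eval, Expr.cost, hs2m, h₂] at x4
  refine ⟨_, _, .seq _ _ _ _ _ _ _ x1 (.seq _ _ _ _ _ _ _ e₁ (.seq _ _ _ _ _ _ _ x2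
    (.seq _ _ _ _ _ _ _ x3 (.seq _ _ _ _ _ _ _ e₂ x4)))), ?_, ?_, ?_, ?_⟩
  · simp
  · intro x hx
    rw [Function.update_of_ne (by omega), r₂ x (by omega), Function.update_of_ne (by omega),
      Function.update_of_ne (by omega), r₁ x (by omega), Function.update_of_ne (by omega)]
  · have := hF (f (s 0)) (g (s 0))
    rw [h₁]
    dsimp only
    omega
  · have := hF (f (s 0)) (g (s 0))
    dsimp only
    omega

theorem pair {f g : Val → Val} (hf : PF B f) (hg : PF B g) : PF B fun v => Val.pair (f v) (g v) :=
  binary hf hg .pair Val.pair (fun _ _ _ => rfl) (fun _ _ _ => rfl)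
    (fun a b => by simp [Val.size])

theorem size_toNat_le (v : Val) : Nat.size v.toNat + 1 ≤ v.size := by
  cases v <;> simp [Val.size, Val.toNat]

theorem add {f g : Val → Val} (hf : PF B f) (hg : PF B g) :
    PF B fun v => Val.nat ((f v).toNat + (g v).toNat) :=
  binary hf hg .add (fun a b => Val.nat (a.toNat + b.toNat)) (fun _ _ _ => rfl)
    (fun _ _ _ => rfl) (fun a b => by
      have ha := size_toNat_le a
      have hb := size_toNat_le b
      have h : Nat.size (a.toNat + b.toNat) ≤ Nat.size a.toNat + Nat.size b.toNat + 1 := by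
        rw [Nat.size_le, pow_succ, pow_add]
        have h1 := Nat.lt_size_self a.toNat
        have h2 := Nat.lt_size_self b.toNat
        have h3 : 1 ≤ 2 ^ Nat.size a.toNat := Nat.one_le_two_pow
        have h4 : 1 ≤ 2 ^ Nat.size b.toNat := Nat.one_le_two_pow
        nlinarith
      simp only [Val.size]; omega)

theorem mul {f g : Val → Val} (hf : PF B f) (hg : PF B g) :
    PF B fun v => Val.nat ((f v).toNat * (g v).toNat) :=
  binary hf hg .mul (fun a b => Val.nat (a.toNat * b.toNat)) (fun _ _ _ => rfl)
    (fun _ _ _ => rfl) (fun a b => by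
      have ha := size_toNat_le a
      have hb := size_toNat_le b
      have h : Nat.size (a.toNat * b.toNat) ≤ Nat.size a.toNat + Nat.size b.toNat := by
        rw [Nat.size_le, pow_add]
        exact Nat.mul_lt_mul'' (Nat.lt_size_self _) (Nat.lt_size_self _)
      simp only [Val.size]; omega)

theorem eq {f g : Val → Val} (hf : PF B f) (hg : PF B g) :
    PF B fun v => if f v = g v then Val.nat 1 else Val.nat 0 :=
  binary hf hg .eq (fun a b => if a = b then Val.nat 1 else Val.nat 0) (fun _ _ _ => rfl)
    (fun _ _ _ => rfl) (fun a b => by split_ifs <;> simp [Val.size])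

theorem ite {c f g : Val → Val} (hc : PF B c) (hf : PF B f) (hg : PF B g) :
    PF B fun v => if c v = Val.nat 0 then g v else f v := by
  obtain ⟨p, k, b, hb, hk, hp⟩ := hc
  obtain ⟨q, l, d, hd, hl, hq⟩ := hf
  obtain ⟨r, n, e, he, hn, hr⟩ := hg
  set m := max k (max l n) with hm
  refine ⟨.seq (.assign m (.var 0)) (.seq p (.ite (.var 0)
    (.seq (.assign 0 (.var m)) q) (.seq (.assign 0 (.var m)) r))), m + 1,
    fun n => 2 * n + 2 * b n + d n + e n + 20, ?_, by omega, fun s => ?_⟩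
  · exact (((((IsPoly.const 2).mul .id).add ((IsPoly.const 2).mul hb)).add hd).add he).add
      (.const 20)
  obtain ⟨s₁, t₁, e₁, h₁, r₁, u₁, z₁⟩ := hp (Function.update s m (s 0))
  have hm0 : (0 : ℕ) ≠ m := by omega
  rw [Function.update_of_ne hm0] at h₁ u₁ z₁
  have hs1m : s₁ m = s 0 := by rw [r₁ m (by omega)]; simp
  have x1 := Exec.assign (B := B) s m (.var 0)
  have x2 := Exec.assign (B := B) s₁ 0 (.var m)
  simp only [Expr.eval, Expr.cost, hs1m] at x1 x2
  by_cases hz : c (s 0) = Val.nat 0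
  · obtain ⟨s₂, t₂, e₂, h₂, r₂, u₂, z₂⟩ := hr (Function.update s₁ 0 (s 0))
    rw [Function.update_self] at h₂ u₂ z₂
    refine ⟨_, _, .seq _ _ _ _ _ _ _ x1 (.seq _ _ _ _ _ _ _ e₁ (.ite_false _ _ _ _ _ _
      (by simp [Expr.eval, h₁, hz]) (.seq _ _ _ _ _ _ _ x2 e₂))), ?_, ?_, ?_, ?_⟩
    · simp [h₂, hz]
    · intro x hx
      rw [r₂ x (by omega), Function.update_of_ne (by omega), r₁ x (by omega),
        Function.update_of_ne (by omega)]
    · simp only [Expr.cost, h₁]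
      omega
    · simp only [hz, if_true]
      omega
  · obtain ⟨s₂, t₂, e₂, h₂, r₂, u₂, z₂⟩ := hq (Function.update s₁ 0 (s 0))
    rw [Function.update_self] at h₂ u₂ z₂
    refine ⟨_, _, .seq _ _ _ _ _ _ _ x1 (.seq _ _ _ _ _ _ _ e₁ (.ite_true _ _ _ _ _ _
      (by simp [Expr.eval, h₁, hz]) (.seq _ _ _ _ _ _ _ x2 e₂))), ?_, ?_, ?_, ?_⟩
    · simp [h₂, hz]
    · intro x hx
      rw [r₂ x (by omega), Function.update_of_ne (by omega), r₁ x (by omega),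
        Function.update_of_ne (by omega)]
    · simp only [Expr.cost, h₁]
      omega
    · simp only [hz, if_false]
      omega

end PF

end CQA

namespace CQA

/-! ## Programs that produce lists -/

/-- The entries of a list. -/
def Val.elems : Val → List Val
  | .nat _ => []
  | .pair a b => a :: b.elems

/-- The list `v` with the values `l` put in front. -/
def Val.app (l : List Val) (v : Val) : Val := l.foldr Val.pair v

/-- The size that the entries `l` contribute to a list. -/
def Val.weight (l : List Val) : ℕ := (l.map fun v => v.size + 1).sum

namespace Val

theorem elems_ofList (l : List Val) : (ofList l).elems = l := by
  induction l with
  | nil => rfl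
  | cons a l ih => simp [ofList, elems, ih]

theorem app_append (l m : List Val) (v : Val) : app (l ++ m) v = app l (app m v) := by
  simp [app]

theorem app_ofList (l m : List Val) : app l (ofList m) = ofList (l ++ m) := by
  induction l with
  | nil => rfl
  | cons a l ih => simp only [app, List.foldr_cons] at ih ⊢; simp [ih, ofList]

theorem app_nat_zero (l : List Val) : app l (nat 0) = ofList l := by
  simpa [ofList] using app_ofList l []

theorem size_app (l : List Val) (v : Val) : (app l v).size = v.size + weight l := by
  induction l with
  | nil => simp [app, weight]
  | cons a l ih =>
    simp only [app, List.foldr_cons, weight, List.map_cons, List.sum_cons] at ih ⊢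
    simp only [size, ih]; omega

end Val

/-- The list-valued function `H` is computed in polynomial time, putting its entries in front of a
given list. -/
def PL (B : Problem) (H : Val → List Val) : Prop := PF B fun w => Val.app (H w.fst) w.snd

/-- Each pass puts the entries for the next element in front of the accumulator, whence the
reversal. These entries do not depend on the accumulator, so its size grows by a bounded summand per
pass; a bound of the form "polynomial in the previous size" would not survive iteration. `N` bounds
the accumulator throughout. -/
theorem PL.loop_exec {B : Problem} {H : Val → List Val} {p : Prog} {k : ℕ} {b : ℕ → ℕ}
    (hb : IsPoly b) (hk : 0 < k)
    (hp : ∀ s : Store, ∃ (s' : Store) (t : ℕ), Exec B p s s' t ∧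
      s' 0 = Val.app (H (s 0).fst) (s 0).snd ∧ (∀ x, k ≤ x → s' x = s x) ∧
      t ≤ b (s 0).size ∧ (Val.app (H (s 0).fst) (s 0).snd).size ≤ b (s 0).size)
    (env : Val) (r N : ℕ) (rest : Val) : ∀ (acc : Val) (s : Store), rest.size ≤ r →
      s k = env → s (k + 1) = rest → s (k + 2) = acc →
      acc.size + rest.elems.length * b (env.size + r + 3) ≤ N →
      ∃ (s' : Store) (t : ℕ),
        Exec B (.loop (.isPair (.var (k + 1)))
          (.seq (.assign 0 (.pair (.pair (.var k) (.fst (.var (k + 1)))) (.var (k + 2))))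
            (.seq p (.seq (.assign (k + 2) (.var 0))
              (.assign (k + 1) (.snd (.var (k + 1)))))))) s s' t ∧
        s' (k + 2) = Val.app (rest.elems.reverse.flatMap fun e => H (.pair env e)) acc ∧
        (∀ x, k + 3 ≤ x → s' x = s x) ∧
        t ≤ (rest.elems.length + 1) *
          (40 * (env.size + r + N + 1) + 2 * b (env.size + r + N + 2)) ∧
        (Val.app (rest.elems.reverse.flatMap fun e => H (.pair env e)) acc).size ≤ N := by
  induction rest with
  | nat n =>
    intro acc s hr h0 h1 h2 hN
    refine ⟨s, _, .loop_false _ _ _ (by simp [Expr.eval, h1, Val.isPair]), ?_, fun _ _ => rfl,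
      ?_, ?_⟩
    · simp [h2, Val.elems, Val.app]
    · simp only [Expr.cost, Expr.eval, h1, Val.isPair, Val.elems, List.length_nil]
      simp only [Val.size, Nat.size_zero] at hr ⊢
      omega
    · simp only [Val.elems, Val.app, List.length_nil] at hN ⊢
      simpa using hN
  | pair a rest _ ih =>
    intro acc s hr h0 h1 h2 hN
    simp only [Val.elems, List.length_cons] at hN ⊢
    have x1 := Exec.assign (B := B) s 0
      (.pair (.pair (.var k) (.fst (.var (k + 1)))) (.var (k + 2)))
    simp only [Expr.eval, Expr.cost, h0, h1, h2, Val.fst] at x1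
    obtain ⟨s₂, t₂, e₂, v₂, r₂, u₂, z₂⟩ := hp
      (Function.update s 0 (Val.pair (Val.pair env a) acc))
    rw [Function.update_self] at v₂ u₂ z₂
    simp only [Val.fst, Val.snd] at v₂ z₂
    -- A run with the empty accumulator bounds the weight of the new entries independently of `acc`.
    obtain ⟨-, -, -, -, -, -, z₀⟩ := hp (fun _ => Val.pair (Val.pair env a) (Val.nat 0))
    simp only [Val.fst, Val.snd, Val.size_app] at z₀
    have hw : Val.weight (H (Val.pair env a)) ≤ b (env.size + r + 3) := by
      refine le_trans (Nat.le_add_left _ _) (z₀.trans (hb.mono ?_))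
      simp only [Val.size, Nat.size_zero] at hr ⊢
      omega
    have x3 := Exec.assign (B := B) s₂ (k + 2) (.var 0)
    simp only [Expr.eval, Expr.cost, v₂] at x3
    have x4 := Exec.assign (B := B)
      (Function.update s₂ (k + 2) (Val.app (H (Val.pair env a)) acc)) (k + 1)
      (.snd (.var (k + 1)))
    have hs1 : Function.update s₂ (k + 2) (Val.app (H (Val.pair env a)) acc) (k + 1)
        = Val.pair a rest := by
      rw [Function.update_of_ne (by omega), r₂ _ (by omega), Function.update_of_ne (by omega), h1]
    simp only [Expr.eval, Expr.cost, hs1, Val.snd] at x4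
    have hsz := Val.size_app (H (Val.pair env a)) acc
    have hmul : (rest.elems.length + 1) * b (env.size + r + 3)
      = rest.elems.length * b (env.size + r + 3) + b (env.size + r + 3) := by ring
    obtain ⟨s₃, t₃, e₃, v₃, r₃, u₃, z₃⟩ := ih (Val.app (H (Val.pair env a)) acc)
      (Function.update (Function.update s₂ (k + 2) (Val.app (H (Val.pair env a)) acc)) (k + 1)
        rest)
      (by simp only [Val.size] at hr; omega)
      (by rw [Function.update_of_ne (by omega), Function.update_of_ne (by omega), r₂ _ (by omega),
        Function.update_of_ne (by omega), h0])
      (by simp)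
      (by rw [Function.update_of_ne (by omega)]; simp)
      (by rw [hsz]; omega)
    have happ : Val.app ((a :: rest.elems).reverse.flatMap fun e => H (.pair env e)) acc =
        Val.app (rest.elems.reverse.flatMap fun e => H (.pair env e))
          (Val.app (H (Val.pair env a)) acc) := by
      rw [← Val.app_append]; simp
    refine ⟨s₃, _, .loop_true _ _ _ _ _ _ _ (by simp [Expr.eval, h1, Val.isPair])
      (.seq _ _ _ _ _ _ _ x1 (.seq _ _ _ _ _ _ _ e₂ (.seq _ _ _ _ _ _ _ x3 x4))) e₃,
      by rw [v₃, happ], fun x hx => ?_, ?_, by rw [happ]; exact z₃⟩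
    · rw [r₃ x hx, Function.update_of_ne (by omega), Function.update_of_ne (by omega),
        r₂ x (by omega), Function.update_of_ne (by omega)]
    · have hacc : acc.size ≤ N := le_trans (Nat.le_add_right _ _) hN
      have hb' : b (Val.pair (Val.pair env a) acc).size ≤ b (env.size + r + N + 2) :=
        hb.mono (by simp only [Val.size] at hr ⊢; omega)
      have hN' : acc.size + Val.weight (H (Val.pair env a)) ≤ N := by omega
      have hexp : (rest.elems.length + 1 + 1) *
          (40 * (env.size + r + N + 1) + 2 * b (env.size + r + N + 2)) =
          (rest.elems.length + 1) *
          (40 * (env.size + r + N + 1) + 2 * b (env.size + r + N + 2)) +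
          (40 * (env.size + r + N + 1) + 2 * b (env.size + r + N + 2)) := by ring
      rw [hexp]
      simp only [Expr.cost, Expr.eval, h1, Val.isPair, hsz]
      simp only [Val.size] at hr ⊢
      have : Nat.size 1 = 1 := by simp
      omega

theorem PL.loop {B : Problem} {H : Val → List Val} (hH : PL B H) :
    PF B fun w => Val.app (w.snd.fst.elems.reverse.flatMap fun e => H (.pair w.fst e))
      w.snd.snd := by
  obtain ⟨p, k, b, hb, hk, hp⟩ := hH
  have hlen : ∀ v : Val, v.elems.length ≤ v.size := by
    intro v
    induction v with
    | nat n => simp [Val.elems]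
    | pair a v _ ih => simp only [Val.elems, Val.size, List.length_cons]; omega
  refine ⟨.seq (.assign k (.fst (.var 0))) (.seq (.assign (k + 1) (.fst (.snd (.var 0))))
    (.seq (.assign (k + 2) (.snd (.snd (.var 0)))) (.seq (.loop (.isPair (.var (k + 1)))
          (.seq (.assign 0 (.pair (.pair (.var k) (.fst (.var (k + 1)))) (.var (k + 2))))
            (.seq p (.seq (.assign (k + 2) (.var 0))
              (.assign (k + 1) (.snd (.var (k + 1)))))))) (.assign 0 (.var (k + 2)))))), k + 3,
    fun n => (n + 1) * (40 * (n + n + (n + n * b (n + n + 3)) + 1) +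
      2 * b (n + n + (n + n * b (n + n + 3)) + 2)) + 20 * n + 40 + 2 * (n + n * b (n + n + 3)),
    ?_, by omega, fun s => ?_⟩
  · have h1 : IsPoly fun n => n + n * b (n + n + 3) :=
      IsPoly.id.add (IsPoly.id.mul (hb.comp ((IsPoly.id.add .id).add (.const 3))))
    have h2 : IsPoly fun n => n + n + (n + n * b (n + n + 3)) := (IsPoly.id.add .id).add h1
    exact ((((IsPoly.id.add (.const 1)).mul (((IsPoly.const 40).mul (h2.add (.const 1))).add
      ((IsPoly.const 2).mul (hb.comp (h2.add (.const 2)))))).add ((IsPoly.const 20).mul .id)).add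
      (.const 40)).add ((IsPoly.const 2).mul h1)
  · set v := s 0 with hv
    set n := v.size with hn
    have s1 := PF.size_fst_le v
    have s2 := PF.size_snd_le v
    have s3 := PF.size_fst_le v.snd
    have s4 := PF.size_snd_le v.snd
    have x1 := Exec.assign (B := B) s k (.fst (.var 0))
    simp only [Expr.eval, Expr.cost, ← hv] at x1
    have x2 := Exec.assign (B := B) (Function.update s k v.fst) (k + 1) (.fst (.snd (.var 0)))
    have hk0 : (0 : ℕ) ≠ k := by omega
    simp only [Expr.eval, Expr.cost, Function.update_of_ne hk0, ← hv] at x2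
    have x3 := Exec.assign (B := B)
      (Function.update (Function.update s k v.fst) (k + 1) v.snd.fst) (k + 2)
      (.snd (.snd (.var 0)))
    have hk1 : (0 : ℕ) ≠ k + 1 := by omega
    simp only [Expr.eval, Expr.cost, Function.update_of_ne hk0, Function.update_of_ne hk1,
      ← hv] at x3
    have hmono := hb.mono (show v.fst.size + n + 3 ≤ n + n + 3 by omega)
    have hlen' := hlen v.snd.fst
    -- An input of size `n` has at most `n` list entries, each of which adds at most `b (n + n + 3)`
    -- to an accumulator that starts with size at most `n`.
    obtain ⟨s₄, t₄, e₄, v₄, r₄, u₄, z₄⟩ := PL.loop_exec hb hk hp v.fst n (n + n * b (n + n + 3))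
      v.snd.fst v.snd.snd
      (Function.update (Function.update (Function.update s k v.fst) (k + 1) v.snd.fst) (k + 2)
        v.snd.snd) (by omega)
      (by rw [Function.update_of_ne (by omega), Function.update_of_ne (by omega),
        Function.update_self])
      (by rw [Function.update_of_ne (by omega), Function.update_self])
      (by rw [Function.update_self])
      (Nat.add_le_add (by omega) (Nat.mul_le_mul (by omega) hmono))
    have x5 := Exec.assign (B := B) s₄ 0 (.var (k + 2))
    simp only [Expr.eval, Expr.cost, v₄] at x5
    refine ⟨_, _, .seq _ _ _ _ _ _ _ x1 (.seq _ _ _ _ _ _ _ x2 (.seq _ _ _ _ _ _ _ x3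
      (.seq _ _ _ _ _ _ _ e₄ x5))), by simp, fun x hx => ?_, ?_, ?_⟩
    · rw [Function.update_of_ne (by omega), r₄ x hx, Function.update_of_ne (by omega),
        Function.update_of_ne (by omega), Function.update_of_ne (by omega)]
    · have := Nat.mul_le_mul (show v.snd.fst.elems.length + 1 ≤ n + 1 by omega)
        (Nat.add_le_add (Nat.mul_le_mul_left 40
          (show v.fst.size + n + (n + n * b (n + n + 3)) + 1 ≤
            n + n + (n + n * b (n + n + 3)) + 1 by omega))
        (Nat.mul_le_mul_left 2 (hb.mono
          (show v.fst.size + n + (n + n * b (n + n + 3)) + 2 ≤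
            n + n + (n + n * b (n + n + 3)) + 2 by omega))))
      have u₄' := u₄.trans this
      dsimp only
      generalize (n + 1) * (40 * (n + n + (n + n * b (n + n + 3)) + 1) +
        2 * b (n + n + (n + n * b (n + n + 3)) + 2)) = K at *
      generalize n * b (n + n + 3) = J at *
      omega
    · refine z₄.trans ?_
      dsimp only
      omega

namespace PL

variable {B : Problem}

theorem nil : PL B fun _ => [] := PF.snd₀

theorem cons {f : Val → Val} {H : Val → List Val} (hf : PF B f) (hH : PL B H) :
    PL B fun v => f v :: H v :=
  (hf.comp PF.fst₀).pair hH

theorem append {H K : Val → List Val} (hH : PL B H) (hK : PL B K) :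
    PL B fun v => H v ++ K v := by
  have := PF.comp hH (PF.pair PF.fst₀ hK)
  unfold PL
  simpa only [Val.fst, Val.snd, Val.app_append] using this

theorem ite {c : Val → Val} {H K : Val → List Val} (hc : PF B c) (hH : PL B H) (hK : PL B K) :
    PL B fun v => if c v = Val.nat 0 then K v else H v := by
  have := PF.ite (hc.comp PF.fst₀) hH hK
  unfold PL
  convert this using 2 with w
  by_cases h : c w.fst = Val.nat 0 <;> simp [h]

theorem flatMap {f : Val → Val} {H : Val → List Val} (hf : PF B f) (hH : PL B H) :
    PL B fun v => (f v).elems.reverse.flatMap fun e => H (.pair v e) := by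
  have := PF.comp hH.loop (PF.pair PF.fst₀ (PF.pair (hf.comp PF.fst₀) PF.snd₀))
  exact this

theorem ofList {H : Val → List Val} (hH : PL B H) : PF B fun v => Val.ofList (H v) := by
  have := PF.comp hH (PF.pair PF.id (PF.const (.nat 0)))
  simpa only [Val.fst, Val.snd, Val.app_nat_zero] using this

theorem comp {f : Val → Val} {H : Val → List Val} (hH : PL B H) (hf : PF B f) :
    PL B fun v => H (f v) := by
  have := PF.comp hH (PF.pair (hf.comp PF.fst₀) PF.snd₀)
  exact this

end PL

/-- The predicate `c` is decided in polynomial time. -/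
def PB (B : Problem) (c : Val → Prop) : Prop :=
  ∃ f : Val → Val, PF B f ∧ ∀ v, f v = Val.nat 0 ↔ ¬ c v

namespace PB

variable {B : Problem}

theorem eq {f g : Val → Val} (hf : PF B f) (hg : PF B g) : PB B fun v => f v = g v :=
  ⟨_, hf.eq hg, fun v => by split_ifs with h <;> simp [h]⟩

theorem mem {f g : Val → Val} (hf : PF B f) (hg : PF B g) : PB B fun v => f v ∈ (g v).elems := by
  -- Membership is decided by emitting a `1` for every entry equal to `f v` and asking whether the
  -- resulting list is a pair.
  have h := ((PL.flatMap hg (PL.ite (PF.eq (hf.comp PF.fst₀) PF.snd₀)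
    (PL.cons (PF.const (.nat 1)) PL.nil) PL.nil)).ofList).isPair
  refine ⟨_, h, fun v => ?_⟩
  rw [iff_not_comm]
  have h0 : ∀ l : List Val, ¬ (Val.ofList l).isPair = .nat 0 ↔ ∃ x, x ∈ l := by
    intro l
    cases l with
    | nil => simp [Val.ofList, Val.isPair]
    | cons a l => simp only [Val.ofList, Val.isPair]; simp
  rw [h0]
  constructor
  · intro hm
    refine ⟨.nat 1, ?_⟩
    rw [List.mem_flatMap]
    exact ⟨f v, by simpa using hm, by simp [Val.fst, Val.snd]⟩
  · rintro ⟨x, hx⟩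
    rw [List.mem_flatMap] at hx
    obtain ⟨e, he, hx⟩ := hx
    by_cases hfe : f v = e
    · rw [hfe]; simpa using he
    · simp [Val.fst, Val.snd, hfe] at hx

theorem and {c d : Val → Prop} (hc : PB B c) (hd : PB B d) : PB B fun v => c v ∧ d v := by
  obtain ⟨f, hf, h⟩ := hc
  obtain ⟨g, hg, h'⟩ := hd
  refine ⟨_, PF.ite hf hg (PF.const (.nat 0)), fun v => ?_⟩
  have h1 := h v
  have h2 := h' v
  split_ifs with h0
  · simp only [true_iff]
    tauto
  · tauto

theorem forall_mem {ι : Type*} (l : List ι) {c : ι → Val → Prop} (hc : ∀ i ∈ l, PB B (c i)) :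
    PB B fun v => ∀ i ∈ l, c i v := by
  induction l with
  | nil => exact ⟨_, PF.const (.nat 1), fun v => by simp⟩
  | cons a l ih =>
    simpa using (hc a (by simp)).and (ih fun i hi => hc i (by simp [hi]))

end PB

theorem PL.ite' {B : Problem} {c : Val → Prop} {H : Val → List Val} (hc : PB B c)
    (hH : PL B H) : ∃ K, PL B K ∧ ∀ v x, x ∈ K v ↔ c v ∧ x ∈ H v := by
  obtain ⟨f, hf, h⟩ := hc
  refine ⟨_, PL.ite hf hH PL.nil, fun v x => ?_⟩
  have := h v
  split_ifs with h0 <;> simp <;> tauto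

theorem PF.ofList {B : Problem} {ι : Type*} (l : List ι) {f : ι → Val → Val}
    (hf : ∀ i ∈ l, PF B (f i)) : PF B fun v => Val.ofList (l.map fun i => f i v) := by
  induction l with
  | nil => exact PF.const _
  | cons a l ih => exact (hf a (by simp)).pair (ih fun i hi => hf i (by simp [hi]))

theorem PL.flatMap_static {B : Problem} {ι : Type*} (l : List ι) {H : ι → Val → List Val}
    (hH : ∀ i ∈ l, PL B (H i)) : PL B fun v => l.flatMap fun i => H i v := by
  induction l with
  | nil => exact PL.nil
  | cons a l ih =>
    simpa using (hH a (by simp)).append (ih fun i hi => hH i (by simp [hi]))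

end CQA

namespace CQA

/-! ## Reductions that hand one database to the oracle -/

theorem card_le_size_of_databaseRepr {S : Schema} {v : Val} {D : Database S}
    (h : DatabaseRepr v D) : D.card ≤ v.size := by
  obtain ⟨l, rfl, rfl⟩ := h
  refine (List.toFinset_card_le l).trans ?_
  induction l with
  | nil => simp
  | cons a l ih => simp only [List.map_cons, Val.ofList, Val.size, List.length_cons]; omega

theorem repairs_subset_powerset {S : Schema} (F : FDSet S) (D : Database S) :
    repairs F D ⊆ (D.powerset : Set (Database S)) := fun _ hE => by
  simpa using hE.1

theorem repairs_finite {S : Schema} (F : FDSet S) (D : Database S) : (repairs F D).Finite :=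
  D.powerset.finite_toSet.subset (repairs_subset_powerset F D)

/-- The oracle's answer is charged by its size. Numerator and denominator are at most the number of
subsets of `D`, so they have linearly many bits. -/
theorem size_encodeRat_relFreq_le {S : Schema} (F : FDSet S) (Q : CQ S) (D : Database S) :
    (encodeRat (relFreq F Q D)).size ≤ 2 * D.card + 5 := by
  set a := {E ∈ repairs F D | Q.EntailedBy E}.ncard with ha
  set b := (repairs F D).ncard with hb
  have hab : a ≤ b := Set.ncard_le_ncard (fun _ h => h.1) (repairs_finite F D)
  have hb2 : b ≤ 2 ^ D.card := by
    have := Set.ncard_le_ncard (repairs_subset_powerset F D) D.powerset.finite_toSet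
    rwa [Set.ncard_coe_finset, Finset.card_powerset] at this
  have hq : relFreq F Q D = (a : ℚ) / (b : ℚ) := rfl
  have hden : (relFreq F Q D).den ≤ 2 ^ D.card := by
    -- For `b = 0` the quotient is `0` by convention and has denominator `1`.
    rcases Nat.eq_zero_or_pos b with h0 | hpos
    · rw [hq, h0]; simp [Nat.one_le_two_pow]
    · refine le_trans (Nat.le_of_dvd hpos ?_) hb2
      have := Rat.den_dvd (a : ℤ) (b : ℤ)
      rw [Rat.divInt_eq_div, Int.cast_natCast, Int.cast_natCast] at this
      rw [hq]
      exact Int.natCast_dvd_natCast.1 this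
  have hnum : (relFreq F Q D).num.toNat ≤ 2 ^ D.card := by
    refine le_trans ?_ hden
    have h1 : relFreq F Q D ≤ 1 := by
      rw [hq]
      exact div_le_one_of_le₀ (by exact_mod_cast hab) (by positivity)
    have := (Rat.le_iff _ _).1 h1
    simp at this
    omega
  have key : ∀ n, n ≤ 2 ^ D.card → Nat.size n ≤ D.card + 1 := fun n hn => by
    rw [Nat.size_le, pow_succ]
    have : 1 ≤ 2 ^ D.card := Nat.one_le_two_pow
    omega
  have h1 := key _ hden
  have h2 := key _ hnum
  simp only [encodeRat, Val.size]
  omega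

/-- The size of `g v` bounds the number of facts of `D₂`, and thereby the size of the answer that
the single oracle call is charged for. -/
theorem cookReducible_of_map {S S' : Schema} {F : FDSet S} {Q : CQ S} {F' : FDSet S'}
    {Q' : CQ S'} {g : Val → Val} (hg : PF (RelFreq F Q) g)
    (h : ∀ (D : Database S') (v : Val), DatabaseRepr v D →
      ∃ D₂ : Database S, DatabaseRepr (g v) D₂ ∧ relFreq F' Q' D = relFreq F Q D₂) :
    CookReducible (RelFreq F' Q') (RelFreq F Q) := by
  obtain ⟨p, k, b, ⟨T, hT⟩, hk, hp⟩ := hg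
  refine ⟨.seq p (.query 0 (.var 0)), Polynomial.C 4 * T + Polynomial.C 10, fun D v hv => ?_⟩
  obtain ⟨D₂, hD₂, heq⟩ := h D v hv
  obtain ⟨s', t, he, h0, -, ht, hz⟩ := hp (initStore v)
  have hi : initStore v 0 = v := rfl
  rw [hi] at h0 ht hz
  have hq := Exec.query (B := RelFreq F Q) s' 0 (.var 0) D₂ (by
    change DatabaseRepr (s' 0) D₂
    rwa [h0])
  have hc := card_le_size_of_databaseRepr hD₂
  have ha := size_encodeRat_relFreq_le F Q D₂
  refine ⟨_, _, .seq _ _ _ _ _ _ _ he hq, ?_, ?_⟩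
  · rw [Function.update_self]
    change encodeRat _ = encodeRat _
    rw [heq]
  · change t + (Expr.cost s' (.var 0) + (encodeRat (relFreq F Q D₂)).size + 1) + 1 ≤ _
    simp only [Expr.cost, h0, Polynomial.eval_add, Polynomial.eval_mul, Polynomial.eval_C, ← hT]
    omega

end CQA

namespace CQA

/-! ## Maximal conflict-free sets -/

/-- The inclusion-maximal conflict-free subsets of `D`. -/
def maxIndep {A : Type*} (c : A → A → Prop) (D : Finset A) : Set (Finset A) :=
  {E | E ⊆ D ∧ (∀ a ∈ E, ∀ b ∈ E, ¬ c a b) ∧ ∀ a ∈ D, a ∉ E → ∃ b ∈ E, c a b}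

theorem Consistent.mono {S : Schema} {F : FDSet S} {D E : Database S} (h : Consistent F E)
    (hD : D ⊆ E) : Consistent F D :=
  fun φ hφ a b ha hb => h φ hφ a b (hD ha) (hD hb)

/-- An FD speaks of two facts at a time, so consistency means that there are no conflicting pairs.
-/
theorem consistent_iff_pairs {S : Schema} {F : FDSet S} {D : Database S} :
    Consistent F D ↔ ∀ f ∈ D, ∀ g ∈ D, Consistent F {f, g} := by
  refine ⟨fun h f hf g hg => h.mono (by simp [Finset.insert_subset_iff, hf, hg]),
    fun h φ hφ a b ha hb => h _ ha _ hb φ hφ a b (by simp) (by simp)⟩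

theorem consistent_singleton {S : Schema} (F : FDSet S) (f : Fact S) :
    Consistent F {f} := by
  rintro φ - a b ha hb - B -
  rw [Finset.mem_singleton] at ha hb
  have := ha.trans hb.symm
  simp only [Fact.mk.injEq, heq_eq_eq, true_and] at this
  rw [this]

/-- Maximality may be tested by adding single facts: such a fact either conflicts with a member of
the set or could be added to it. -/
theorem repairs_eq_maxIndep {S : Schema} (F : FDSet S) (D : Database S) :
    repairs F D = maxIndep (fun f g => ¬ Consistent F {f, g}) D := by
  ext E
  constructor
  · rintro ⟨h1, h2, h3⟩
    refine ⟨h1, fun a ha b hb => not_not.2 (consistent_iff_pairs.1 h2 a ha b hb),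
      fun a ha hE => ?_⟩
    by_contra! hcon
    refine h3 (insert a E) (Finset.ssubset_insert hE) (Finset.insert_subset ha h1)
      (consistent_iff_pairs.2 fun f hf g hg => ?_)
    rcases Finset.mem_insert.1 hf with hf | hf <;> rcases Finset.mem_insert.1 hg with hg | hg
    · rw [hf, hg]; simpa using consistent_singleton F _
    · rw [hf]; exact hcon g hg
    · rw [hg, Finset.pair_comm]; exact hcon f hf
    · exact consistent_iff_pairs.1 h2 f hf g hg
  · rintro ⟨h1, h2, h3⟩
    refine ⟨h1, consistent_iff_pairs.2 fun f hf g hg => not_not.1 (h2 f hf g hg),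
      fun E' hE hD hc => ?_⟩
    obtain ⟨hs, a, ha, hn⟩ := Finset.ssubset_iff_exists_cons_subset.1 hE |> fun ⟨a, h, h'⟩ =>
      (⟨hE.1, a, h' (by simp), h⟩ : E ⊆ E' ∧ ∃ a ∈ E', a ∉ E)
    obtain ⟨b, hb, hab⟩ := h3 a (hD ha) hn
    exact hab (consistent_iff_pairs.1 hc a ha b (hs hb))

theorem maxIndep_image {A I : Type*} [DecidableEq A] {c : A → A → Prop} {t : I → A}
    {K : Finset I} :
    maxIndep c (K.image t) = Finset.image t '' maxIndep (fun f g => c (t f) (t g)) K := by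
  classical
  ext E
  constructor
  · rintro ⟨h1, h2, h3⟩
    have hE : (K.filter fun f => t f ∈ E).image t = E := by
      ext a
      simp only [Finset.mem_image, Finset.mem_filter]
      constructor
      · rintro ⟨f, ⟨-, h⟩, rfl⟩; exact h
      · intro ha
        obtain ⟨f, hf, rfl⟩ := Finset.mem_image.1 (h1 ha)
        exact ⟨f, ⟨hf, ha⟩, rfl⟩
    refine ⟨K.filter fun f => t f ∈ E, ⟨Finset.filter_subset _ _, ?_, ?_⟩, hE⟩
    · intro f hf g hg
      exact h2 _ (Finset.mem_filter.1 hf).2 _ (Finset.mem_filter.1 hg).2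
    · intro f hf hn
      obtain ⟨b, hb, hc⟩ := h3 (t f) (Finset.mem_image_of_mem t hf)
        (fun h => hn (Finset.mem_filter.2 ⟨hf, h⟩))
      rw [← hE] at hb
      obtain ⟨g, hg, rfl⟩ := Finset.mem_image.1 hb
      exact ⟨g, hg, hc⟩
  · rintro ⟨E, ⟨h1, h2, h3⟩, rfl⟩
    refine ⟨Finset.image_subset_image h1, ?_, ?_⟩
    · simp only [Finset.forall_mem_image]
      exact h2
    · simp only [Finset.forall_mem_image]
      intro f hf hn
      obtain ⟨g, hg, hc⟩ := h3 f hf (fun h => hn (Finset.mem_image_of_mem t h))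
      exact ⟨t g, Finset.mem_image_of_mem t hg, hc⟩

/-! ### Independent sets that choose one element from each block -/

section Blocks

variable {A I : Type*} [DecidableEq A] [DecidableEq I] {D : Finset A} {blk : A → A → Prop}
  {K : Finset I} {c : I → I → Prop} {π : I → Finset A}

/-- One representative of each block will do. This makes the factor that is cancelled in
`maxIndep_ratio` nonzero. -/
theorem maxIndep_blocks_nonempty (hblk : Equivalence blk) (D : Finset A) :
    (maxIndep (fun a b => blk a b ∧ a ≠ b) D).Nonempty := by
  classical
  by_cases hA : Nonempty A
  swap
  · rw [not_nonempty_iff] at hA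
    exact ⟨∅, by simp, by simp, fun a => (hA.false a).elim⟩
  -- `epsilon` depends on the predicate only, so equivalent elements get the same representative.
  let rep : A → A := fun a => Classical.epsilon fun b => b ∈ D ∧ blk a b
  have hrep : ∀ a b, blk a b → rep a = rep b := by
    intro a b hab
    have : (fun x => x ∈ D ∧ blk a x) = fun x => x ∈ D ∧ blk b x := by
      funext x
      exact propext (and_congr_right fun _ =>
        ⟨fun h => hblk.trans (hblk.symm hab) h, fun h => hblk.trans hab h⟩)
    simp only [rep, this]
  have hspec : ∀ a ∈ D, rep a ∈ D ∧ blk a (rep a) := fun a ha =>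
    Classical.epsilon_spec (p := fun b => b ∈ D ∧ blk a b) ⟨a, ha, hblk.refl a⟩
  refine ⟨D.filter fun a => rep a = a, Finset.filter_subset _ _, ?_, ?_⟩
  · rintro a ha b hb ⟨hab, hne⟩
    apply hne
    rw [← (Finset.mem_filter.1 ha).2, ← (Finset.mem_filter.1 hb).2, hrep a b hab]
  · intro a ha hn
    obtain ⟨h1, h2⟩ := hspec a ha
    refine ⟨rep a, Finset.mem_filter.2 ⟨h1, (hrep _ _ h2).symm⟩, h2, fun h => hn ?_⟩
    exact Finset.mem_filter.2 ⟨ha, h.symm⟩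

/-- If the elements of `K` correspond to sets of elements of `D`, at most one of each block, such
that conflicts and replacements within blocks are reflected, then the proportion of the maximal
conflict-free sets with a certain property is the same for `K` and for `D`. -/
theorem maxIndep_ratio (hblk : Equivalence blk) (hπ : ∀ f ∈ K, π f ⊆ D)
    (hc : ∀ f ∈ K, ∀ g ∈ K, c f g ↔ ∃ a ∈ π f, ∃ b ∈ π g, blk a b ∧ a ≠ b)
    (hex : ∀ E ∈ maxIndep (fun a b => blk a b ∧ a ≠ b) D, ∀ f ∈ K,
      ∃ f' ∈ K, π f' ⊆ E ∧ ∀ a ∈ π f, ∃ b ∈ π f', blk a b)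
    {P : Finset A → Prop} {P₂ : Finset I → Prop}
    (hP : ∀ E ∈ maxIndep (fun a b => blk a b ∧ a ≠ b) D,
      P E ↔ P₂ (K.filter fun f => π f ⊆ E)) :
    ({E ∈ maxIndep (fun a b => blk a b ∧ a ≠ b) D | P E}.ncard : ℚ) /
      (maxIndep (fun a b => blk a b ∧ a ≠ b) D).ncard =
    ({E ∈ maxIndep c K | P₂ E}.ncard : ℚ) / (maxIndep c K).ncard := by
  classical
  set M := maxIndep (fun a b => blk a b ∧ a ≠ b) D with hM
  -- `U` consists of the blocks that no `π f` meets. The map `φ` records which `π f` are contained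
  -- in `E` and what `E` chooses in `U`; it is a bijection from `M` onto `maxIndep c K` times the
  -- possible choices in `U`.
  let U : Finset A := D.filter fun a => ∀ f ∈ K, ∀ b ∈ π f, ¬ blk a b
  let J : Finset A → Finset I := fun E => K.filter fun f => π f ⊆ E
  let φ : Finset A → Finset I × Finset A := fun E => (J E, E ∩ U)
  have huniq : ∀ E ∈ M, ∀ a ∈ E, ∀ b ∈ E, blk a b → a = b := fun E hE a ha b hb hab => by
    by_contra hne
    exact hE.2.1 a ha b hb ⟨hab, hne⟩
  -- By `hex` and uniqueness within blocks, the part of `E` outside `U` is covered by the `π f`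
  -- contained in `E`. This gives injectivity of `φ`.
  have hcover : ∀ E ∈ M, ∀ a ∈ E, a ∉ U → ∃ f ∈ J E, a ∈ π f := by
    intro E hE a ha hU
    have hU' : ∃ f ∈ K, ∃ b ∈ π f, blk a b := by
      by_contra! hcon
      exact hU (Finset.mem_filter.2 ⟨hE.1 ha, hcon⟩)
    obtain ⟨f, hf, b, hb, hab⟩ := hU'
    obtain ⟨f', hf', hs, hr⟩ := hex E hE f hf
    obtain ⟨b', hb', hbb⟩ := hr b hb
    have := huniq E hE a ha b' (hs hb') (hblk.trans hab hbb)
    exact ⟨f', Finset.mem_filter.2 ⟨hf', hs⟩, this ▸ hb'⟩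
  have hJ : ∀ E ∈ M, J E ∈ maxIndep c K := by
    intro E hE
    refine ⟨Finset.filter_subset _ _, ?_, ?_⟩
    · intro f hf g hg hcfg
      obtain ⟨hf, hf'⟩ := Finset.mem_filter.1 hf
      obtain ⟨hg, hg'⟩ := Finset.mem_filter.1 hg
      obtain ⟨a, ha, b, hb, hab, hne⟩ := (hc f hf g hg).1 hcfg
      exact hne (huniq E hE a (hf' ha) b (hg' hb) hab)
    · intro f hf hn
      have hn' : ¬ π f ⊆ E := fun h => hn (Finset.mem_filter.2 ⟨hf, h⟩)
      obtain ⟨a, ha, haE⟩ := Finset.not_subset.1 hn'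
      obtain ⟨f', hf', hs, hr⟩ := hex E hE f hf
      obtain ⟨b, hb, hab⟩ := hr a ha
      exact ⟨f', Finset.mem_filter.2 ⟨hf', hs⟩, (hc f hf f' hf').2
        ⟨a, ha, b, hb, hab, fun h => haE (h ▸ hs hb)⟩⟩
  have hinj : Set.InjOn φ M := by
    have key : ∀ E₁ ∈ M, ∀ E₂ ∈ M, φ E₁ = φ E₂ → E₁ ⊆ E₂ := by
      intro E₁ h₁ E₂ h₂ h a ha
      simp only [φ, Prod.mk.injEq] at h
      by_cases hU : a ∈ U
      · have : a ∈ E₂ ∩ U := h.2 ▸ Finset.mem_inter.2 ⟨ha, hU⟩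
        exact (Finset.mem_inter.1 this).1
      · obtain ⟨f, hf, haf⟩ := hcover E₁ h₁ a ha hU
        rw [h.1] at hf
        exact (Finset.mem_filter.1 hf).2 haf
    exact fun E₁ h₁ E₂ h₂ h => (key E₁ h₁ E₂ h₂ h).antisymm (key E₂ h₂ E₁ h₁ h.symm)
  -- Gluing: in the blocks that `p` meets, the element of `p` is taken, and in all others the choice
  -- of `E₃`.
  have hsurj : ∀ E₂ ∈ maxIndep c K, ∀ E₃ ∈ M, ∃ E ∈ M, J E = E₂ ∧ E ∩ U = E₃ ∩ U := by
    intro E₂ h₂ E₃ h₃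
    let p : Finset A := E₂.biUnion π
    have hpD : p ⊆ D := Finset.biUnion_subset.2 fun f hf => hπ f (h₂.1 hf)
    let E : Finset A := D.filter fun a => (a ∈ p) ∨ ((∀ b ∈ p, ¬ blk a b) ∧ a ∈ E₃)
    have hpu : ∀ a ∈ p, ∀ b ∈ p, blk a b → a = b := by
      intro a ha b hb hab
      obtain ⟨f, hf, ha⟩ := Finset.mem_biUnion.1 ha
      obtain ⟨g, hg, hb⟩ := Finset.mem_biUnion.1 hb
      by_contra hne
      exact h₂.2.1 f hf g hg ((hc f (h₂.1 hf) g (h₂.1 hg)).2 ⟨a, ha, b, hb, hab, hne⟩)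
    have hE : E ∈ M := by
      refine ⟨Finset.filter_subset _ _, ?_, ?_⟩
      · rintro a ha b hb ⟨hab, hne⟩
        obtain ⟨-, ha⟩ := Finset.mem_filter.1 ha
        obtain ⟨-, hb⟩ := Finset.mem_filter.1 hb
        rcases ha with ha | ⟨ha, ha'⟩ <;> rcases hb with hb | ⟨hb, hb'⟩
        · exact hne (hpu a ha b hb hab)
        · exact hb a ha (hblk.symm hab)
        · exact ha b hb hab
        · exact hne (huniq E₃ h₃ a ha' b hb' hab)
      · intro a ha hn
        by_cases hap : ∃ b ∈ p, blk a b
        · obtain ⟨b, hb, hab⟩ := hap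
          have hbE : b ∈ E := Finset.mem_filter.2 ⟨hpD hb, Or.inl hb⟩
          exact ⟨b, hbE, hab, fun h => hn (h ▸ hbE)⟩
        · push Not at hap
          obtain ⟨b, hb, hab, hne⟩ := h₃.2.2 a ha fun h =>
            hn (Finset.mem_filter.2 ⟨ha, Or.inr ⟨hap, h⟩⟩)
          exact ⟨b, Finset.mem_filter.2 ⟨h₃.1 hb, Or.inr
            ⟨fun x hx hbx => hap x hx (hblk.trans hab hbx), hb⟩⟩, hab, hne⟩
    refine ⟨E, hE, ?_, ?_⟩
    · have hsub : E₂ ⊆ J E := fun f hf => Finset.mem_filter.2 ⟨h₂.1 hf, fun a ha =>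
        Finset.mem_filter.2 ⟨hπ f (h₂.1 hf) ha, Or.inl (Finset.mem_biUnion.2 ⟨f, hf, ha⟩)⟩⟩
      -- `J E` is conflict-free and contains the maximal set `E₂`, so they coincide.
      refine Finset.Subset.antisymm (fun f hf => ?_) hsub
      by_contra hn
      have hfK := (Finset.mem_filter.1 hf).1
      obtain ⟨g, hg, hcfg⟩ := h₂.2.2 f hfK hn
      exact (hJ E hE).2.1 f hf g (hsub hg) hcfg
    · ext a
      simp only [Finset.mem_inter, E, U, Finset.mem_filter]
      constructor
      · rintro ⟨⟨h1, h2⟩, -, h4⟩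
        refine ⟨?_, h1, h4⟩
        rcases h2 with h2 | h2
        · obtain ⟨f, hf, ha⟩ := Finset.mem_biUnion.1 h2
          exact (h4 f (h₂.1 hf) a ha (hblk.refl a)).elim
        · exact h2.2
      · rintro ⟨h1, h2, h4⟩
        refine ⟨⟨h2, Or.inr ⟨fun b hb => ?_, h1⟩⟩, h2, h4⟩
        obtain ⟨f, hf, ha⟩ := Finset.mem_biUnion.1 hb
        exact h4 f (h₂.1 hf) b ha
  let V : Set (Finset A) := (fun E => E ∩ U) '' M
  have hMfin : M.Finite := D.powerset.finite_toSet.subset fun E hE => by simpa using hE.1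
  have hcard : ∀ (P : Finset A → Prop) (P₂ : Finset I → Prop),
      (∀ E ∈ M, P E ↔ P₂ (J E)) →
      {E ∈ M | P E}.ncard = {E ∈ maxIndep c K | P₂ E}.ncard * V.ncard := by
    intro P P₂ hP
    rw [← Set.ncard_prod, ← (hinj.mono (Set.sep_subset M P)).ncard_image]
    congr 1
    ext ⟨E₂, E₃⟩
    simp only [Set.mem_image, Set.mem_prod, Set.mem_ofPred_eq, φ, V, Prod.mk.injEq]
    constructor
    · rintro ⟨E, ⟨hE, hPE⟩, rfl, rfl⟩
      exact ⟨⟨hJ E hE, (hP E hE).1 hPE⟩, E, hE, rfl⟩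
    · rintro ⟨⟨h₂, hP₂⟩, E₃, h₃, rfl⟩
      obtain ⟨E, hE, rfl, h⟩ := hsurj E₂ h₂ E₃ h₃
      exact ⟨E, ⟨hE, (hP E hE).2 hP₂⟩, rfl, h⟩
  have hV : (V.ncard : ℚ) ≠ 0 := by
    rw [Nat.cast_ne_zero]
    have : V.Nonempty := (maxIndep_blocks_nonempty hblk D).image _
    rw [← Nat.pos_iff_ne_zero]
    exact (Set.ncard_pos (hMfin.image _)).2 this
  have h1 := hcard P P₂ hP
  -- The same count with trivial properties treats the denominators.
  have h2 := hcard (fun _ => True) (fun _ => True) (fun _ _ => Iff.rfl)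
  simp only [and_true, Set.ofPred_mem_eq] at h2
  rw [h1, h2]
  push_cast
  rw [mul_div_mul_right _ _ hV]

end Blocks

/-- `maxIndep_ratio` for repairs. In the application, `K` contains the facts before identifiers are
put in, and `t` puts them in. -/
theorem relFreq_eq_of_blocks {S S' : Schema} {F : FDSet S} {Q : CQ S} {F' : FDSet S'} {Q' : CQ S'}
    {D : Database S'} {I : Type*} [DecidableEq I] {K : Finset I} {t : I → Fact S}
    {blk : Fact S' → Fact S' → Prop} {π : I → Finset (Fact S')}
    (hblk : Equivalence blk) (hF' : ∀ a b, ¬ Consistent F' {a, b} ↔ blk a b ∧ a ≠ b)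
    (ht : Set.InjOn t K) (hπ : ∀ f ∈ K, π f ⊆ D)
    (hc : ∀ f ∈ K, ∀ g ∈ K, ¬ Consistent F {t f, t g} ↔ ∃ a ∈ π f, ∃ b ∈ π g, blk a b ∧ a ≠ b)
    (hex : ∀ E ∈ maxIndep (fun a b => blk a b ∧ a ≠ b) D, ∀ f ∈ K,
      ∃ f' ∈ K, π f' ⊆ E ∧ ∀ a ∈ π f, ∃ b ∈ π f', blk a b)
    (hQ : ∀ E ∈ maxIndep (fun a b => blk a b ∧ a ≠ b) D,
      Q'.EntailedBy E ↔ Q.EntailedBy ((K.filter fun f => π f ⊆ E).image t)) :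
    relFreq F' Q' D = relFreq F Q (K.image t) := by
  have h := maxIndep_ratio hblk hπ hc hex hQ (P₂ := fun E => Q.EntailedBy (E.image t))
  have hinj : Set.InjOn (Finset.image t)
      (maxIndep (fun f g => ¬ Consistent F {t f, t g}) K) := by
    intro E₁ h₁ E₂ h₂ h
    have key : ∀ E₁ ⊆ K, ∀ E₂ ⊆ K, E₁.image t = E₂.image t → E₁ ⊆ E₂ := by
      intro E₁ h₁ E₂ h₂ h f hf
      have : t f ∈ E₂.image t := h ▸ Finset.mem_image_of_mem t hf
      obtain ⟨g, hg, hgf⟩ := Finset.mem_image.1 this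
      exact ht (h₂ hg) (h₁ hf) hgf ▸ hg
    exact (key _ h₁.1 _ h₂.1 h).antisymm (key _ h₂.1 _ h₁.1 h.symm)
  have hD : repairs F' D = maxIndep (fun a b => blk a b ∧ a ≠ b) D := by
    rw [repairs_eq_maxIndep]
    simp only [hF']
  have hK : repairs F (K.image t) =
      Finset.image t '' maxIndep (fun f g => ¬ Consistent F {t f, t g}) K := by
    rw [repairs_eq_maxIndep, maxIndep_image]
  have hset : {E ∈ repairs F (K.image t) | Q.EntailedBy E} =
      Finset.image t '' {E ∈ maxIndep (fun f g => ¬ Consistent F {t f, t g}) K |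
        Q.EntailedBy (E.image t)} := by
    rw [hK]
    ext E
    simp only [Set.mem_image, Set.mem_ofPred_eq]
    constructor
    · rintro ⟨⟨E, hE, rfl⟩, h⟩
      exact ⟨E, ⟨hE, h⟩, rfl⟩
    · rintro ⟨E, ⟨hE, h⟩, rfl⟩
      exact ⟨⟨E, hE, rfl⟩, h⟩
  rw [relFreq, relFreq, hset, hK, hD, hinj.ncard_image,
    (hinj.mono (Set.sep_subset _ _)).ncard_image]
  exact h

end CQA

namespace CQA

/-! ## Canonical sets of functional dependencies -/

section Canonical

variable {S : Schema} {F : FDSet S} {R : Fin S.numRel} {X Y X' Y' : Finset (Fin (S.arity R))}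

theorem Canonical.rhs_nonempty (hF : Canonical F) (h : FD.mk R X Y ∈ F) : Y.Nonempty := by
  rw [Finset.nonempty_iff_ne_empty]
  rintro rfl
  refine hF.no_redundant_fd _ h fun D => ⟨fun hD φ hφ => ?_, fun hD φ hφ => hD φ hφ.1⟩
  by_cases hne : φ = FD.mk R X ∅
  · subst hne
    intro a b _ _ _ B hB
    simp at hB
  · exact hD φ ⟨hφ, hne⟩

theorem Canonical.notMem_lhs_of_mem_rhs (hF : Canonical F) (h : FD.mk R X Y ∈ F)
    {A : Fin (S.arity R)} (hA : A ∈ Y) : A ∉ X := by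
  intro hX
  refine hF.no_redundant_rhs _ h A hA fun D => ⟨fun hD φ hφ => ?_, fun hD φ hφ => ?_⟩
  · by_cases hne : φ = FD.mk R X Y
    · subst hne
      intro a b ha hb hab B hB
      by_cases hBA : B = A
      · rw [hBA]; exact hab A hX
      · exact hD _ (Set.mem_insert _ _) a b ha hb hab B (Finset.mem_erase.2 ⟨hBA, hB⟩)
    · exact hD φ (Set.mem_insert_of_mem _ ⟨hφ, hne⟩)
  · rcases hφ with rfl | hφ
    · intro a b ha hb hab B hB
      exact hD _ h a b ha hb hab B (Finset.mem_of_mem_erase hB)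
    · exact hD φ hφ.1

/-- If an attribute is on the right of two FDs with comparable left-hand sides, the FD with the
smaller one makes it redundant in the other. -/
theorem Canonical.lhs_eq_of_mem_rhs (hF : Canonical F) (hch : LHSChain F)
    (h : FD.mk R X Y ∈ F) (h' : FD.mk R X' Y' ∈ F) {A : Fin (S.arity R)} (hA : A ∈ Y)
    (hA' : A ∈ Y') : X = X' := by
  have key : ∀ X Y X' Y' : Finset (Fin (S.arity R)), FD.mk R X Y ∈ F → FD.mk R X' Y' ∈ F →
      A ∈ Y → A ∈ Y' → X ⊆ X' → X = X' := by
    intro X Y X' Y' h h' hA hA' hs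
    by_contra hne
    refine hF.no_redundant_rhs _ h' A hA' fun D => ⟨fun hD φ hφ => ?_, fun hD φ hφ => ?_⟩
    · by_cases hne' : φ = FD.mk R X' Y'
      · subst hne'
        intro a b ha hb hab B hB
        by_cases hBA : B = A
        · rw [hBA]
          exact hD (FD.mk R X Y) (Set.mem_insert_of_mem _ ⟨h, by simp [hne]⟩) a b ha hb
            (fun C hC => hab C (hs hC)) A hA
        · exact hD _ (Set.mem_insert _ _) a b ha hb hab B (Finset.mem_erase.2 ⟨hBA, hB⟩)
      · exact hD φ (Set.mem_insert_of_mem _ ⟨hφ, hne'⟩)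
    · rcases hφ with rfl | hφ
      · intro a b ha hb hab B hB
        exact hD _ h' a b ha hb hab B (Finset.mem_of_mem_erase hB)
      · exact hD φ hφ.1
  rcases hch R X Y X' Y' h h' with hs | hs
  · exact key X Y X' Y' h h' hA hA' hs
  · exact (key X' Y' X Y h' h hA' hA hs).symm

/-- If `X ⊆ X'`, the rest of `X'` determines `A` already, so `A` is redundant in `X'`. If `X' ⊆ X`,
then `A` would be on both sides of `X → Y`. -/
theorem Canonical.notMem_lhs (hF : Canonical F) (hch : LHSChain F)
    (h : FD.mk R X Y ∈ F) (h' : FD.mk R X' Y' ∈ F) {A : Fin (S.arity R)} (hA : A ∈ Y) :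
    A ∉ X' := by
  have hAX := hF.notMem_lhs_of_mem_rhs h hA
  rcases hch R X Y X' Y' h h' with hs | hs
  swap
  · exact fun hA' => hAX (hs hA')
  intro hA'
  have hne : FD.mk R X Y ≠ FD.mk R X' Y' := by
    simp only [ne_eq, FD.mk.injEq, heq_eq_eq, true_and, not_and]
    rintro rfl
    exact (hAX hA').elim
  refine hF.no_redundant_lhs _ h' A hA' fun D => ⟨fun hD φ hφ => ?_, fun hD φ hφ => ?_⟩
  · by_cases hne' : φ = FD.mk R X' Y'
    · subst hne'
      intro a b ha hb hab
      exact hD _ (Set.mem_insert _ _) a b ha hb fun C hC => hab C (Finset.mem_of_mem_erase hC)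
    · exact hD φ (Set.mem_insert_of_mem _ ⟨hφ, hne'⟩)
  · rcases hφ with rfl | hφ
    · intro a b ha hb hab
      refine hD _ h' a b ha hb fun C hC => ?_
      by_cases hCA : C = A
      · rw [hCA]
        refine hD _ h a b ha hb (fun C hC => hab C (Finset.mem_erase.2 ⟨?_, hs hC⟩)) A hA
        rintro rfl
        exact hAX hC
      · exact hab C (Finset.mem_erase.2 ⟨hCA, hC⟩)
    · exact hD φ hφ.1

end Canonical

/-! ## Primary functional dependencies -/

section Primary

variable {S : Schema} {F : FDSet S} {α : Atom S} {X Y X' Y' : Finset (Fin (S.arity α.rel))}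

theorem Term.const_or_var (t : Term) : (∃ c, t = .const c) ∨ ∃ x, t = .var x := by
  cases t <;> simp

/-- Among the FDs that mention a variable of `α`, one with a left-hand side of least cardinality is
primary. -/
theorem exists_isPrimaryFD (h : FD.mk α.rel X Y ∈ F) {A : Fin (S.arity α.rel)} (hA : A ∈ X ∪ Y)
    {x : ℕ} (hx : α.args A = .var x) :
    ∃ X₀ Y₀ : Finset (Fin (S.arity α.rel)), IsPrimaryFD F α X₀ Y₀ := by
  classical
  let p : ℕ → Prop := fun n => ∃ X Y : Finset (Fin (S.arity α.rel)), X.card = n ∧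
    FD.mk α.rel X Y ∈ F ∧ ∃ A ∈ X ∪ Y, ∃ x, α.args A = .var x
  have hp : ∃ n, p n := ⟨_, X, Y, rfl, h, A, hA, x, hx⟩
  obtain ⟨X₀, Y₀, hc, h₀, hv⟩ := Nat.find_spec hp
  refine ⟨X₀, Y₀, h₀, hv, fun X' Y' h' hs B hB => ?_⟩
  rcases (α.args B).const_or_var with hb | ⟨y, hb⟩
  · exact hb
  · exact (Nat.find_min hp (hc ▸ Finset.card_lt_card hs) ⟨X', Y', rfl, h', B, hB, y, hb⟩).elim

theorem IsPrimaryFD.subset_of_var (hch : LHSChain F) (h₀ : IsPrimaryFD F α X Y)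
    (h : FD.mk α.rel X' Y' ∈ F) {A : Fin (S.arity α.rel)} (hA : A ∈ X' ∪ Y') {x : ℕ}
    (hx : α.args A = .var x) : X ⊆ X' := by
  rcases hch _ _ _ _ _ h₀.1 h with hs | hs
  · exact hs
  · by_cases he : X' = X
    · exact he.ge
    · obtain ⟨c, hc⟩ := h₀.2.2 X' Y' h (hs.ssubset_of_ne he) A hA
      rw [hx] at hc
      cases hc

theorem IsPrimaryFD.lhs_eq (hch : LHSChain F) (h : IsPrimaryFD F α X Y)
    (h' : IsPrimaryFD F α X' Y') : X = X' := by
  obtain ⟨A, hA, x, hx⟩ := h.2.1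
  obtain ⟨B, hB, y, hy⟩ := h'.2.1
  exact (h.subset_of_var hch h'.1 hB hy).antisymm (h'.subset_of_var hch h.1 hA hx)

theorem IsPrimaryFD.primaryLhs_iff (hch : LHSChain F) (h : IsPrimaryFD F α X Y)
    {A : Fin (S.arity α.rel)} : PrimaryLhs F α A ↔ A ∈ X :=
  ⟨fun hA => hA X Y h, fun hA _ _ h' => h.lhs_eq hch h' ▸ hA⟩

theorem IsPrimaryFD.inPrimaryPrefix_iff (hch : LHSChain F) (h : IsPrimaryFD F α X Y) :
    InPrimaryPrefix F α X' Y' ↔ FD.mk α.rel X' Y' ∈ F ∧ X' ⊂ X :=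
  ⟨fun h' => ⟨h'.1, h'.2 X Y h⟩, fun h' => ⟨h'.1, fun _ _ h'' => h.lhs_eq hch h'' ▸ h'.2⟩⟩

end Primary

/-! ## Queries to which no rule applies -/

/-- `Q` is not the union of two nonempty sets of atoms without common atoms or variables. -/
def Unsplittable {S : Schema} (Q : CQ S) : Prop :=
  ∀ Q₁ Q₂ : CQ S, Q₁.Nonempty → Q₂.Nonempty → Disjoint Q₁ Q₂ → Disjoint Q₁.vars Q₂.vars →
    Q₁ ∪ Q₂ ≠ Q

/-- None of the rules for safety applies to `Q`. -/
structure Final {S : Schema} (F : FDSet S) (Q : CQ S) : Prop where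
  pvar_nonempty : ∀ α ∈ complexPart F Q, (pvar F α).Nonempty
  not_common : ∀ x, ∃ α ∈ complexPart F Q, x ∉ pvar F α
  unsplittable : Unsplittable Q

theorem Final.not_safe {S : Schema} {F : FDSet S} {Q : CQ S} (hQ : Final F Q) : ¬ Safe F Q := by
  intro h
  cases h with
  | base _ h =>
    obtain ⟨α, hα, -⟩ := hQ.not_common 0
    rw [h] at hα
    exact hα
  | union Q₁ Q₂ h₁ h₂ hd hv _ _ => exact hQ.unsplittable Q₁ Q₂ h₁ h₂ hd hv rfl
  | lhs _ x c _ _ h _ =>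
    obtain ⟨α, hα, hx⟩ := hQ.not_common x
    exact hx (h α hα)
  | rhs _ x c α X Y A hα h _ _ _ _ => exact (hQ.pvar_nonempty α hα).ne_empty h

/-! ## Partial assignments -/

/-- The value of a term under a partial assignment. -/
def Term.asg (τ : ℕ → Option ℕ) : Term → Term
  | .const c => .const c
  | .var x => (τ x).elim (.var x) .const

/-- The atom under a partial assignment. -/
def Atom.asg {S : Schema} (τ : ℕ → Option ℕ) (α : Atom S) : Atom S :=
  ⟨α.rel, fun A => (α.args A).asg τ⟩

theorem Term.asg_eq_var {τ : ℕ → Option ℕ} {t : Term} {x : ℕ} :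
    t.asg τ = .var x ↔ t = .var x ∧ τ x = none := by
  cases t with
  | const c => simp [Term.asg]
  | var y =>
    cases h : τ y with
    | none =>
      simp only [Term.asg, h, Option.elim, Term.var.injEq]
      exact ⟨fun e => ⟨e, e ▸ h⟩, fun e => e.1⟩
    | some c =>
      simp only [Term.asg, h, Option.elim, Term.var.injEq, false_iff, not_and, reduceCtorEq]
      rintro rfl
      simp [h]

theorem Term.subst_asg {τ : ℕ → Option ℕ} {x c : ℕ} (hx : τ x = none) (t : Term) :
    (t.asg τ).subst x c = t.asg (Function.update τ x (some c)) := by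
  cases t with
  | const d => rfl
  | var y =>
    by_cases hy : y = x
    · subst hy
      simp [Term.asg, hx, Term.subst]
    · cases h : τ y <;> simp [Term.asg, h, Term.subst, hy]

theorem CQ.subst_image_asg {S : Schema} {τ : ℕ → Option ℕ} {x c : ℕ} (hx : τ x = none)
    (P : CQ S) : CQ.subst x c (P.image (Atom.asg τ)) =
      P.image (Atom.asg (Function.update τ x (some c))) := by
  rw [CQ.subst, Finset.image_image]
  congr 1
  funext α
  simp [Atom.asg, Atom.subst, Term.subst_asg hx]

/-- Every database that a reduction produces has the constant `c` at this occurrence, if the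
variable there is assigned to `c`. -/
def Forced {S : Schema} (F : FDSet S) (τ : ℕ → Option ℕ) (α : Atom S)
    (A : Fin (S.arity α.rel)) : Prop :=
  PrimaryLhs F (α.asg τ) A ∨ ∃ X Y : Finset (Fin (S.arity α.rel)), FD.mk α.rel X Y ∈ F ∧ A ∈ Y ∧
    ∀ B ∈ X, ∃ c, (α.args B).asg τ = .const c

/-- An assignment only turns variables into constants. So the primary FD can only move up the chain,
where left-hand sides are larger, and constant left-hand sides stay constant. -/
theorem Forced.update {S : Schema} {F : FDSet S} (hch : LHSChain F) {τ : ℕ → Option ℕ}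
    {α : Atom S} {A : Fin (S.arity α.rel)} (h : Forced F τ α A) {x c : ℕ} (hx : τ x = none) :
    Forced F (Function.update τ x (some c)) α A := by
  have hvar : ∀ (t : Term) (y : ℕ), t.asg (Function.update τ x (some c)) = .var y →
      t.asg τ = .var y := by
    intro t y hy
    rw [← Term.subst_asg hx] at hy
    cases ht : t.asg τ with
    | const d => rw [ht] at hy; cases hy
    | var z =>
      rw [ht] at hy
      simp only [Term.subst] at hy
      split_ifs at hy
      exact hy
  rcases h with h | ⟨X, Y, hXY, hA, hX⟩
  · left
    intro X Y hp
    obtain ⟨B, hB, y, hy⟩ := hp.2.1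
    have hy' := hvar _ _ hy
    obtain ⟨X₀, Y₀, h₀⟩ := exists_isPrimaryFD (α := α.asg τ) hp.1 hB hy'
    exact h₀.subset_of_var hch hp.1 hB hy' (h X₀ Y₀ h₀)
  · right
    refine ⟨X, Y, hXY, hA, fun B hB => ?_⟩
    rcases Term.const_or_var ((α.args B).asg (Function.update τ x (some c))) with h | ⟨y, hy⟩
    · exact h
    · obtain ⟨d, hd⟩ := hX B hB
      rw [hvar _ _ hy] at hd
      cases hd

/-- `P` under `τ` is a part of `Q` that is not safe, such that the assigned variables are forced
and the other atoms share no unassigned variables with `P`. -/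
structure UnsafePart {S : Schema} (F : FDSet S) (Q : CQ S) (τ : ℕ → Option ℕ) (P : CQ S) :
    Prop where
  subset : P ⊆ Q
  disjoint : ∀ α ∈ P, ∀ β ∈ Q, β ∉ P → ∀ A B x, α.args A = .var x → β.args B = .var x → τ x ≠ none
  forced : ∀ x c, τ x = some c → ∃ α ∈ Q, ∃ A, α.args A = .var x ∧ Forced F τ α A
  not_safe : ¬ Safe F (P.image (Atom.asg τ))

theorem finite_vars {S : Schema} (Q : CQ S) : Q.vars.Finite := by
  have : Q.vars ⊆ ⋃ α ∈ Q, Set.range fun A => match α.args A with | .const _ => 0 | .var x => x := by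
    rintro x ⟨α, hα, A, hA⟩
    simp only [Set.mem_iUnion]
    exact ⟨α, hα, A, by simp [hA]⟩
  exact (Set.Finite.biUnion Q.finite_toSet fun α _ => Set.finite_range _).subset this

/-- Every rule of safety passes to a smaller part or assigns a variable. At an unsafe part of least
measure `m`, an applicable rule would therefore have safe premises and prove the part safe. -/
theorem exists_final_part {S : Schema} {F : FDSet S} (hch : LHSChain F) {Q : CQ S}
    (hns : ¬ Safe F Q) :
    ∃ τ P, UnsafePart F Q τ P ∧ Final F (P.image (Atom.asg τ)) := by
  classical
  let m : (ℕ → Option ℕ) × CQ S → ℕ := fun v =>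
    v.2.card + {x ∈ Q.vars | v.1 x = none}.ncard
  have hne : {v : (ℕ → Option ℕ) × CQ S | UnsafePart F Q v.1 v.2}.Nonempty := by
    refine ⟨(fun _ => none, Q), subset_rfl, fun α _ β hβ hβ' => absurd hβ hβ', by simp, ?_⟩
    convert hns
    rw [Finset.image_congr (g := id), Finset.image_id]
    intro α _
    have : ∀ t : Term, t.asg (fun _ => none) = t := by rintro (c | x) <;> rfl
    simp [Atom.asg, this]
  obtain ⟨⟨τ, P⟩, hP, hmin⟩ := exists_minimalFor_of_wellFoundedLT _ m hne
  have hmin' : ∀ τ' P', UnsafePart F Q τ' P' → m (τ, P) ≤ m (τ', P') := fun τ' P' h' => by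
    by_contra hlt
    exact hlt (hmin (j := (τ', P')) h' (le_of_not_ge hlt))
  simp only [Set.mem_ofPred_eq] at hP
  refine ⟨τ, P, hP, ?_⟩
  -- Assigning a variable with a forced occurrence keeps all other conditions of `UnsafePart` and
  -- lowers `m`, so by minimality the result is safe, whatever the constant.
  have hstep : ∀ α ∈ P, ∀ A x, (α.args A).asg τ = .var x → Forced F τ α A → ∀ c,
      Safe F (CQ.subst x c (P.image (Atom.asg τ))) := by
    intro α hα A x hA hf c
    by_contra hs
    obtain ⟨hA, hx⟩ := Term.asg_eq_var.1 hA
    rw [CQ.subst_image_asg hx] at hs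
    have hle := hmin' (Function.update τ x (some c)) P ⟨hP.subset, ?_, ?_, hs⟩
    · have hlt : {y ∈ Q.vars | Function.update τ x (some c) y = none}.ncard <
          {y ∈ Q.vars | τ y = none}.ncard := by
        refine Set.ncard_lt_ncard ⟨?_, ?_⟩ ((finite_vars Q).subset (Set.sep_subset _ _))
        · rintro y ⟨hy, h⟩
          refine ⟨hy, ?_⟩
          by_cases hyx : y = x
          · rw [hyx]; exact hx
          · rwa [Function.update_of_ne hyx] at h
        · intro hsub
          have := (hsub (show x ∈ {y ∈ Q.vars | τ y = none} from
            ⟨⟨α, hP.subset hα, A, hA⟩, hx⟩)).2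
          simp at this
      simp only [m] at hle
      omega
    · intro β hβ γ hγ hγ' B C y hB hC
      have := hP.disjoint β hβ γ hγ hγ' B C y hB hC
      by_cases hyx : y = x
      · subst hyx; simp
      · rwa [Function.update_of_ne hyx]
    · intro y d hy
      by_cases hyx : y = x
      · subst hyx
        exact ⟨α, hP.subset hα, A, hA, hf.update hch hx⟩
      · rw [Function.update_of_ne hyx] at hy
        obtain ⟨β, hβ, B, hB, hf'⟩ := hP.forced y d hy
        exact ⟨β, hβ, B, hB, hf'.update hch hx⟩
  have hcomp : ∀ α ∈ complexPart F (P.image (Atom.asg τ)), ∃ β ∈ P, Atom.asg τ β = α :=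
    fun α hα => Finset.mem_image.1 hα.1
  have hcne : complexPart F (P.image (Atom.asg τ)) ≠ ∅ := fun h => hP.not_safe (.base _ h)
  refine ⟨fun α hα => ?_, fun x => ?_, fun Q₁ Q₂ h₁ h₂ hd hv he => ?_⟩
  · obtain ⟨β, hβ, rfl⟩ := hcomp α hα
    by_contra hpv
    rw [Set.not_nonempty_iff_eq_empty] at hpv
    obtain ⟨-, A, hA, -⟩ := id hα
    simp only [PrimaryLhs, not_forall] at hA
    obtain ⟨X, Y, hXY, hA⟩ := hA
    -- Without primary-lhs variables, the left-hand side of the primary FD carries constants only.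
    -- Hence its right-hand side has a variable, which is forced, and the rule `rhs` applies.
    have hX : ∀ B ∈ X, ∃ c, (β.args B).asg τ = .const c := by
      intro B hB
      rcases Term.const_or_var ((β.args B).asg τ) with h | ⟨y, hy⟩
      · exact h
      · have : y ∈ pvar F (β.asg τ) := ⟨B, (hXY.primaryLhs_iff hch).2 hB, hy⟩
        rw [hpv] at this
        exact this.elim
    obtain ⟨B, hB, y, hy⟩ := hXY.2.1
    rcases Finset.mem_union.1 hB with hB | hB
    · obtain ⟨c, hc⟩ := hX B hB
      exact absurd (hc.symm.trans hy) (by simp)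
    · exact hP.not_safe (.rhs _ y 0 (β.asg τ) X Y B hα hpv hXY hB hy
        (hstep β hβ B y hy (Or.inr ⟨X, Y, hXY.1, hB, hX⟩) 0))
  · by_contra! hall
    obtain ⟨α, hα⟩ := Set.nonempty_iff_ne_empty.2 hcne
    have hα' := hall α hα
    obtain ⟨β, hβ, rfl⟩ := hcomp α hα
    obtain ⟨A, hA, hx⟩ := hα'
    exact hP.not_safe (.lhs _ x 0 hcne ⟨_, hα.1, A, hx⟩ hall
      (hstep β hβ A x hx (Or.inl hA) 0))
  -- An unsafe component would pull back to an unsafe part with fewer atoms. The statement is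
  -- general in the two components, so that it can be used for both.
  · have hpart : ∀ Q₁ Q₂ : CQ S, Q₁.Nonempty → Q₂.Nonempty → Disjoint Q₁ Q₂ →
        Disjoint Q₁.vars Q₂.vars → Q₁ ∪ Q₂ = P.image (Atom.asg τ) → Safe F Q₁ := by
      intro Q₁ Q₂ h₁ h₂ hd hv he
      by_contra hs
      have him : (P.filter fun α => α.asg τ ∈ Q₁).image (Atom.asg τ) = Q₁ := by
        ext α
        simp only [Finset.mem_image, Finset.mem_filter]
        constructor
        · rintro ⟨β, ⟨-, h⟩, rfl⟩; exact h
        · intro hα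
          have : α ∈ P.image (Atom.asg τ) := he ▸ Finset.mem_union_left _ hα
          obtain ⟨β, hβ, rfl⟩ := Finset.mem_image.1 this
          exact ⟨β, ⟨hβ, hα⟩, rfl⟩
      have hle := hmin' τ (P.filter fun α => α.asg τ ∈ Q₁)
        ⟨(Finset.filter_subset _ _).trans hP.subset, ?_, hP.forced, him.symm ▸ hs⟩
      · have hlt : (P.filter fun α => α.asg τ ∈ Q₁).card < P.card := by
          obtain ⟨β, hβ⟩ := h₂
          have : β ∈ P.image (Atom.asg τ) := he ▸ Finset.mem_union_right _ hβ
          obtain ⟨γ, hγ, rfl⟩ := Finset.mem_image.1 this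
          refine Finset.card_lt_card (Finset.filter_ssubset.2 ⟨γ, hγ, fun h => ?_⟩)
          exact Finset.disjoint_left.1 hd h hβ
        simp only [m] at hle
        omega
      · intro α hα β hβ hβ' A B x hA hB
        obtain ⟨hα, hα₁⟩ := Finset.mem_filter.1 hα
        by_cases hβP : β ∈ P
        · intro hx
          have hβ₁ : β.asg τ ∉ Q₁ := fun h => hβ' (Finset.mem_filter.2 ⟨hβP, h⟩)
          have hβ₂ : β.asg τ ∈ Q₂ := by
            have : β.asg τ ∈ Q₁ ∪ Q₂ := he ▸ Finset.mem_image_of_mem _ hβP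
            exact (Finset.mem_union.1 this).resolve_left hβ₁
          exact Set.disjoint_left.1 hv ⟨_, hα₁, A, Term.asg_eq_var.2 ⟨hA, hx⟩⟩
            ⟨_, hβ₂, B, Term.asg_eq_var.2 ⟨hB, hx⟩⟩
        · exact hP.disjoint α hα β hβ hβP A B x hA hB
    refine hP.not_safe (he ▸ .union Q₁ Q₂ h₁ h₂ hd hv (hpart Q₁ Q₂ h₁ h₂ hd hv he) ?_)
    exact hpart Q₂ Q₁ h₂ h₁ hd.symm hv.symm (Finset.union_comm Q₁ Q₂ ▸ he)

end CQA

namespace CQA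

/-! ## Governed attributes -/

section Governed

variable {S : Schema} {F : FDSet S} {Q : CQ S} {α : Atom S}

theorem IsPrimaryFD.unique (hF : Canonical F) (hch : LHSChain F)
    {X Y X' Y' : Finset (Fin (S.arity α.rel))} (h : IsPrimaryFD F α X Y)
    (h' : IsPrimaryFD F α X' Y') : X = X' ∧ Y = Y' := by
  have := h.lhs_eq hch h'
  subst this
  exact ⟨rfl, hF.lhs_unique _ _ _ _ h.1 h'.1⟩

/-- `α` has only variables without further occurrences at the attributes of `Y`. -/
def Loose (Q : CQ S) (α : Atom S) (Y : Finset (Fin (S.arity α.rel))) : Prop :=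
  ∀ A ∈ Y, ∃ y, α.args A = .var y ∧ ¬ Q.Liaison y

/-- In the databases that the reduction produces, the facts that are consistent with each other
and agree on `X` agree on `A`. If the right-hand side of the primary FD is loose, it is used for
identifiers of facts, so that its left-hand side determines everything. -/
def Governs (F : FDSet S) (Q : CQ S) (α : Atom S) (X : Finset (Fin (S.arity α.rel)))
    (A : Fin (S.arity α.rel)) : Prop :=
  ∃ X₀ Y₀ : Finset (Fin (S.arity α.rel)), IsPrimaryFD F α X₀ Y₀ ∧
    ((Loose Q α Y₀ ∧ X = X₀ ∧ A ∉ X₀ ∧ ∀ X' Y' : Finset (Fin (S.arity α.rel)),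
        FD.mk α.rel X' Y' ∈ F → X' ⊂ X₀ → A ∉ X' ∪ Y') ∨
      (¬ Loose Q α Y₀ ∧ X₀ ⊆ X ∧ ∃ Y, FD.mk α.rel X Y ∈ F ∧ A ∈ Y))

/-- The position of `A` holds an identifier of the fact. -/
def Tagged (F : FDSet S) (Q : CQ S) (α : Atom S) (A : Fin (S.arity α.rel)) : Prop :=
  ∃ X₀ Y₀ : Finset (Fin (S.arity α.rel)), IsPrimaryFD F α X₀ Y₀ ∧ Loose Q α Y₀ ∧ A ∈ Y₀

variable {X X' : Finset (Fin (S.arity α.rel))} {A B : Fin (S.arity α.rel)}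

/-- Every governed attribute thus has a well-defined left-hand side, which becomes the key of its
split relation. -/
theorem Governs.lhs_eq (hF : Canonical F) (hch : LHSChain F) (h : Governs F Q α X A)
    (h' : Governs F Q α X' A) : X = X' := by
  obtain ⟨X₀, Y₀, h₀, h⟩ := h
  obtain ⟨X₁, Y₁, h₁, h'⟩ := h'
  obtain ⟨rfl, rfl⟩ := h₀.unique hF hch h₁
  rcases h with ⟨hl, rfl, -⟩ | ⟨hl, -, Y, hY, hA⟩ <;>
    rcases h' with ⟨hl', rfl, -⟩ | ⟨hl', -, Y', hY', hA'⟩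
  · rfl
  · exact (hl' hl).elim
  · exact (hl hl').elim
  · exact hF.lhs_eq_of_mem_rhs hch hY hY' hA hA'

/-- Consequently a change of governed values does not affect the key of any split relation. -/
theorem Governs.not_governs (hF : Canonical F) (hch : LHSChain F) (h : Governs F Q α X A)
    (hB : B ∈ X) : ¬ Governs F Q α X' B := by
  intro h'
  obtain ⟨X₀, Y₀, h₀, h⟩ := h
  obtain ⟨X₁, Y₁, h₁, h'⟩ := h'
  obtain ⟨rfl, rfl⟩ := h₀.unique hF hch h₁
  rcases h with ⟨hl, rfl, -⟩ | ⟨hl, -, Y, hY, hA⟩ <;>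
    rcases h' with ⟨hl', rfl, hB', -⟩ | ⟨hl', -, Y', hY', hA'⟩
  · exact hB' hB
  · exact (hl' hl).elim
  · exact (hl hl').elim
  · exact hF.notMem_lhs hch hY' hY hA' hB

theorem IsPrimaryFD.governs {X₀ Y₀ : Finset (Fin (S.arity α.rel))} (hF : Canonical F)
    (h₀ : IsPrimaryFD F α X₀ Y₀) (hA : A ∈ Y₀) : Governs F Q α X₀ A := by
  by_cases hl : Loose Q α Y₀
  · refine ⟨X₀, Y₀, h₀, Or.inl ⟨hl, rfl, hF.notMem_lhs_of_mem_rhs h₀.1 hA, ?_⟩⟩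
    intro X' Y' h' hs hA'
    obtain ⟨c, hc⟩ := h₀.2.2 X' Y' h' hs A hA'
    obtain ⟨y, hy, -⟩ := hl A hA
    exact absurd (hc.symm.trans hy) (by simp)
  · exact ⟨X₀, Y₀, h₀, Or.inr ⟨hl, subset_rfl, Y₀, h₀.1, hA⟩⟩

theorem Governs.primary_subset (hch : LHSChain F) {X₀ Y₀ : Finset (Fin (S.arity α.rel))}
    (h₀ : IsPrimaryFD F α X₀ Y₀) (h : Governs F Q α X A) : X₀ ⊆ X := by
  obtain ⟨X₁, Y₁, h₁, h⟩ := h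
  rw [h₀.lhs_eq hch h₁]
  rcases h with ⟨-, rfl, -⟩ | ⟨-, h, -⟩
  · rfl
  · exact h

theorem Tagged.governs (hF : Canonical F) (h : Tagged F Q α A) : ∃ X, Governs F Q α X A := by
  obtain ⟨X₀, Y₀, h₀, -, hA⟩ := h
  exact ⟨X₀, h₀.governs hF hA⟩

theorem Tagged.loose (h : Tagged F Q α A) : ∃ y, α.args A = .var y ∧ ¬ Q.Liaison y := by
  obtain ⟨X₀, Y₀, h₀, h, hA⟩ := h
  exact h A hA

theorem consistent_pair_iff {R : Fin S.numRel} {a b : Fin (S.arity R) → ℕ} :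
    Consistent F {Fact.mk R a, Fact.mk R b} ↔ ∀ X Y : Finset (Fin (S.arity R)),
      FD.mk R X Y ∈ F → (∀ A ∈ X, a A = b A) → ∀ B ∈ Y, a B = b B := by
  constructor
  · intro h X Y hXY hab
    exact h _ hXY a b (by simp) (by simp) hab
  · rintro h ⟨R', X, Y⟩ hXY f g hf hg hfg B hB
    simp only [Finset.mem_insert, Finset.mem_singleton, Fact.mk.injEq] at hf hg
    dsimp only at f g hf hg hfg B hB
    have hR : R' = R := by rcases hf with h | h <;> exact h.1
    subst hR
    simp only [heq_eq_eq, true_and] at hf hg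
    have := h X Y hXY
    rcases hf with rfl | rfl <;> rcases hg with rfl | rfl
    · rfl
    · exact this hfg B hB
    · exact (this (fun A hA => (hfg A hA).symm) B hB).symm
    · rfl

theorem consistent_pair_of_rel_ne {f g : Fact S} (h : f.rel ≠ g.rel) : Consistent F {f, g} := by
  rintro ⟨R, X, Y⟩ - a b ha hb - B hB
  simp only [Finset.mem_insert, Finset.mem_singleton] at ha hb
  dsimp only at a b ha hb B hB
  have : Fact.mk R a = Fact.mk R b := by
    rcases ha with ha | ha <;> rcases hb with hb | hb
    · rw [ha, hb]
    · exact (h (by rw [← ha, ← hb])).elim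
    · exact (h (by rw [← ha, ← hb])).elim
    · rw [ha, hb]
  simp only [Fact.mk.injEq, heq_eq_eq, true_and] at this
  rw [this]

open Classical in
/-- The facts of the reduction with their identifiers. -/
theorem consistent_tag_iff (hF : Canonical F) (hch : LHSChain F)
    {code : (Fin (S.arity α.rel) → ℕ) → ℕ} (hcode : Function.Injective code)
    {f g : Fin (S.arity α.rel) → ℕ}
    (hf : ∀ A, (¬ ∃ X, Governs F Q α X A) → ∀ c, α.args A = .const c → f A = c)
    (hg : ∀ A, (¬ ∃ X, Governs F Q α X A) → ∀ c, α.args A = .const c → g A = c) :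
    Consistent F {Fact.mk α.rel fun A => if Tagged F Q α A then code f else f A,
      Fact.mk α.rel fun A => if Tagged F Q α A then code g else g A} ↔
    ∀ X A, Governs F Q α X A → (∀ B ∈ X, f B = g B) → f A = g A := by
  rw [consistent_pair_iff]
  by_cases hp : ∃ X₀ Y₀ : Finset (Fin (S.arity α.rel)), IsPrimaryFD F α X₀ Y₀
  swap
  -- Without a primary FD, the atom has constants at all attributes of FDs. Both tuples have these
  -- constants, so every FD holds, and nothing is governed.
  · have hgov : ∀ X A, ¬ Governs F Q α X A := fun X A ⟨X₀, Y₀, h, _⟩ => hp ⟨X₀, Y₀, h⟩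
    have htag : ∀ A, ¬ Tagged F Q α A := fun A ⟨X₀, Y₀, h, _⟩ => hp ⟨X₀, Y₀, h⟩
    refine ⟨fun _ X A h => (hgov X A h).elim, fun _ X Y hXY _ B hB => ?_⟩
    simp only [htag, if_false]
    rcases (α.args B).const_or_var with ⟨c, hc⟩ | ⟨x, hx⟩
    · rw [hf B (by simp [hgov]) c hc, hg B (by simp [hgov]) c hc]
    · exact (hp (exists_isPrimaryFD hXY (Finset.mem_union_right _ hB) hx)).elim
  obtain ⟨X₀, Y₀, h₀⟩ := hp
  -- The FDs before the primary one involve only positions with constants of the atom. These are not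
  -- governed and not tagged, so both tuples agree there.
  have hpre : ∀ X Y, FD.mk α.rel X Y ∈ F → X ⊂ X₀ → ∀ B ∈ X ∪ Y,
      f B = g B ∧ ¬ Tagged F Q α B := by
    intro X Y hXY hs B hB
    obtain ⟨c, hc⟩ := h₀.2.2 X Y hXY hs B hB
    have hng : ¬ ∃ X', Governs F Q α X' B := by
      rintro ⟨X', X₁, Y₁, h₁, h⟩
      obtain ⟨rfl, rfl⟩ := h₀.unique hF hch h₁
      rcases h with ⟨-, -, -, h⟩ | ⟨-, hX', Y', hY', hB'⟩
      · exact h X Y hXY hs hB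
      · rcases Finset.mem_union.1 hB with hB | hB
        · exact hF.notMem_lhs hch hY' hXY hB' hB
        · have := hF.lhs_eq_of_mem_rhs hch hXY hY' hB hB'
          rw [this] at hs
          exact hs.2 hX'
    exact ⟨by rw [hf B hng c hc, hg B hng c hc], fun h => hng (h.governs hF)⟩
  by_cases hl : Loose Q α Y₀
  · have htag : ∀ A, Tagged F Q α A ↔ A ∈ Y₀ := fun A => by
      refine ⟨fun ⟨X₁, Y₁, h₁, _, hA⟩ => ?_, fun h => ⟨X₀, Y₀, h₀, hl, h⟩⟩
      obtain ⟨rfl, rfl⟩ := h₀.unique hF hch h₁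
      exact hA
    have hgov : ∀ X A, Governs F Q α X A ↔ X = X₀ ∧ A ∉ X₀ ∧
        ∀ X' Y' : Finset (Fin (S.arity α.rel)), FD.mk α.rel X' Y' ∈ F → X' ⊂ X₀ →
          A ∉ X' ∪ Y' := fun X A => by
      refine ⟨fun ⟨X₁, Y₁, h₁, h⟩ => ?_, fun h => ⟨X₀, Y₀, h₀, Or.inl ⟨hl, h⟩⟩⟩
      obtain ⟨rfl, rfl⟩ := h₀.unique hF hch h₁
      rcases h with h | h
      · exact h.2
      · exact (h.1 hl).elim
    simp only [htag, hgov]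
    have hX₀ : ∀ B ∈ X₀, B ∉ Y₀ := fun B hB hB' => hF.notMem_lhs_of_mem_rhs h₀.1 hB' hB
    constructor
    · rintro h X A ⟨rfl, -, -⟩ hfg
      -- The right-hand side is nonempty, so it holds at least one identifier, and equal identifiers
      -- mean equal tuples.
      obtain ⟨B, hB⟩ := hF.rhs_nonempty h₀.1
      have := h X Y₀ h₀.1 (fun C hC => by simpa [hX₀ C hC] using hfg C hC) B hB
      simp only [hB, if_true] at this
      rw [hcode this]
    · intro h X Y hXY hfg B hB
      by_cases hX : X₀ ⊆ X
      -- Agreement on `X₀` is enough: every other attribute is governed by `X₀` or belongs to the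
      -- prefix.
      · have heq : f = g := by
          funext A
          have hfg₀ : ∀ C ∈ X₀, f C = g C := fun C hC => by simpa [hX₀ C hC] using hfg C (hX hC)
          by_cases hA : A ∈ X₀
          · exact hfg₀ A hA
          · by_cases hpre' : ∀ X' Y' : Finset (Fin (S.arity α.rel)), FD.mk α.rel X' Y' ∈ F →
                X' ⊂ X₀ → A ∉ X' ∪ Y'
            · exact h X₀ A ⟨rfl, hA, hpre'⟩ hfg₀
            · push Not at hpre'
              obtain ⟨X', Y', h', hs, hA'⟩ := hpre'
              exact (hpre X' Y' h' hs A hA').1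
        rw [heq]
      · have hs : X ⊂ X₀ := by
          rcases hch _ _ _ _ _ hXY h₀.1 with h | h
          · exact ⟨h, hX⟩
          · exact (hX h).elim
        obtain ⟨h1, h2⟩ := hpre X Y hXY hs B (Finset.mem_union_right _ hB)
        rw [htag] at h2
        simp [h2, h1]
  · have htag : ∀ A, ¬ Tagged F Q α A := fun A ⟨X₁, Y₁, h₁, h, _⟩ => by
      obtain ⟨rfl, rfl⟩ := h₀.unique hF hch h₁
      exact hl h
    simp only [htag, if_false]
    constructor
    · rintro h X A ⟨X₁, Y₁, h₁, h'⟩ hfg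
      obtain ⟨rfl, rfl⟩ := h₀.unique hF hch h₁
      rcases h' with h' | ⟨-, -, Y, hXY, hA⟩
      · exact (hl h'.1).elim
      · exact h X Y hXY hfg A hA
    · intro h X Y hXY hfg B hB
      by_cases hX : X₀ ⊆ X
      · exact h X B ⟨X₀, Y₀, h₀, Or.inr ⟨hl, hX, Y, hXY, hB⟩⟩ hfg
      · have hs : X ⊂ X₀ := by
          rcases hch _ _ _ _ _ hXY h₀.1 with h | h
          · exact ⟨h, hX⟩
          · exact (hX h).elim
        exact (hpre X Y hXY hs B (Finset.mem_union_right _ hB)).1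

/-! ### Governed attributes in queries to which no rule applies -/

/-- Otherwise `α` has no primary-lhs variable and so is not complex. Then none of its variables is a
liaison variable, and `α` splits off from the query. -/
theorem Final.exists_var_of_isPrimaryFD (hch : LHSChain F) (hQ : Final F Q) (hα : α ∈ Q)
    {X₀ Y₀ : Finset (Fin (S.arity α.rel))} (h₀ : IsPrimaryFD F α X₀ Y₀) :
    ∃ A ∈ X₀, ∃ x, α.args A = .var x := by
  by_contra! hcon
  by_cases hc : α ∈ complexPart F Q
  · obtain ⟨x, A, hA, hx⟩ := hQ.pvar_nonempty α hc
    exact hcon A ((h₀.primaryLhs_iff hch).1 hA) x hx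
  have horph : ∀ A x, α.args A = .var x → ¬ Q.Liaison x := by
    intro A x hx hl
    refine hc ⟨hα, A, fun hA => hcon A ((h₀.primaryLhs_iff hch).1 hA) x hx,
      Or.inr ⟨x, hx, hl⟩, fun X Y hXY hA => ?_⟩
    rw [h₀.inPrimaryPrefix_iff hch] at hXY
    obtain ⟨c, hc⟩ := h₀.2.2 X Y hXY.1 hXY.2 A hA
    exact absurd (hc.symm.trans hx) (by simp)
  -- The variable `0` is arbitrary; only the existence of a complex atom is used, which makes
  -- `Q.erase α` nonempty.
  obtain ⟨β, hβ, -⟩ := hQ.not_common 0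
  refine hQ.unsplittable {α} (Q.erase α) (by simp)
    ⟨β, Finset.mem_erase.2 ⟨fun h => hc (h ▸ hβ), hβ.1⟩⟩ (by simp) ?_ ?_
  · rw [Set.disjoint_left]
    rintro x ⟨γ, hγ, A, hA⟩ ⟨δ, hδ, B, hB⟩
    rw [Finset.mem_singleton] at hγ
    subst hγ
    obtain ⟨hne, hδ⟩ := Finset.mem_erase.1 hδ
    refine horph A x hA ⟨⟨γ, A⟩, ⟨δ, B⟩, fun h => hne ?_, hα, hδ, hA, hB⟩
    exact (congrArg Sigma.fst h).symm
  · rw [Finset.singleton_union, Finset.insert_erase hα]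

theorem exists_isPrimaryFD_of_mem_complexPart (hα : α ∈ complexPart F Q) :
    ∃ X₀ Y₀ : Finset (Fin (S.arity α.rel)), IsPrimaryFD F α X₀ Y₀ := by
  obtain ⟨-, A, hA, -⟩ := hα
  simp only [PrimaryLhs, not_forall] at hA
  obtain ⟨X, Y, h, -⟩ := hA
  exact ⟨X, Y, h⟩

/-- The two cases of `Governs` are made for this. If `Y₀` is not loose, it contains a suitable
position itself. If it is loose, `X₀` governs all attributes outside `X₀` and the prefix, among them
the position that makes `α` complex. -/
theorem IsPrimaryFD.exists_complex_position (hch : LHSChain F)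
    {X₀ Y₀ : Finset (Fin (S.arity α.rel))} (h₀ : IsPrimaryFD F α X₀ Y₀)
    (hα : α ∈ complexPart F Q) :
    ∃ A, Governs F Q α X₀ A ∧
      ((∃ c, α.args A = .const c) ∨ ∃ x, α.args A = .var x ∧ Q.Liaison x) := by
  by_cases hl : Loose Q α Y₀
  · obtain ⟨-, A, hA, h, hpre⟩ := hα
    rw [h₀.primaryLhs_iff hch] at hA
    exact ⟨A, ⟨X₀, Y₀, h₀, Or.inl ⟨hl, rfl, hA, fun X Y hXY hs =>
      hpre X Y ((h₀.inPrimaryPrefix_iff hch).2 ⟨hXY, hs⟩)⟩⟩, h⟩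
  · have hl' := hl
    simp only [Loose, not_forall, not_exists, not_and, not_not] at hl'
    obtain ⟨A, hA, h⟩ := hl'
    refine ⟨A, ⟨X₀, Y₀, h₀, Or.inr ⟨hl, subset_rfl, Y₀, h₀.1, hA⟩⟩, ?_⟩
    rcases (α.args A).const_or_var with hc | ⟨x, hx⟩
    · exact Or.inl hc
    · exact Or.inr ⟨x, hx, h x hx⟩

/-- A forced position is in `X₀` or on the right of an FD whose left-hand side has only constants.
As `X₀` has a variable, such an FD precedes the primary one, and its attributes are not governed. -/
theorem Forced.not_governs (hF : Canonical F) (hch : LHSChain F) {τ : ℕ → Option ℕ}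
    (hQ : Final F Q) (hα : α.asg τ ∈ Q) (h : Forced F τ α A)
    {X : Finset (Fin (S.arity α.rel))} : ¬ Governs F Q (α.asg τ) X A := by
  rintro ⟨X₀, Y₀, h₀, hg⟩
  rcases h with h | ⟨X', Y', hXY, hA, hX⟩
  · have hA : A ∈ X₀ := h X₀ Y₀ h₀
    rcases hg with ⟨-, -, hn, -⟩ | ⟨-, -, Y, hY, hAY⟩
    · exact hn hA
    · exact hF.notMem_lhs hch hY h₀.1 hAY hA
  · have hns : ¬ X₀ ⊆ X' := fun hs => by
      obtain ⟨B, hB, x, hx⟩ := hQ.exists_var_of_isPrimaryFD hch hα h₀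
      obtain ⟨c, hc⟩ := hX B (hs hB)
      exact absurd (hc.symm.trans hx) (by simp)
    have hs : X' ⊂ X₀ := by
      rcases hch _ _ _ _ _ hXY h₀.1 with h | h
      · exact ⟨h, hns⟩
      · exact (hns h).elim
    rcases hg with ⟨-, -, -, hn⟩ | ⟨-, hX₀, Y, hY, hAY⟩
    · exact hn X' Y' hXY hs (Finset.mem_union_right _ hA)
    · have := hF.lhs_eq_of_mem_rhs hch hXY hY hA hAY
      exact hns (this ▸ hX₀)

end Governed

end CQA

namespace CQA

/-! ## The target schema -/

/-- The schema with relation names `(R, i)`, `i ≤ M`, of arity `M`. -/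
abbrev splitSchema (S : Schema) (M : ℕ) : Schema := ⟨S.numRel * (M + 1), fun _ => M⟩

/-- All positions but `i` are the key of `(R, i)`, for `i < M`. -/
def splitFDs (S : Schema) (M : ℕ) : FDSet (splitSchema S M) :=
  {φ | ∃ (R : Fin S.numRel) (i : Fin M),
    φ = ⟨finProdFinEquiv (R, i.castSucc), Finset.univ.erase i, {i}⟩}

section Target

variable {S : Schema} {M : ℕ}

theorem mem_splitFDs {k : Fin (S.numRel * (M + 1))} {X Y : Finset (Fin M)} :
    (⟨k, X, Y⟩ : FD (splitSchema S M)) ∈ splitFDs S M ↔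
      ∃ (R : Fin S.numRel) (i : Fin M), k = finProdFinEquiv (R, i.castSucc) ∧
        X = Finset.univ.erase i ∧ Y = {i} := by
  simp only [splitFDs, Set.mem_ofPred_eq, FD.mk.injEq, heq_eq_eq]

theorem mem_splitFDs_index {R : Fin S.numRel} {i : Fin M} {X Y : Finset (Fin M)} :
    (⟨finProdFinEquiv (R, i.castSucc), X, Y⟩ : FD (splitSchema S M)) ∈ splitFDs S M ↔
      X = Finset.univ.erase i ∧ Y = {i} := by
  rw [mem_splitFDs]
  constructor
  · rintro ⟨R', i', h, rfl, rfl⟩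
    have := finProdFinEquiv.injective h
    simp only [Prod.mk.injEq, Fin.castSucc_inj] at this
    rw [this.2]
    exact ⟨rfl, rfl⟩
  · rintro ⟨rfl, rfl⟩
    exact ⟨R, i, rfl, rfl, rfl⟩

theorem notMem_splitFDs_last {R : Fin S.numRel} {X Y : Finset (Fin M)} :
    (⟨finProdFinEquiv (R, Fin.last M), X, Y⟩ : FD (splitSchema S M)) ∉ splitFDs S M := by
  rw [mem_splitFDs]
  rintro ⟨R', i', h, -, -⟩
  have := finProdFinEquiv.injective h
  simp only [Prod.mk.injEq] at this
  exact Fin.castSucc_ne_last i' this.2.symm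

theorem primaryKeys_splitFDs : PrimaryKeys (splitFDs S M) := by
  refine ⟨?_, ?_⟩
  · rintro φ ⟨R, i, rfl⟩
    ext j
    by_cases h : j = i <;> simp [h]
  · rintro φ ⟨R, i, rfl⟩ ψ ⟨R', i', rfl⟩ h
    have := finProdFinEquiv.injective h
    simp only [Prod.mk.injEq, Fin.castSucc_inj] at this
    rw [this.1, this.2]

/-- Each FD is the only one over its relation name. Two facts that differ exactly at `i`, or at `i`
and the attribute in question, refute each redundancy. -/
theorem canonical_splitFDs : Canonical (splitFDs S M) := by
  have hone : ∀ (k : Fin (S.numRel * (M + 1))) (a b : Fin M → ℕ) (φ : FD (splitSchema S M)),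
      φ.rel ≠ k → φ.SatisfiedBy {⟨k, a⟩, ⟨k, b⟩} := by
    intro k a b φ hφ u v hu
    simp only [Finset.mem_insert, Finset.mem_singleton, Fact.mk.injEq, hφ, false_and,
      or_self] at hu
  have hpair : ∀ (R : Fin S.numRel) (i : Fin M) (a b : Fin M → ℕ)
      (φ : FD (splitSchema S M)), φ ∈ splitFDs S M →
      φ ≠ ⟨finProdFinEquiv (R, i.castSucc), Finset.univ.erase i, {i}⟩ →
      φ.SatisfiedBy {⟨finProdFinEquiv (R, i.castSucc), a⟩, ⟨finProdFinEquiv (R, i.castSucc), b⟩} := by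
    intro R i a b φ hφ hne
    refine hone _ _ _ _ fun h => hne ?_
    exact primaryKeys_splitFDs.2 φ hφ _ (mem_splitFDs_index.2 ⟨rfl, rfl⟩) h
  refine ⟨?_, ?_, ?_, ?_⟩
  · rintro φ ⟨R, i, rfl⟩ heq
    have hc := (heq {⟨finProdFinEquiv (R, i.castSucc), fun _ => 0⟩,
      ⟨finProdFinEquiv (R, i.castSucc), fun j => if j = i then 1 else 0⟩}).1
      fun φ hφ => hpair R i _ _ φ hφ.1 hφ.2
    have := consistent_pair_iff.1 hc _ _ (mem_splitFDs_index.2 ⟨rfl, rfl⟩)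
      (fun A hA => by simp [Finset.ne_of_mem_erase hA]) i (by simp)
    simp at this
  · rintro φ ⟨R, i, rfl⟩ (A : Fin M) hA heq
    have hAi : A ≠ i := Finset.ne_of_mem_erase hA
    have hc := (heq {⟨finProdFinEquiv (R, i.castSucc), fun _ => 0⟩,
      ⟨finProdFinEquiv (R, i.castSucc), fun j => if j = i ∨ j = A then 1 else 0⟩}).2
      (consistent_pair_iff.2 fun X Y hXY h => by
        obtain ⟨rfl, rfl⟩ := mem_splitFDs_index.1 hXY
        have := h A hA
        simp at this)
    have := consistent_pair_iff.1 hc _ _ (Set.mem_insert _ _)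
      (fun B hB => by
        have h1 := Finset.ne_of_mem_erase hB
        have h2 := Finset.ne_of_mem_erase (Finset.mem_of_mem_erase hB)
        simp [h1, h2]) i (by simp)
    simp at this
  · rintro φ ⟨R, i, rfl⟩ (A : Fin M) hA heq
    obtain rfl := Finset.mem_singleton.1 hA
    have hc := (heq {⟨finProdFinEquiv (R, A.castSucc), fun _ => 0⟩,
      ⟨finProdFinEquiv (R, A.castSucc), fun j => if j = A then 1 else 0⟩}).1
      (by
        rintro φ (rfl | hφ)
        · intro u v _ _ _ B hB
          simp at hB
        · exact hpair R A _ _ φ hφ.1 hφ.2)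
    have := consistent_pair_iff.1 hc _ _ (mem_splitFDs_index.2 ⟨rfl, rfl⟩)
      (fun B hB => by simp [Finset.ne_of_mem_erase hB]) A (by simp)
    simp at this
  · intro k X Y Y' h h'
    obtain ⟨R, i, rfl, rfl, rfl⟩ := mem_splitFDs.1 h
    exact (mem_splitFDs_index.1 h').2.symm

/-- The facts `a` and `b` agree on the key of a relation, or are equal. -/
def SameBlock (a b : Fact (splitSchema S M)) : Prop :=
  a = b ∨ ∃ (R : Fin S.numRel) (i : Fin M) (u v : Fin M → ℕ),
    a = ⟨finProdFinEquiv (R, i.castSucc), u⟩ ∧ b = ⟨finProdFinEquiv (R, i.castSucc), v⟩ ∧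
    ∀ j, j ≠ i → u j = v j

theorem sameBlock_equivalence : Equivalence (SameBlock (S := S) (M := M)) := by
  refine ⟨fun _ => Or.inl rfl, ?_, ?_⟩
  · rintro a b (rfl | ⟨R, i, u, v, rfl, rfl, h⟩)
    · exact Or.inl rfl
    · exact Or.inr ⟨R, i, v, u, rfl, rfl, fun j hj => (h j hj).symm⟩
  · rintro a b c (rfl | ⟨R, i, u, v, rfl, rfl, h⟩) h'
    · exact h'
    · rcases h' with rfl | ⟨R', i', u', v', h1, rfl, h2⟩
      · exact Or.inr ⟨R, i, u, v, rfl, rfl, h⟩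
      · simp only [Fact.mk.injEq, EmbeddingLike.apply_eq_iff_eq, Prod.mk.injEq, Fin.castSucc_inj,
          heq_eq_eq] at h1
        obtain ⟨⟨rfl, rfl⟩, rfl⟩ := h1
        exact Or.inr ⟨R, i, u, v', rfl, rfl, fun j hj => (h j hj).trans (h2 j hj)⟩

theorem not_consistent_splitFDs_iff (a b : Fact (splitSchema S M)) :
    ¬ Consistent (splitFDs S M) {a, b} ↔ SameBlock a b ∧ a ≠ b := by
  constructor
  · intro h
    have hne : a ≠ b := by
      rintro rfl
      rw [Finset.pair_eq_singleton] at h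
      exact h (consistent_singleton _ _)
    refine ⟨?_, hne⟩
    by_cases hr : a.rel = b.rel
    · obtain ⟨k, u⟩ := a
      obtain ⟨k', v⟩ := b
      obtain rfl : k = k' := hr
      rw [consistent_pair_iff] at h
      push Not at h
      obtain ⟨X, Y, hXY, hX, -⟩ := h
      obtain ⟨R, i, rfl, rfl, rfl⟩ := mem_splitFDs.1 hXY
      exact Or.inr ⟨R, i, u, v, rfl, rfl, fun j hj => hX j (by simp [hj])⟩
    · exact (h (consistent_pair_of_rel_ne hr)).elim
  · rintro ⟨rfl | ⟨R, i, u, v, rfl, rfl, h⟩, hne⟩ hc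
    · exact hne rfl
    · apply hne
      have := consistent_pair_iff.1 hc _ _ (mem_splitFDs_index.2 ⟨rfl, rfl⟩)
        (fun A hA => h A (Finset.ne_of_mem_erase hA)) i (by simp)
      congr 1
      funext j
      by_cases hj : j = i
      · rw [hj]; exact this
      · exact h j hj

end Target

/-! ## Splitting relations -/

/-- A set of governed attributes for each relation name, with their left-hand sides. -/
structure Split (S : Schema) (M : ℕ) where
  arity_le : ∀ R, S.arity R ≤ M
  gov : ∀ R, Finset (Fin (S.arity R))
  lhs : ∀ R, Fin (S.arity R) → Finset (Fin (S.arity R))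
  notMem_gov : ∀ R, ∀ A ∈ gov R, ∀ B ∈ lhs R A, B ∉ gov R

namespace Split

variable {S : Schema} {M : ℕ} (σ : Split S M)

/-- The position of an attribute in the target schema. -/
def pos {R : Fin S.numRel} (A : Fin (S.arity R)) : Fin M := A.castLE (σ.arity_le R)

/-- The relation name for the governed attribute `o`, or for all other attributes. -/
def name (R : Fin S.numRel) (o : Option (Fin (S.arity R))) : Fin (S.numRel * (M + 1)) :=
  finProdFinEquiv (R, o.elim (Fin.last M) fun A => (σ.pos A).castSucc)

/-- The attributes that are kept in the relation `σ.name R o`. -/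
def keep (R : Fin S.numRel) : Option (Fin (S.arity R)) → Finset (Fin (S.arity R))
  | none => (σ.gov R)ᶜ
  | some A => insert A (σ.lhs R A)

/-- The tuple `v` on `Z`, padded with `d`. -/
def pad {β : Type*} (d : β) {n : ℕ} (Z : Finset (Fin n)) (v : Fin n → β) : Fin M → β :=
  fun i => if h : i.1 < n then if ⟨i, h⟩ ∈ Z then v ⟨i, h⟩ else d else d

/-- The projection of a fact. -/
def projFact (f : Fact S) (o : Option (Fin (S.arity f.rel))) : Fact (splitSchema S M) :=
  ⟨σ.name f.rel o, pad 0 (σ.keep f.rel o) f.val⟩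

/-- The projection of an atom. -/
def projAtom (α : Atom S) (o : Option (Fin (S.arity α.rel))) : Atom (splitSchema S M) :=
  ⟨σ.name α.rel o, pad (.const 0) (σ.keep α.rel o) α.args⟩

/-- The query with an atom for each governed attribute, and one for all other attributes. -/
def query (rels : Finset (Fin S.numRel)) (U : ∀ R, Fin (S.arity R) → Term) :
    CQ (splitSchema S M) :=
  rels.biUnion fun R => (Finset.insertNone (σ.gov R)).image (σ.projAtom ⟨R, U R⟩)

variable {σ}

theorem mem_query {rels : Finset (Fin S.numRel)} {U : ∀ R, Fin (S.arity R) → Term}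
    {β : Atom (splitSchema S M)} : β ∈ σ.query rels U ↔
      ∃ R ∈ rels, ∃ o ∈ Finset.insertNone (σ.gov R), σ.projAtom ⟨R, U R⟩ o = β := by
  simp [query]

theorem pad_pos {β : Type*} (d : β) {R : Fin S.numRel} (Z : Finset (Fin (S.arity R)))
    (v : Fin (S.arity R) → β) (A : Fin (S.arity R)) :
    (pad d Z v : Fin M → β) (σ.pos A) = if A ∈ Z then v A else d := by
  exact dif_pos A.2

theorem pad_cases {β : Type*} (d : β) {R : Fin S.numRel} (Z : Finset (Fin (S.arity R)))
    (v : Fin (S.arity R) → β) (i : Fin M) :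
    (pad d Z v : Fin M → β) i = d ∨ ∃ A ∈ Z, i = σ.pos A ∧ (pad d Z v : Fin M → β) i = v A := by
  unfold pad
  split_ifs with h h'
  · exact Or.inr ⟨_, h', rfl, rfl⟩
  · exact Or.inl rfl
  · exact Or.inl rfl

theorem pos_injective {R : Fin S.numRel} : Function.Injective (σ.pos (R := R)) :=
  Fin.castLE_injective (σ.arity_le R)

theorem name_inj {R R' : Fin S.numRel} {o : Option (Fin (S.arity R))}
    {o' : Option (Fin (S.arity R'))} (h : σ.name R o = σ.name R' o') :
    ∃ e : R = R', e ▸ o = o' := by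
  have := finProdFinEquiv.injective h
  simp only [Prod.mk.injEq] at this
  obtain ⟨rfl, h⟩ := this
  refine ⟨rfl, ?_⟩
  cases o with
  | none =>
    cases o' with
    | none => rfl
    | some B => exact (Fin.castSucc_ne_last _ h.symm).elim
  | some A =>
    cases o' with
    | none => exact (Fin.castSucc_ne_last _ h).elim
    | some B =>
      simp only [Option.elim, Fin.castSucc_inj] at h
      rw [pos_injective h]

theorem selfJoinFree_query (rels : Finset (Fin S.numRel)) (U : ∀ R, Fin (S.arity R) → Term) :
    (σ.query rels U).SelfJoinFree := by
  intro α hα β hβ h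
  obtain ⟨R, hR, o, ho, rfl⟩ := mem_query.1 hα
  obtain ⟨R', hR', o', ho', rfl⟩ := mem_query.1 hβ
  obtain ⟨e, he⟩ := name_inj h
  dsimp only at e
  subst e
  dsimp only at he
  rw [he]

/-! ### No rule of safety applies to the split query -/

section Final

variable {rels : Finset (Fin S.numRel)} {U : ∀ R, Fin (S.arity R) → Term} {R : Fin S.numRel}

/-- A key attribute is repeated in several split atoms. Fixing one copy of each occurrence keeps
distinct occurrences distinct, so that liaison variables remain liaison variables. -/
theorem occurrence (hR : R ∈ rels) {B : Fin (S.arity R)} {x : ℕ} (hB : U R B = .var x) :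
    ∃ o ∈ Finset.insertNone (σ.gov R), (B ∈ σ.gov R → o = some B) ∧
      (B ∉ σ.gov R → o = none) ∧ σ.projAtom ⟨R, U R⟩ o ∈ σ.query rels U ∧
      (σ.projAtom ⟨R, U R⟩ o).args (σ.pos B) = .var x := by
  by_cases h : B ∈ σ.gov R
  · have ho : some B ∈ Finset.insertNone (σ.gov R) := by simpa using h
    refine ⟨some B, ho, fun _ => rfl, fun h' => (h' h).elim, mem_query.2 ⟨R, hR, _, ho, rfl⟩, ?_⟩
    exact (pad_pos _ _ _ _).trans (by simp [keep, hB])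
  · have ho : none ∈ Finset.insertNone (σ.gov R) := by simp
    refine ⟨none, ho, fun h' => (h h').elim, fun _ => rfl, mem_query.2 ⟨R, hR, _, ho, rfl⟩, ?_⟩
    exact (pad_pos _ _ _ _).trans (by simp [keep, h, hB])

theorem projAtom_none_notMem_complexPart {Q : CQ (splitSchema S M)} {α : Atom S} :
    σ.projAtom α none ∉ complexPart (splitFDs S M) Q := by
  rintro ⟨-, A, hA, -⟩
  exact hA fun X Y h => (notMem_splitFDs_last h.1).elim

theorem lhs_of_isPrimaryFD {α : Atom S} {A : Fin (S.arity α.rel)} {X Y : Finset (Fin M)}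
    (h : IsPrimaryFD (splitFDs S M) (σ.projAtom α (some A)) X Y) :
    X = Finset.univ.erase (σ.pos A) :=
  (mem_splitFDs_index.1 h.1).1

theorem exists_isPrimaryFD_projAtom {α : Atom S} {A B : Fin (S.arity α.rel)} {x : ℕ}
    (hB : B ∈ σ.lhs α.rel A) (hx : α.args B = .var x) :
    IsPrimaryFD (splitFDs S M) (σ.projAtom α (some A)) (Finset.univ.erase (σ.pos A))
      {σ.pos A} := by
  refine ⟨mem_splitFDs_index.2 ⟨rfl, rfl⟩, ⟨σ.pos B, ?_, x, ?_⟩, fun X' Y' h hs => ?_⟩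
  · by_cases h : σ.pos B = σ.pos A <;> simp [h]
  · exact (pad_pos _ _ _ _).trans (by simp [keep, hB, hx])
  · rw [(mem_splitFDs_index.1 h).1] at hs
    exact (ssubset_irrefl _ hs).elim

/-- The variable from `hvar` is in the key of every split atom of `R` and also in the keyless atom.
This yields primary-lhs variables and keeps the split atoms of one atom connected. The attribute
from `hcomm` gives a complex split atom whose key avoids `x`. -/
theorem final_query {Q : CQ S} (hQ : Q = rels.image fun R => Atom.mk R (U R))
    (hvar : ∀ R ∈ rels, (σ.gov R).Nonempty → ∃ B, B ∉ σ.gov R ∧ (∀ A ∈ σ.gov R, B ∈ σ.lhs R A) ∧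
      ∃ x, U R B = .var x)
    (hcomm : ∀ x, ∃ R ∈ rels, ∃ A ∈ σ.gov R, (∀ B ∈ σ.lhs R A, U R B ≠ .var x) ∧
      ((∃ c, U R A = .const c) ∨ ∃ y, U R A = .var y ∧ Q.Liaison y))
    (hun : Unsplittable Q) : Final (splitFDs S M) (σ.query rels U) := by
  have hmem : ∀ R, (⟨R, U R⟩ : Atom S) ∈ Q ↔ R ∈ rels := by
    intro R
    rw [hQ, Finset.mem_image]
    refine ⟨?_, fun h => ⟨R, h, rfl⟩⟩
    rintro ⟨R', hR', h⟩
    have := congrArg Atom.rel h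
    dsimp only at this
    exact this ▸ hR'
  have hform : ∀ α ∈ Q, α = ⟨α.rel, U α.rel⟩ := by
    intro α hα
    rw [hQ, Finset.mem_image] at hα
    obtain ⟨R, -, rfl⟩ := hα
    rfl
  refine ⟨?_, ?_, ?_⟩
  · intro β hβ
    obtain ⟨R, hR, o, ho, rfl⟩ := mem_query.1 hβ.1
    cases o with
    | none => exact (projAtom_none_notMem_complexPart hβ).elim
    | some A =>
      have hA : A ∈ σ.gov R := by simpa using ho
      obtain ⟨B, hB, hBA, x, hx⟩ := hvar R hR ⟨A, hA⟩
      refine ⟨x, σ.pos B, fun X Y h => ?_, ?_⟩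
      · have := lhs_of_isPrimaryFD h
        rw [this]
        refine Finset.mem_erase.2 ⟨fun h => hB ?_, Finset.mem_univ _⟩
        rw [pos_injective h]; exact hA
      · exact (pad_pos _ _ _ _).trans (by simp [keep, hBA A hA, hx])
  · intro x
    obtain ⟨R, hR, A, hA, hx, hc⟩ := hcomm x
    obtain ⟨B, hB, hBA, y, hy⟩ := hvar R hR ⟨A, hA⟩
    have hp := exists_isPrimaryFD_projAtom (σ := σ) (α := ⟨R, U R⟩) (hBA A hA) hy
    have hargA : (σ.projAtom ⟨R, U R⟩ (some A)).args (σ.pos A) = U R A :=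
      (pad_pos _ _ _ _).trans (by simp [keep])
    have hin : σ.projAtom ⟨R, U R⟩ (some A) ∈ σ.query rels U :=
      mem_query.2 ⟨R, hR, some A, by simpa using hA, rfl⟩
    refine ⟨σ.projAtom ⟨R, U R⟩ (some A), ⟨hin, σ.pos A, fun h => ?_, ?_, fun X Y h => ?_⟩, ?_⟩
    · simpa using h _ _ hp
    · rw [hargA]
      rcases hc with hc | ⟨z, hz, p, q, hne, hp, hq, hpz, hqz⟩
      · exact Or.inl hc
      · right
        refine ⟨z, hz, ?_⟩
        -- The designated copy of any other occurrence of `z` differs from the occurrence at `A` in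
        -- the split atom of `A`.
        have key : ∀ r : (α : Atom S) × Fin (S.arity α.rel), r ≠ ⟨⟨R, U R⟩, A⟩ → r.1 ∈ Q →
            r.1.args r.2 = .var z → (σ.query rels U).Liaison z := by
          rintro ⟨α, C⟩ hne' hα hz'
          obtain ⟨R', rfl⟩ : ∃ R', α = ⟨R', U R'⟩ := ⟨_, hform α hα⟩
          have hR' := (hmem R').1 hα
          obtain ⟨o, ho, ho1, ho2, hoQ, hoz⟩ := occurrence (σ := σ) (B := C) hR' hz'
          refine ⟨⟨σ.projAtom ⟨R', U R'⟩ o, σ.pos C⟩, ⟨σ.projAtom ⟨R, U R⟩ (some A), σ.pos A⟩,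
            fun h => hne' ?_, hoQ, hin, hoz, hargA.trans hz⟩
          have h1 := congrArg (fun r => r.1.rel) h
          obtain ⟨e, he⟩ := name_inj (σ := σ) h1
          dsimp only at e
          subst e
          dsimp only at he
          by_cases hC : C ∈ σ.gov R'
          · rw [ho1 hC, Option.some.injEq] at he
            rw [he]
          · rw [ho2 hC] at he
            cases he
        by_cases h : p = ⟨⟨R, U R⟩, A⟩
        · exact key q (fun h' => hne (h.trans h'.symm)) hq hqz
        · exact key p h hp hpz
    · have := h.2 _ _ hp
      rw [(mem_splitFDs_index.1 h.1).1] at this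
      exact (ssubset_irrefl _ this).elim
    · rintro ⟨j, hj, hjx⟩
      have hj' := hj _ _ hp
      rcases pad_cases (σ := σ) (Term.const 0) (σ.keep R (some A)) (U R) j with h | ⟨C, hC, rfl, h⟩
      · exact absurd (h.symm.trans hjx) (by simp)
      · rcases Finset.mem_insert.1 hC with rfl | hC
        · simp at hj'
        · exact hx C hC (h.symm.trans hjx)
  · intro Q₁ Q₂ h₁ h₂ hd hv he
    have hshare : ∀ R ∈ rels, ∀ o ∈ Finset.insertNone (σ.gov R), o ≠ none →
        ∃ x, (∃ A, (σ.projAtom ⟨R, U R⟩ o).args A = .var x) ∧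
          ∃ A, (σ.projAtom ⟨R, U R⟩ none).args A = .var x := by
      intro R hR o ho hne
      obtain ⟨A, rfl⟩ := Option.ne_none_iff_exists'.1 hne
      have hA : A ∈ σ.gov R := by simpa using ho
      obtain ⟨B, hB, hBA, x, hx⟩ := hvar R hR ⟨A, hA⟩
      exact ⟨x, ⟨σ.pos B, (pad_pos _ _ _ _).trans (by simp [keep, hBA A hA, hx])⟩,
        ⟨σ.pos B, (pad_pos _ _ _ _).trans (by simp [keep, hB, hx])⟩⟩
    have hall : ∀ R ∈ rels, ∀ o ∈ Finset.insertNone (σ.gov R),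
        σ.projAtom ⟨R, U R⟩ o ∈ Q₁ ∨ σ.projAtom ⟨R, U R⟩ o ∈ Q₂ := fun R hR o ho => by
      rw [← Finset.mem_union, he]
      exact mem_query.2 ⟨R, hR, o, ho, rfl⟩
    have hnone : ∀ R : Fin S.numRel, none ∈ Finset.insertNone (σ.gov R) := fun R => by simp
    -- All split atoms of one atom lie on the same side, so a splitting of the split query induces a
    -- splitting of `Q`.
    have hfam : ∀ R ∈ rels, ∀ o ∈ Finset.insertNone (σ.gov R),
        (σ.projAtom ⟨R, U R⟩ o ∈ Q₁ ↔ σ.projAtom ⟨R, U R⟩ none ∈ Q₁) := by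
      intro R hR o ho
      by_cases hne : o = none
      · rw [hne]
      obtain ⟨x, ⟨A, hA⟩, B, hB⟩ := hshare R hR o ho hne
      constructor
      · intro h
        by_contra h'
        exact Set.disjoint_left.1 hv ⟨_, h, A, hA⟩
          ⟨_, (hall R hR none (hnone R)).resolve_left h', B, hB⟩
      · intro h
        by_contra h'
        exact Set.disjoint_left.1 hv ⟨_, h, B, hB⟩ ⟨_, (hall R hR o ho).resolve_left h', A, hA⟩
    let p : Fin S.numRel → Prop := fun R => σ.projAtom ⟨R, U R⟩ none ∈ Q₁
    classical
    refine hun (Q.filter fun α => p α.rel) (Q.filter fun α => ¬ p α.rel) ?_ ?_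
      (Finset.disjoint_filter_filter_not _ _ _) ?_ (Finset.filter_union_filter_not_eq _ _)
    · obtain ⟨β, hβ⟩ := h₁
      obtain ⟨R, hR, o, ho, rfl⟩ := mem_query.1 (he ▸ Finset.mem_union_left _ hβ)
      exact ⟨⟨R, U R⟩, Finset.mem_filter.2 ⟨(hmem R).2 hR, (hfam R hR o ho).1 hβ⟩⟩
    · obtain ⟨β, hβ⟩ := h₂
      obtain ⟨R, hR, o, ho, rfl⟩ := mem_query.1 (he ▸ Finset.mem_union_right _ hβ)
      exact ⟨⟨R, U R⟩, Finset.mem_filter.2 ⟨(hmem R).2 hR, fun h =>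
        Finset.disjoint_left.1 hd ((hfam R hR o ho).2 h) hβ⟩⟩
    · rw [Set.disjoint_left]
      rintro x ⟨α, hα, A, hA⟩ ⟨β, hβ, B, hB⟩
      obtain ⟨hα, hpα⟩ := Finset.mem_filter.1 hα
      obtain ⟨hβ, hpβ⟩ := Finset.mem_filter.1 hβ
      obtain ⟨R, rfl⟩ : ∃ R, α = ⟨R, U R⟩ := ⟨_, hform α hα⟩
      obtain ⟨R', rfl⟩ : ∃ R', β = ⟨R', U R'⟩ := ⟨_, hform β hβ⟩
      have hR := (hmem R).1 hα
      have hR' := (hmem R').1 hβ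
      obtain ⟨o, ho, -, -, -, hox⟩ := occurrence (σ := σ) hR hA
      obtain ⟨o', ho', -, -, -, hox'⟩ := occurrence (σ := σ) hR' hB
      refine Set.disjoint_left.1 hv ⟨_, (hfam R hR o ho).2 hpα, _, hox⟩
        ⟨_, (hall R' hR' o' ho').resolve_left fun h => hpβ ((hfam R' hR' o' ho').1 h), _, hox'⟩

end Final

end Split

end CQA

namespace CQA

/-! ## The databases that the reduction produces -/

/-- An injective encoding of tuples by numbers. -/
def code : {n : ℕ} → (Fin n → ℕ) → ℕ
  | 0, _ => 0
  | _ + 1, f => (f 0 + code (Fin.tail f)) * (f 0 + code (Fin.tail f)) + f 0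

/-- A number `s * s + a` with `a ≤ s` determines `s`, hence `a`; here `s` is the sum of the head `a`
and the code of the tail. -/
theorem code_injective : ∀ {n : ℕ}, Function.Injective (code (n := n))
  | 0, _, _, _ => Subsingleton.elim _ _
  | n + 1, f, g, h => by
    simp only [code] at h
    have hsum : f 0 + code (Fin.tail f) = g 0 + code (Fin.tail g) := by
      rcases lt_trichotomy (f 0 + code (Fin.tail f)) (g 0 + code (Fin.tail g)) with hl | he | hl
      · nlinarith
      · exact he
      · nlinarith
    have h0 : f 0 = g 0 := by rw [hsum] at h; omega
    have ht := code_injective (show code (Fin.tail f) = code (Fin.tail g) by omega)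
    rw [← Fin.cons_self_tail f, ← Fin.cons_self_tail g, h0, ht]

/-- The data of the reduction: the relation names that are split, their atoms, the attributes that
hold identifiers, and the facts over the other relation names. -/
structure Plan (S : Schema) (M : ℕ) extends Split S M where
  rels : Finset (Fin S.numRel)
  args : ∀ R, Fin (S.arity R) → Term
  tagged : ∀ R, Finset (Fin (S.arity R))
  ground : Finset (Fact S)

namespace Plan

variable {S : Schema} {M : ℕ} (p : Plan S M)

/-- The fact with the identifiers put in. -/
def tag (f : Fact S) : Fact S :=
  ⟨f.rel, fun A => if A ∈ p.tagged f.rel then code f.val else f.val A⟩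

/-- The fact has the constants of the atom at the attributes that are not governed. -/
def Matches (f : Fact S) : Prop :=
  ∀ A, A ∉ p.gov f.rel → ∀ c, p.args f.rel A = .const c → f.val A = c

/-- The facts without identifiers that result from the database `D`. -/
def Raw (D : Database (splitSchema S M)) (f : Fact S) : Prop :=
  f.rel ∈ p.rels ∧ p.Matches f ∧
    ∀ o ∈ Finset.insertNone (p.gov f.rel), p.toSplit.projFact f o ∈ D

theorem tag_injective : Function.Injective p.tag := by
  rintro ⟨R, u⟩ ⟨R', v⟩ h
  obtain rfl : R = R' := congrArg Fact.rel h
  simp only [tag, Fact.mk.injEq, heq_eq_eq, true_and] at h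
  congr 1
  by_cases ht : ∃ A, A ∈ p.tagged R
  · obtain ⟨A, hA⟩ := ht
    have := congrFun h A
    simp only [hA, if_true] at this
    exact code_injective this
  · push Not at ht
    funext A
    simpa [ht A] using congrFun h A

/-- The active domain. -/
def adom (D : Database (splitSchema S M)) : Finset ℕ :=
  D.biUnion fun g => Finset.univ.image fun i : Fin M => g.val i

variable {p}

/-- Each attribute is kept by some projection. So the raw facts can be found among the tuples over
the active domain, which are polynomially many since arities are fixed. -/
theorem Raw.mem_adom {D : Database (splitSchema S M)} {f : Fact S} (h : p.Raw D f)
    (A : Fin (S.arity f.rel)) : f.val A ∈ adom D := by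
  have key : ∀ o ∈ Finset.insertNone (p.gov f.rel), A ∈ p.toSplit.keep f.rel o →
      f.val A ∈ adom D := by
    intro o ho hA
    refine Finset.mem_biUnion.2 ⟨_, h.2.2 o ho, Finset.mem_image.2
      ⟨p.toSplit.pos A, Finset.mem_univ _, ?_⟩⟩
    exact (Split.pad_pos _ _ _ _).trans (if_pos hA)
  by_cases hg : A ∈ p.gov f.rel
  · exact key (some A) (by simpa using hg) (by simp [Split.keep])
  · exact key none (by simp) (by simp [Split.keep, hg])

theorem finite_raw (D : Database (splitSchema S M)) : {f | p.Raw D f}.Finite := by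
  have hfin : (⋃ R : Fin S.numRel, Fact.mk R '' {v | ∀ A, v A ∈ adom D}).Finite := by
    refine Set.finite_iUnion fun R => Set.Finite.image _ ?_
    have := Set.Finite.pi' (fun _ : Fin (S.arity R) => (adom D).finite_toSet)
    exact this
  refine hfin.subset fun f hf => ?_
  rw [Set.mem_iUnion]
  exact ⟨f.rel, f.val, fun A => Raw.mem_adom hf A, rfl⟩

variable (p) in
/-- The facts over the source schema, without identifiers. -/
noncomputable def facts (D : Database (splitSchema S M)) : Finset (Fact S) :=
  (finite_raw (p := p) D).toFinset ∪ p.ground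

variable (p) in
/-- The database over the source schema. -/
noncomputable def database (D : Database (splitSchema S M)) : Database S :=
  (p.facts D).image p.tag

theorem mem_facts {D : Database (splitSchema S M)} {f : Fact S} :
    f ∈ p.facts D ↔ p.Raw D f ∨ f ∈ p.ground := by
  simp [facts]

/-- The projections of a fact. -/
def proj (p : Plan S M) (f : Fact S) : Finset (Fact (splitSchema S M)) :=
  if f.rel ∈ p.rels then (Finset.insertNone (p.gov f.rel)).image (p.toSplit.projFact f) else ∅

theorem projFact_ext {f g : Fin (S.arity R) → ℕ} {o : Option (Fin (S.arity R))}
    (h : ∀ A ∈ p.toSplit.keep R o, f A = g A) :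
    p.toSplit.projFact ⟨R, f⟩ o = p.toSplit.projFact ⟨R, g⟩ o := by
  unfold Split.projFact Split.pad
  congr 1
  funext i
  dsimp only
  split_ifs with h1 h2
  · exact h _ h2
  · rfl
  · rfl

theorem sameBlock_projFact_iff {R : Fin S.numRel} {f g : Fin (S.arity R) → ℕ}
    {o : Option (Fin (S.arity R))} :
    (SameBlock (p.toSplit.projFact ⟨R, f⟩ o) (p.toSplit.projFact ⟨R, g⟩ o) ∧
      p.toSplit.projFact ⟨R, f⟩ o ≠ p.toSplit.projFact ⟨R, g⟩ o) ↔
    ∃ A, o = some A ∧ (∀ B ∈ p.lhs R A, B ≠ A → f B = g B) ∧ f A ≠ g A := by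
  constructor
  · rintro ⟨h | ⟨R', i, u, v, h1, h2, h3⟩, hne⟩
    · exact (hne h).elim
    · have hn : p.toSplit.name R o = finProdFinEquiv (R', i.castSucc) := congrArg Fact.rel h1
      have := finProdFinEquiv.injective hn
      simp only [Prod.mk.injEq] at this
      obtain ⟨rfl, hi⟩ := this
      cases o with
      | none => exact (Fin.castSucc_ne_last _ hi.symm).elim
      | some A =>
        simp only [Option.elim, Fin.castSucc_inj] at hi
        subst hi
        simp only [Split.projFact, Split.name, Option.elim, Fact.mk.injEq, heq_eq_eq,
          true_and] at h1 h2
        subst h1 h2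
        have hag : ∀ B ∈ p.lhs R A, B ≠ A → f B = g B := by
          intro B hB hBA
          have := h3 (p.toSplit.pos B) (fun h => hBA (Split.pos_injective h))
          rw [Split.pad_pos, Split.pad_pos] at this
          simpa [Split.keep, hB] using this
        refine ⟨A, rfl, hag, fun hA => hne (projFact_ext fun B hB => ?_)⟩
        by_cases hBA : B = A
        · rw [hBA]; exact hA
        · exact hag B ((Finset.mem_insert.1 hB).resolve_left hBA) hBA
  · rintro ⟨A, rfl, h, hA⟩
    refine ⟨Or.inr ⟨R, p.toSplit.pos A, _, _, rfl, rfl, fun j hj => ?_⟩, fun he => hA ?_⟩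
    · unfold Split.pad
      dsimp only
      split_ifs with h1 h2
      · rcases Finset.mem_insert.1 h2 with h2 | h2
        · exact (hj (by rw [← h2]; rfl)).elim
        · refine h _ h2 fun h3 => hj (by rw [← h3]; rfl)
      · rfl
      · rfl
    · simp only [Split.projFact, Fact.mk.injEq, heq_eq_eq, true_and] at he
      have := congrFun he (p.toSplit.pos A)
      rw [Split.pad_pos, Split.pad_pos] at this
      simpa [Split.keep] using this

variable (p) in
/-- What the reduction needs to know about the data. -/
structure Correct (F : FDSet S) (Q : CQ S) : Prop where
  consistent_iff : ∀ R ∈ p.rels, ∀ f g : Fin (S.arity R) → ℕ, p.Matches ⟨R, f⟩ →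
    p.Matches ⟨R, g⟩ → (Consistent F {p.tag ⟨R, f⟩, p.tag ⟨R, g⟩} ↔
      ∀ A ∈ p.gov R, (∀ B ∈ p.lhs R A, f B = g B) → f A = g A)
  ground_rel : ∀ f ∈ p.ground, f.rel ∉ p.rels
  ground_unique : ∀ f ∈ p.ground, ∀ g ∈ p.ground, f.rel = g.rel → f = g
  entailedBy_iff : ∀ J : Finset (Fact S), (∀ f ∈ J, f.rel ∈ p.rels ∧ p.Matches f) →
    (Q.EntailedBy ((J ∪ p.ground).image p.tag) ↔
      ∃ h : ℕ → ℕ, ∀ R ∈ p.rels, Fact.mk R (fun A => (p.args R A).eval h) ∈ J)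

/-- This checks the hypotheses of `relFreq_eq_of_blocks`, with the projections of a fact as `π`.
Ground facts have no projections, so they count as contained in every repair. -/
theorem Correct.relFreq_eq {F : FDSet S} {Q : CQ S} (hp : p.Correct F Q)
    (D : Database (splitSchema S M)) :
    relFreq (splitFDs S M) (p.toSplit.query p.rels p.args) D = relFreq F Q (p.database D) := by
  have hground : ∀ f ∈ p.ground, p.proj f = ∅ := fun f hf => if_neg (hp.ground_rel f hf)
  have hraw : ∀ {f}, p.Raw D f →
      p.proj f = (Finset.insertNone (p.gov f.rel)).image (p.toSplit.projFact f) :=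
    fun hf => if_pos hf.1
  refine relFreq_eq_of_blocks (π := p.proj) sameBlock_equivalence not_consistent_splitFDs_iff
    (p.tag_injective.injOn) ?_ ?_ ?_ ?_
  · intro f hf
    rcases mem_facts.1 hf with hf | hf
    · rw [hraw hf]
      exact Finset.image_subset_iff.2 hf.2.2
    · simp [hground f hf]
  · intro f hf g hg
    by_cases hr : f.rel = g.rel
    swap
    · have : Consistent F {p.tag f, p.tag g} := consistent_pair_of_rel_ne hr
      simp only [this, not_true, false_iff, not_exists, not_and]
      intro a ha b hb hab
      unfold proj at ha hb
      split_ifs at ha hb with h1 h2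
      · obtain ⟨o, -, rfl⟩ := Finset.mem_image.1 ha
        obtain ⟨o', -, rfl⟩ := Finset.mem_image.1 hb
        exfalso
        have hname : p.toSplit.name f.rel o = p.toSplit.name g.rel o' := by
          rcases hab with h | ⟨R, i, u, v, h1, h2, -⟩
          · exact congrArg Fact.rel h
          · exact (congrArg Fact.rel h1).trans (congrArg Fact.rel h2).symm
        exact hr (Split.name_inj hname).1
      all_goals simp at ha hb
    · rcases mem_facts.1 hf with hf | hf
      · have hg : p.Raw D g := (mem_facts.1 hg).resolve_right fun h =>
          hp.ground_rel g h (hr ▸ hf.1)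
        rw [hraw hf, hraw hg]
        obtain ⟨R, f⟩ := f
        obtain ⟨R', g⟩ := g
        obtain rfl : R = R' := hr
        rw [hp.consistent_iff R hf.1 f g hf.2.1 hg.2.1]
        constructor
        · intro h
          push Not at h
          obtain ⟨A, hA, h1, h2⟩ := h
          have ho : some A ∈ Finset.insertNone (p.gov R) := by simpa using hA
          refine ⟨_, Finset.mem_image_of_mem _ ho, _, Finset.mem_image_of_mem _ ho, ?_⟩
          exact sameBlock_projFact_iff.2 ⟨A, rfl, fun B hB _ => h1 B hB, h2⟩
        · rintro ⟨a, ha, b, hb, hab, hne⟩ h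
          obtain ⟨o, ho, rfl⟩ := Finset.mem_image.1 ha
          obtain ⟨o', ho', rfl⟩ := Finset.mem_image.1 hb
          have hname : p.toSplit.name R o = p.toSplit.name R o' := by
            rcases hab with h | ⟨R, i, u, v, h1, h2, -⟩
            · exact congrArg Fact.rel h
            · exact (congrArg Fact.rel h1).trans (congrArg Fact.rel h2).symm
          have he : o = o' := (Split.name_inj hname).2
          subst he
          obtain ⟨A, rfl, h1, h2⟩ := sameBlock_projFact_iff.1 ⟨hab, hne⟩
          have hA : A ∈ p.gov R := by simpa using ho
          exact h2 (h A hA fun B hB => h1 B hB fun hBA => p.notMem_gov R A hA B hB (hBA ▸ hA))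
      · have hg : g ∈ p.ground := (mem_facts.1 hg).resolve_left fun h =>
          hp.ground_rel f hf (hr ▸ h.1)
        obtain rfl := hp.ground_unique f hf g hg hr
        simp [hground f hf, consistent_singleton]
  · intro E hE f hf
    rcases mem_facts.1 hf with hf' | hf'
    swap
    · exact ⟨f, hf, by simp [hground f hf']⟩
    -- A repair meets every block of `D`. Its choices in the blocks of the projections of `f` supply
    -- the new values of the governed attributes.
    have hrep : ∀ a ∈ D, ∃ b ∈ E, SameBlock a b := by
      intro a ha
      by_cases haE : a ∈ E
      · exact ⟨a, haE, Or.inl rfl⟩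
      · obtain ⟨b, hb, hab, -⟩ := hE.2.2 a ha haE
        exact ⟨b, hb, hab⟩
    obtain ⟨R, f⟩ := f
    have hsome : ∀ A ∈ p.gov R, ∃ v : Fin M → ℕ,
        (⟨p.toSplit.name R (some A), v⟩ : Fact (splitSchema S M)) ∈ E ∧
        ∀ j, j ≠ p.toSplit.pos A → v j = (Split.pad 0 (p.toSplit.keep R (some A)) f : Fin M → ℕ) j := by
      intro A hA
      obtain ⟨b, hb, hab⟩ := hrep _ (hf'.2.2 (some A) (by simpa using hA))
      rcases hab with rfl | ⟨R', i, u, v, h1, rfl, h3⟩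
      · exact ⟨_, hb, fun _ _ => rfl⟩
      · have h1' := congrArg Fact.rel h1
        have hi := finProdFinEquiv.injective h1'
        simp only [Option.elim, Prod.mk.injEq, Fin.castSucc_inj] at hi
        obtain ⟨rfl, rfl⟩ := hi
        simp only [Split.projFact, Split.name, Option.elim, Fact.mk.injEq, heq_eq_eq,
          true_and] at h1
        subst h1
        exact ⟨v, hb, fun j hj => (h3 j hj).symm⟩
    choose! v hvE hv using hsome
    -- Left-hand sides are ungoverned, so `f'` has the same keys as `f`, and its projections are the
    -- chosen facts. The keyless projection is in `E` because nothing conflicts with it.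
    let f' : Fin (S.arity R) → ℕ := fun A => if A ∈ p.gov R then v A (p.toSplit.pos A) else f A
    have hnone : p.toSplit.projFact ⟨R, f'⟩ none = p.toSplit.projFact ⟨R, f⟩ none := by
      refine projFact_ext fun A hA => ?_
      have : A ∉ p.gov R := by simpa [Split.keep] using hA
      simp [f', this]
    have hproj : ∀ A ∈ p.gov R, p.toSplit.projFact ⟨R, f'⟩ (some A) =
        ⟨p.toSplit.name R (some A), v A⟩ := by
      intro A hA
      simp only [Split.projFact, Fact.mk.injEq, heq_eq_eq, true_and]
      funext j
      by_cases hj : j = p.toSplit.pos A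
      · rw [hj, Split.pad_pos]
        simp [Split.keep, f', hA]
      · rw [hv A hA j hj]
        unfold Split.pad
        split_ifs with h1 h2
        · rcases Finset.mem_insert.1 h2 with h2 | h2
          · exact (hj (by rw [← h2]; rfl)).elim
          · simp [f', p.notMem_gov R A hA _ h2]
        · rfl
        · rfl
    have hnoneE : p.toSplit.projFact ⟨R, f⟩ none ∈ E := by
      obtain ⟨b, hb, hab⟩ := hrep _ (hf'.2.2 none (by simp))
      rcases hab with h | ⟨R', i, u, w, h1, -⟩
      · rw [h]; exact hb
      · have h1' := congrArg Fact.rel h1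
        have hi := finProdFinEquiv.injective h1'
        simp only [Option.elim, Prod.mk.injEq] at hi
        exact (Fin.castSucc_ne_last _ hi.2.symm).elim
    have hall : ∀ o ∈ Finset.insertNone (p.gov R), p.toSplit.projFact ⟨R, f'⟩ o ∈ E := by
      intro o ho
      cases o with
      | none => rw [hnone]; exact hnoneE
      | some A =>
        have hA : A ∈ p.gov R := by simpa using ho
        rw [hproj A hA]
        exact hvE A hA
    have hfr : p.Raw D ⟨R, f'⟩ := by
      refine ⟨hf'.1, fun A hA c hc => ?_, fun o ho => hE.1 (hall o ho)⟩
      have := hf'.2.1 A hA c hc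
      dsimp only at this hA
      simp [f', hA, this]
    refine ⟨⟨R, f'⟩, mem_facts.2 (Or.inl hfr), ?_, ?_⟩
    · rw [hraw hfr]
      exact Finset.image_subset_iff.2 hall
    · rw [hraw hf', hraw hfr]
      intro a ha
      obtain ⟨o, ho, rfl⟩ := Finset.mem_image.1 ha
      refine ⟨_, Finset.mem_image_of_mem _ ho, ?_⟩
      cases o with
      | none => rw [hnone]; exact Or.inl rfl
      | some A =>
        have hA : A ∈ p.gov R := by simpa using ho
        rw [hproj A hA]
        exact Or.inr ⟨R, p.toSplit.pos A, _, _, rfl, rfl, fun j hj => (hv A hA j hj).symm⟩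
  · intro E hE
    have hfilter : (p.facts D).filter (fun f => p.proj f ⊆ E) =
        ((p.facts D).filter fun f => f.rel ∈ p.rels ∧ p.proj f ⊆ E) ∪ p.ground := by
      ext f
      simp only [Finset.mem_union, Finset.mem_filter, mem_facts]
      constructor
      · rintro ⟨h1 | h1, h2⟩
        · exact Or.inl ⟨Or.inl h1, h1.1, h2⟩
        · exact Or.inr h1
      · rintro (⟨h1, -, h2⟩ | h1)
        · exact ⟨h1, h2⟩
        · exact ⟨Or.inr h1, by simp [hground f h1]⟩
    rw [hfilter, hp.entailedBy_iff]
    swap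
    · intro f hf
      obtain ⟨h1, h2, -⟩ := Finset.mem_filter.1 hf
      exact ⟨h2, ((mem_facts.1 h1).resolve_right fun h => hp.ground_rel f h h2).2.1⟩
    -- Projection commutes with evaluation, so one assignment `h` serves both queries.
    have hev : ∀ (h : ℕ → ℕ) (R : Fin S.numRel) (o : Option (Fin (S.arity R))),
        (Fact.mk (p.toSplit.projAtom ⟨R, p.args R⟩ o).rel fun A =>
          ((p.toSplit.projAtom ⟨R, p.args R⟩ o).args A).eval h : Fact (splitSchema S M)) =
        p.toSplit.projFact ⟨R, fun A => (p.args R A).eval h⟩ o := by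
      intro h R o
      simp only [Split.projAtom, Split.projFact, Fact.mk.injEq, heq_eq_eq, true_and]
      funext i
      unfold Split.pad
      split_ifs <;> rfl
    refine exists_congr fun h => ?_
    constructor
    · intro hh R hR
      have hall : ∀ o ∈ Finset.insertNone (p.gov R),
          p.toSplit.projFact ⟨R, fun A => (p.args R A).eval h⟩ o ∈ E := fun o ho => by
        rw [← hev]
        exact hh _ (Split.mem_query.2 ⟨R, hR, o, ho, rfl⟩)
      have hr : p.Raw D ⟨R, fun A => (p.args R A).eval h⟩ := by
        refine ⟨hR, fun A _ c hc => ?_, fun o ho => hE.1 (hall o ho)⟩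
        dsimp only at hc ⊢
        rw [hc]; rfl
      refine Finset.mem_filter.2 ⟨mem_facts.2 (Or.inl hr), hR, ?_⟩
      rw [hraw hr]
      exact Finset.image_subset_iff.2 hall
    · intro hh β hβ
      obtain ⟨R, hR, o, ho, rfl⟩ := Split.mem_query.1 hβ
      rw [hev]
      have := (Finset.mem_filter.1 (hh R hR)).2.2
      rw [proj, if_pos hR] at this
      exact this (Finset.mem_image_of_mem _ ho)

end Plan

end CQA

namespace CQA

/-! ## The program of the reduction -/

section Tuples

variable {B : Problem}

/-- The entry at position `i` of a list. -/
def Val.nth : ℕ → Val → Val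
  | 0, v => v.fst
  | i + 1, v => Val.nth i v.snd

/-- The representation of a tuple. -/
def Val.tuple {n : ℕ} (f : Fin n → ℕ) : Val := .ofList (List.ofFn fun i => .nat (f i))

theorem Val.nth_tuple {n : ℕ} (f : Fin n → ℕ) (i : Fin n) :
    Val.nth i (Val.tuple f) = .nat (f i) := by
  induction n with
  | zero => exact i.elim0
  | succ n ih =>
    simp only [Val.tuple, List.ofFn_succ, Val.ofList]
    cases i using Fin.cases with
    | zero => rfl
    | succ i => exact ih (fun i => f i.succ) i

theorem PF.nth {f : Val → Val} (hf : PF B f) (i : ℕ) : PF B fun v => Val.nth i (f v) := by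
  induction i generalizing f with
  | zero => exact hf.fst
  | succ i ih => exact ih hf.snd

/-- The code of a tuple, as a function of its representation. -/
def codeVal : ℕ → Val → Val
  | 0, _ => .nat 0
  | n + 1, v => .nat ((v.fst.toNat + (codeVal n v.snd).toNat) *
      (v.fst.toNat + (codeVal n v.snd).toNat) + v.fst.toNat)

theorem codeVal_tuple {n : ℕ} (f : Fin n → ℕ) : codeVal n (Val.tuple f) = .nat (code f) := by
  induction n with
  | zero => rfl
  | succ n ih =>
    have : (Val.tuple f).snd = Val.tuple (Fin.tail f) := by
      simp only [Val.tuple, List.ofFn_succ, Val.ofList, Val.snd]; rfl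
    have h0 : (Val.tuple f).fst = .nat (f 0) := by
      simp only [Val.tuple, List.ofFn_succ, Val.ofList, Val.fst]
    simp only [codeVal, this, h0, ih, code, Val.toNat]

theorem PF.codeVal {f : Val → Val} (hf : PF B f) (n : ℕ) :
    PF B fun v => CQA.codeVal n (f v) := by
  induction n generalizing f with
  | zero => exact PF.const _
  | succ n ih => exact ((hf.fst.add (ih hf.snd)).mul (hf.fst.add (ih hf.snd))).add hf.fst

theorem PL.static (l : List Val) : PL B fun _ => l := by
  induction l with
  | nil => exact PL.nil
  | cons a l ih => exact PL.cons (PF.const a) ih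

/-- The entries at positions below `m` in the facts of a database. -/
def adomList (m : ℕ) (v : Val) : List Val :=
  v.elems.reverse.flatMap fun e => (List.range m).flatMap fun i => [Val.nth i e.snd]

theorem PL.adomList (m : ℕ) : PL B (CQA.adomList m) :=
  PL.flatMap PF.id (PL.flatMap_static (H := fun i w => [Val.nth i w.snd.snd]) (List.range m)
    fun i _ => PL.cons (PF.snd₀.snd.nth i) PL.nil)

/-- The tuples of length `n` over the active domain. -/
def tupleList (m : ℕ) : ℕ → Val → List Val
  | 0, _ => [.nat 0]
  | n + 1, v => (Val.ofList (adomList m v)).elems.reverse.flatMap fun a =>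
      (Val.ofList (tupleList m n v)).elems.reverse.flatMap fun t => [.pair a t]

theorem PL.tupleList (m n : ℕ) : PL B (CQA.tupleList m n) := by
  induction n with
  | zero => exact PL.cons (PF.const _) PL.nil
  | succ n ih =>
    refine PL.flatMap (H := fun w => (Val.ofList (CQA.tupleList m n w.fst)).elems.reverse.flatMap
      fun t => [.pair w.snd t]) (PL.adomList m).ofList ?_
    exact PL.flatMap (H := fun w => [.pair w.fst.snd w.snd]) (ih.comp PF.fst₀).ofList
      (PL.cons (PF.fst₀.snd.pair PF.snd₀) PL.nil)

theorem mem_tupleList {m n : ℕ} {v : Val} {s : Finset ℕ}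
    (hs : ∀ x, x ∈ adomList m v ↔ ∃ a ∈ s, x = .nat a) (t : Val) :
    t ∈ tupleList m n v ↔ ∃ f : Fin n → ℕ, (∀ i, f i ∈ s) ∧ t = Val.tuple f := by
  induction n generalizing t with
  | zero =>
    simp only [tupleList, List.mem_singleton]
    constructor
    · rintro rfl
      exact ⟨Fin.elim0, fun i => i.elim0, rfl⟩
    · rintro ⟨f, -, rfl⟩
      rfl
  | succ n ih =>
    simp only [tupleList, Val.elems_ofList, List.mem_flatMap, List.mem_reverse, hs, ih,
      List.mem_singleton]
    constructor
    · rintro ⟨_, ⟨a, ha, rfl⟩, _, ⟨f, hf, rfl⟩, rfl⟩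
      refine ⟨Fin.cons a f, fun i => ?_, ?_⟩
      · cases i using Fin.cases with
        | zero => exact ha
        | succ i => exact hf i
      · simp [Val.tuple, List.ofFn_succ, Val.ofList]
    · rintro ⟨f, hf, rfl⟩
      exact ⟨_, ⟨f 0, hf 0, rfl⟩, _, ⟨fun i => f i.succ, fun i => hf _, rfl⟩,
        by simp [Val.tuple, List.ofFn_succ, Val.ofList]⟩

end Tuples

theorem Fact.encode_eq {S : Schema} (f : Fact S) : f.encode = .pair (.nat f.rel)
    (.ofList ((List.finRange (S.arity f.rel)).map fun A => .nat (f.val A))) := by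
  rw [Fact.encode, List.ofFn_eq_map]

theorem DatabaseRepr.mem_elems {S : Schema} {D : Database S} {v : Val} (h : DatabaseRepr v D)
    (x : Val) : x ∈ v.elems ↔ ∃ f ∈ D, x = f.encode := by
  obtain ⟨l, rfl, rfl⟩ := h
  rw [Val.elems_ofList]
  simp [eq_comm]

theorem databaseRepr_ofList {S : Schema} {D : Database S} {l : List Val}
    (h : ∀ x, x ∈ l ↔ ∃ f ∈ D, x = f.encode) : DatabaseRepr (Val.ofList l) D := by
  have hl : ∃ m : List (Fact S), l = m.map Fact.encode := by
    have h' : ∀ x ∈ l, ∃ f : Fact S, x = f.encode := fun x hx =>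
      let ⟨f, _, hf⟩ := (h x).1 hx
      ⟨f, hf⟩
    clear h
    induction l with
    | nil => exact ⟨[], rfl⟩
    | cons a l ih =>
      obtain ⟨m, hm⟩ := ih fun x hx => h' x (by simp [hx])
      obtain ⟨f, hf⟩ := h' a (by simp)
      exact ⟨f :: m, by rw [hf, hm]; rfl⟩
  obtain ⟨m, rfl⟩ := hl
  refine ⟨m, ?_, rfl⟩
  ext f
  rw [List.mem_toFinset]
  constructor
  · intro hf
    obtain ⟨g, hg, he⟩ := (h _).1 (List.mem_map_of_mem hf)
    exact Fact.encode_injective he ▸ hg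
  · intro hf
    obtain ⟨g, hg, he⟩ := List.mem_map.1 ((h f.encode).2 ⟨f, hf, rfl⟩)
    exact Fact.encode_injective he ▸ hg

namespace Plan

variable {S : Schema} {M : ℕ} {p : Plan S M} {B : Problem}

theorem mem_adomList {D : Database (splitSchema S M)} {v : Val} (hv : DatabaseRepr v D) (x : Val) :
    x ∈ adomList M v ↔ ∃ a ∈ adom D, x = .nat a := by
  simp only [adomList, List.mem_flatMap, List.mem_reverse, hv.mem_elems, List.mem_range,
    List.mem_singleton, adom, Finset.mem_biUnion, Finset.mem_image, Finset.mem_univ, true_and]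
  constructor
  · rintro ⟨_, ⟨f, hf, rfl⟩, i, hi, rfl⟩
    exact ⟨f.val ⟨i, hi⟩, ⟨f, hf, ⟨i, hi⟩, rfl⟩, Val.nth_tuple f.val ⟨i, hi⟩⟩
  · rintro ⟨_, ⟨f, hf, i, rfl⟩, rfl⟩
    exact ⟨_, ⟨f, hf, rfl⟩, i, i.2, (Val.nth_tuple f.val i).symm⟩

/-- The encoding of the projection of a fact, as a function of its tuple. -/
def projVal (p : Plan S M) (R : Fin S.numRel) (o : Option (Fin (S.arity R))) (t : Val) : Val :=
  .pair (.nat (p.toSplit.name R o)) (.ofList ((List.finRange M).map fun i : Fin M =>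
    if h : i.1 < S.arity R then
      if ⟨i, h⟩ ∈ p.toSplit.keep R o then Val.nth i t else .nat 0 else .nat 0))

theorem pf_projVal {f : Val → Val} (hf : PF B f) (R : Fin S.numRel)
    (o : Option (Fin (S.arity R))) : PF B fun v => p.projVal R o (f v) := by
  refine (PF.const _).pair (PF.ofList _ (f := fun (i : Fin M) v => if h : i.1 < S.arity R then
      if ⟨i, h⟩ ∈ p.toSplit.keep R o then Val.nth i (f v) else .nat 0 else .nat 0) fun i _ => ?_)
  split_ifs
  · exact hf.nth i
  · exact PF.const _
  · exact PF.const _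

theorem projVal_tuple (R : Fin S.numRel) (o : Option (Fin (S.arity R)))
    (f : Fin (S.arity R) → ℕ) :
    p.projVal R o (.tuple f) = (p.toSplit.projFact ⟨R, f⟩ o).encode := by
  rw [projVal, Fact.encode_eq]
  unfold Split.projFact Split.pad
  congr 2
  refine List.map_congr_left fun i _ => ?_
  dsimp only
  split_ifs with h1 h2
  · exact Val.nth_tuple f ⟨i, h1⟩
  · rfl
  · rfl

/-- The encoding of a fact with the identifiers put in, as a function of its tuple. -/
def tagVal (p : Plan S M) (R : Fin S.numRel) (t : Val) : Val :=
  .pair (.nat R) (.ofList ((List.finRange (S.arity R)).map fun A =>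
    if A ∈ p.tagged R then codeVal (S.arity R) t else Val.nth A t))

theorem pf_tagVal {f : Val → Val} (hf : PF B f) (R : Fin S.numRel) :
    PF B fun v => p.tagVal R (f v) := by
  refine (PF.const _).pair (PF.ofList _ (f := fun A v =>
    if A ∈ p.tagged R then codeVal (S.arity R) (f v) else Val.nth A (f v)) fun A _ => ?_)
  split_ifs
  · exact hf.codeVal _
  · exact hf.nth A

theorem tagVal_tuple (R : Fin S.numRel) (f : Fin (S.arity R) → ℕ) :
    p.tagVal R (.tuple f) = (p.tag ⟨R, f⟩).encode := by
  rw [tagVal, Fact.encode_eq]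
  unfold tag
  congr 2
  refine List.map_congr_left fun A _ => ?_
  dsimp only
  split_ifs
  · exact codeVal_tuple f
  · exact Val.nth_tuple f A

/-- All tuples over the active domain are listed, and a fixed number of tests selects those that
come from raw facts. -/
theorem exists_list_raw (R : Fin S.numRel) (hR : R ∈ p.rels) : ∃ K, PL B K ∧
    ∀ (D : Database (splitSchema S M)) (v : Val), DatabaseRepr v D →
      ∀ x, x ∈ K v ↔ ∃ f : Fin (S.arity R) → ℕ, p.Raw D ⟨R, f⟩ ∧ x = (p.tag ⟨R, f⟩).encode := by
  let c₁ : Fin (S.arity R) → Val → Prop := fun A w =>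
    ∀ c, p.args R A = .const c → Val.nth A w.snd = .nat c
  have hc₁ : ∀ A, PB B (c₁ A) := by
    intro A
    cases h : p.args R A with
    | const c =>
      have := PB.eq (B := B) (PF.snd₀.nth A) (PF.const (.nat c))
      simpa [c₁, h] using this
    | var x => exact ⟨_, PF.const (.nat 1), fun v => by simp [c₁, h]⟩
  let c₂ : Option (Fin (S.arity R)) → Val → Prop := fun o w => p.projVal R o w.snd ∈ w.fst.elems
  have hc₂ : ∀ o, PB B (c₂ o) := fun o => PB.mem (pf_projVal PF.snd₀ R o) PF.fst₀
  have htest := (PB.forall_mem (p.gov R)ᶜ.toList fun A _ => hc₁ A).and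
    (PB.forall_mem (Finset.insertNone (p.gov R)).toList fun o _ => hc₂ o)
  obtain ⟨K, hK, hmem⟩ := PL.ite' htest (PL.cons (pf_tagVal (p := p) PF.snd₀ R) PL.nil)
  refine ⟨_, PL.flatMap (PL.tupleList M (S.arity R)).ofList hK, fun D v hv x => ?_⟩
  simp only [List.mem_flatMap, List.mem_reverse, Val.elems_ofList, hmem, List.mem_singleton,
    mem_tupleList (mem_adomList hv), Finset.mem_toList, Finset.mem_compl, c₁, c₂, Val.fst,
    Val.snd]
  constructor
  · rintro ⟨_, ⟨f, -, rfl⟩, ⟨h1, h2⟩, rfl⟩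
    refine ⟨f, ⟨hR, fun A hA c hc => ?_, fun o ho => ?_⟩, tagVal_tuple R f⟩
    · have := h1 A hA c hc
      rwa [Val.nth_tuple, Val.nat.injEq] at this
    · have := h2 o ho
      rw [projVal_tuple, hv.mem_elems] at this
      obtain ⟨g, hg, he⟩ := this
      rw [Fact.encode_injective he]
      exact hg
  · rintro ⟨f, hf, rfl⟩
    refine ⟨_, ⟨f, fun A => hf.mem_adom A, rfl⟩, ⟨fun A hA c hc => ?_, fun o ho => ?_⟩,
      (tagVal_tuple R f).symm⟩
    · rw [Val.nth_tuple, Val.nat.injEq]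
      exact hf.2.1 A hA c hc
    · rw [projVal_tuple, hv.mem_elems]
      exact ⟨_, hf.2.2 o ho, rfl⟩

theorem exists_pf_database (p : Plan S M) (B : Problem) : ∃ g, PF B g ∧
    ∀ (D : Database (splitSchema S M)) (v : Val), DatabaseRepr v D →
      DatabaseRepr (g v) (p.database D) := by
  have h : ∀ R : Fin S.numRel, ∃ K, PL B K ∧ (R ∈ p.rels → ∀ (D : Database (splitSchema S M))
      (v : Val), DatabaseRepr v D → ∀ x, x ∈ K v ↔
        ∃ f : Fin (S.arity R) → ℕ, p.Raw D ⟨R, f⟩ ∧ x = (p.tag ⟨R, f⟩).encode) := by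
    intro R
    by_cases hR : R ∈ p.rels
    · obtain ⟨K, hK, h⟩ := exists_list_raw (B := B) R hR
      exact ⟨K, hK, fun _ => h⟩
    · exact ⟨_, PL.nil, fun h => (hR h).elim⟩
  choose K hK hmem using h
  refine ⟨_, ((PL.static (p.ground.toList.map fun f => (p.tag f).encode)).append
    (PL.flatMap_static p.rels.toList fun R _ => hK R)).ofList, fun D v hv => ?_⟩
  refine databaseRepr_ofList fun x => ?_
  simp only [List.mem_append, List.mem_map, List.mem_flatMap, Finset.mem_toList, database,
    Finset.mem_image, mem_facts]
  constructor
  · rintro (⟨f, hf, rfl⟩ | ⟨R, hR, hx⟩)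
    · exact ⟨_, ⟨f, Or.inr hf, rfl⟩, rfl⟩
    · obtain ⟨f, hf, rfl⟩ := (hmem R hR D v hv x).1 hx
      exact ⟨_, ⟨_, Or.inl hf, rfl⟩, rfl⟩
  · rintro ⟨_, ⟨f, hf | hf, rfl⟩, rfl⟩
    · exact Or.inr ⟨f.rel, hf.1, (hmem f.rel hf.1 D v hv _).2 ⟨f.val, hf, rfl⟩⟩
    · exact Or.inl ⟨f, hf, rfl⟩

theorem Correct.cookReducible {F : FDSet S} {Q : CQ S} (hp : p.Correct F Q) :
    CookReducible (RelFreq (splitFDs S M) (p.toSplit.query p.rels p.args)) (RelFreq F Q) := by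
  obtain ⟨g, hg, h⟩ := p.exists_pf_database (RelFreq F Q)
  exact cookReducible_of_map hg fun D v hv => ⟨_, h D v hv, hp.relFreq_eq D⟩

end Plan

end CQA

namespace CQA

/-! ## The data of the reduction -/

theorem CQ.SelfJoinFree.exists_args {S : Schema} {Q : CQ S} (hQ : Q.SelfJoinFree) :
    ∃ T : ∀ R, Fin (S.arity R) → Term, ∀ α ∈ Q, α = ⟨α.rel, T α.rel⟩ := by
  have h : ∀ R, ∃ t : Fin (S.arity R) → Term, ∀ u, Atom.mk R u ∈ Q → u = t := by
    intro R
    by_cases hR : ∃ u, Atom.mk R u ∈ Q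
    · obtain ⟨t, ht⟩ := hR
      refine ⟨t, fun u hu => ?_⟩
      have := hQ _ hu _ ht rfl
      simpa using this
    · push Not at hR
      -- Relation names without an atom get arbitrary terms.
      exact ⟨fun _ => .const 0, fun u hu => (hR u hu).elim⟩
  choose T hT using h
  exact ⟨T, fun α hα => by rw [← hT α.rel α.args hα]⟩

section Construction

variable {S : Schema} {F : FDSet S} {M : ℕ}

open Classical in
/-- The left-hand sides of the governed attributes. -/
noncomputable def governingLhs (F : FDSet S) (Q : CQ S) (α : Atom S) (A : Fin (S.arity α.rel)) :
    Finset (Fin (S.arity α.rel)) :=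
  if h : ∃ X, Governs F Q α X A then h.choose else ∅

theorem Governs.governingLhs_eq (hF : Canonical F) (hch : LHSChain F) {Q : CQ S} {α : Atom S}
    {X : Finset (Fin (S.arity α.rel))} {A : Fin (S.arity α.rel)} (h : Governs F Q α X A) :
    governingLhs F Q α A = X := by
  have hex : ∃ X, Governs F Q α X A := ⟨X, h⟩
  rw [governingLhs, dif_pos hex]
  exact hex.choose_spec.lhs_eq hF hch h

open Classical in
/-- The data of the reduction for the query with the atoms `R(T R)`, for `R ∈ rels`. -/
noncomputable def plan (hF : Canonical F) (hch : LHSChain F) (hM : ∀ R, S.arity R ≤ M) (Q : CQ S)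
    (rels : Finset (Fin S.numRel)) (T : ∀ R, Fin (S.arity R) → Term) (ground : Finset (Fact S)) :
    Plan S M where
  arity_le := hM
  gov R := Finset.univ.filter fun A => ∃ X, Governs F Q ⟨R, T R⟩ X A
  lhs R := governingLhs F Q ⟨R, T R⟩
  notMem_gov R A hA B hB hB' := by
    obtain ⟨X, hX⟩ := (Finset.mem_filter.1 hA).2
    obtain ⟨X', hX'⟩ := (Finset.mem_filter.1 hB').2
    rw [hX.governingLhs_eq hF hch] at hB
    exact hX.not_governs hF hch hB hX'
  rels := rels
  args := T
  tagged R := Finset.univ.filter fun A => R ∈ rels ∧ Tagged F Q ⟨R, T R⟩ A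
  ground := ground

variable {hF : Canonical F} {hch : LHSChain F} {hM : ∀ R, S.arity R ≤ M} {Q : CQ S}
  {rels : Finset (Fin S.numRel)} {T : ∀ R, Fin (S.arity R) → Term} {ground : Finset (Fact S)}

theorem mem_gov_plan {R : Fin S.numRel} {A : Fin (S.arity R)} :
    A ∈ (plan hF hch hM Q rels T ground).gov R ↔ ∃ X, Governs F Q ⟨R, T R⟩ X A := by
  simp [plan]

theorem lhs_plan {R : Fin S.numRel} {A : Fin (S.arity R)} {X : Finset (Fin (S.arity R))}
    (h : Governs F Q ⟨R, T R⟩ X A) : (plan hF hch hM Q rels T ground).lhs R A = X :=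
  h.governingLhs_eq hF hch

theorem mem_tagged_plan {R : Fin S.numRel} {A : Fin (S.arity R)} :
    A ∈ (plan hF hch hM Q rels T ground).tagged R ↔ R ∈ rels ∧ Tagged F Q ⟨R, T R⟩ A := by
  simp [plan]

theorem final_plan (hQ : Q = rels.image fun R => Atom.mk R (T R)) (hfin : Final F Q) :
    Final (splitFDs S M) ((plan hF hch hM Q rels T ground).toSplit.query rels T) := by
  refine Split.final_query hQ ?_ ?_ hfin.unsplittable
  · rintro R hR ⟨A, hA⟩
    obtain ⟨X, hX⟩ := mem_gov_plan.1 hA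
    obtain ⟨X₀, Y₀, h₀, -⟩ := id hX
    have hα : (⟨R, T R⟩ : Atom S) ∈ Q := hQ ▸ Finset.mem_image_of_mem _ hR
    obtain ⟨B, hB, x, hx⟩ := hfin.exists_var_of_isPrimaryFD hch hα h₀
    refine ⟨B, fun hB' => ?_, fun A' hA' => ?_, x, hx⟩
    · obtain ⟨X', hX'⟩ := mem_gov_plan.1 hB'
      exact hX.not_governs hF hch (hX.primary_subset hch h₀ hB) hX'
    · obtain ⟨X', hX'⟩ := mem_gov_plan.1 hA'
      rw [lhs_plan hX']
      exact hX'.primary_subset hch h₀ hB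
  · intro x
    obtain ⟨α, hα, hx⟩ := hfin.not_common x
    obtain ⟨R, hR, rfl⟩ : ∃ R ∈ rels, Atom.mk R (T R) = α := by
      have := hα.1
      rw [hQ] at this
      simpa using this
    obtain ⟨X₀, Y₀, h₀⟩ := exists_isPrimaryFD_of_mem_complexPart hα
    obtain ⟨A, hA, h⟩ := h₀.exists_complex_position hch hα
    refine ⟨R, hR, A, mem_gov_plan.2 ⟨X₀, hA⟩, fun B hB hBx => ?_, h⟩
    rw [lhs_plan hA] at hB
    exact hx ⟨B, (h₀.primaryLhs_iff hch).2 hB, hBx⟩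

theorem consistent_plan (R : Fin S.numRel) (hR : R ∈ rels) (f g : Fin (S.arity R) → ℕ)
    (hf : (plan hF hch hM Q rels T ground).Matches ⟨R, f⟩)
    (hg : (plan hF hch hM Q rels T ground).Matches ⟨R, g⟩) :
    Consistent F {(plan hF hch hM Q rels T ground).tag ⟨R, f⟩,
      (plan hF hch hM Q rels T ground).tag ⟨R, g⟩} ↔
      ∀ A ∈ (plan hF hch hM Q rels T ground).gov R,
        (∀ B ∈ (plan hF hch hM Q rels T ground).lhs R A, f B = g B) → f A = g A := by
  classical
  have h := consistent_tag_iff (α := ⟨R, T R⟩) (Q := Q) hF hch code_injective (f := f) (g := g)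
    (fun A hA c hc => hf A (fun h => hA (mem_gov_plan.1 h)) c hc)
    (fun A hA c hc => hg A (fun h => hA (mem_gov_plan.1 h)) c hc)
  have htag : ∀ f : Fin (S.arity R) → ℕ, (plan hF hch hM Q rels T ground).tag ⟨R, f⟩ =
      ⟨R, fun A => if Tagged F Q ⟨R, T R⟩ A then code f else f A⟩ := by
    intro f
    unfold Plan.tag
    congr 1
    funext A
    exact if_congr (mem_tagged_plan.trans (and_iff_right hR)) rfl rfl
  rw [htag, htag]
  refine h.trans ⟨fun h A hA hB => ?_, fun h X A hX hB => ?_⟩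
  · obtain ⟨X, hX⟩ := mem_gov_plan.1 hA
    exact h X A hX fun B hBX => hB B (by rw [lhs_plan hX]; exact hBX)
  · exact h A (mem_gov_plan.2 ⟨X, hX⟩) fun B hBX => hB B (by rwa [lhs_plan hX] at hBX)

/-- This allows the value of a variable at an identifier position to be changed without any effect
elsewhere. -/
theorem occurrence_unique (hQ : Q = rels.image fun R => Atom.mk R (T R)) {y : ℕ}
    (hy : ¬ Q.Liaison y) {s t : (R : Fin S.numRel) × Fin (S.arity R)} (hs : s.1 ∈ rels)
    (ht : t.1 ∈ rels) (hsy : T s.1 s.2 = .var y) (hty : T t.1 t.2 = .var y) : s = t := by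
  by_contra hne
  have hmem : ∀ R ∈ rels, Atom.mk R (T R) ∈ Q := fun R hR => hQ ▸ Finset.mem_image_of_mem _ hR
  refine hy ⟨⟨⟨s.1, T s.1⟩, s.2⟩, ⟨⟨t.1, T t.1⟩, t.2⟩, fun h => hne ?_, hmem _ hs, hmem _ ht,
    hsy, hty⟩
  obtain ⟨R, A⟩ := s
  obtain ⟨R', A'⟩ := t
  have hR : R = R' := congrArg (fun r => r.1.rel) h
  subst hR
  simpa using h

theorem Term.eval_asg {τ : ℕ → Option ℕ} {h : ℕ → ℕ} {t : Term}
    (ht : ∀ x c, t = .var x → τ x = some c → h x = c) : (t.asg τ).eval h = t.eval h := by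
  cases t with
  | const c => rfl
  | var x =>
    cases hx : τ x with
    | none => simp [Term.asg, hx]
    | some c => simp [Term.asg, hx, Term.eval, ht x c rfl hx]

end Construction

/-! ### Correctness of the reduction -/

section Correctness

variable {S : Schema} {F : FDSet S} {M : ℕ} {Q P : CQ S} {τ : ℕ → Option ℕ}
  {T : ∀ R, Fin (S.arity R) → Term}

/-- The facts for the atoms in `Q` but not in `P`. -/
def groundFacts (Q P : CQ S) (τ : ℕ → Option ℕ) : Finset (Fact S) :=
  (Q \ P).image fun α => ⟨α.rel, fun A => (α.args A).eval fun x => (τ x).getD 0⟩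

theorem mem_groundFacts {f : Fact S} : f ∈ groundFacts Q P τ ↔ ∃ α ∈ Q, α ∉ P ∧
    (⟨α.rel, fun A => (α.args A).eval fun x => (τ x).getD 0⟩ : Fact S) = f := by
  simp [groundFacts, and_assoc]

theorem image_asg_eq (hT : ∀ α ∈ P, α = ⟨α.rel, T α.rel⟩) :
    P.image (Atom.asg τ) = (P.image Atom.rel).image
      fun R => Atom.mk R fun A => (T R A).asg τ := by
  rw [Finset.image_image]
  refine Finset.image_congr fun α hα => ?_
  have := hT α hα
  rw [this]
  rfl

theorem rel_mem_iff (hQ : Q.SelfJoinFree) (hP : P ⊆ Q) {α : Atom S} (hα : α ∈ Q) :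
    α.rel ∈ P.image Atom.rel ↔ α ∈ P := by
  refine ⟨fun h => ?_, Finset.mem_image_of_mem _⟩
  obtain ⟨β, hβ, h⟩ := Finset.mem_image.1 h
  rwa [hQ α hα β (hP hβ) h.symm]

/-- The point is entailment. Assigned variables are pinned by their forced occurrences, and the
atoms outside `P` by their ground facts. Variables at identifier positions occur only once, so their
values can be switched between identifiers and original entries. -/
theorem correct_plan (hF : Canonical F) (hch : LHSChain F) (hM : ∀ R, S.arity R ≤ M)
    (hQ : Q.SelfJoinFree) (hT : ∀ α ∈ Q, α = ⟨α.rel, T α.rel⟩) (hP : UnsafePart F Q τ P)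
    (hfin : Final F (P.image (Atom.asg τ))) :
    (plan hF hch hM (P.image (Atom.asg τ)) (P.image Atom.rel) (fun R A => (T R A).asg τ)
      (groundFacts Q P τ)).Correct F Q := by
  set Q' : CQ S := P.image (Atom.asg τ) with hQ'
  set rels := P.image Atom.rel with hrels
  set T' : ∀ R, Fin (S.arity R) → Term := fun R A => (T R A).asg τ with hT'
  set p := plan hF hch hM Q' rels T' (groundFacts Q P τ) with hp
  have himg : Q' = rels.image fun R => Atom.mk R (T' R) :=
    image_asg_eq fun α hα => hT α (hP.subset hα)
  have hmemP : ∀ R ∈ rels, Atom.mk R (T R) ∈ P := by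
    intro R hR
    obtain ⟨α, hα, rfl⟩ := Finset.mem_image.1 hR
    rw [← hT α (hP.subset hα)]
    exact hα
  have hgrel : ∀ f ∈ p.ground, f.rel ∉ rels := by
    intro f hf
    obtain ⟨α, hα, hαP, rfl⟩ := mem_groundFacts.1 hf
    exact fun h => hαP ((rel_mem_iff hQ hP.subset hα).1 h)
  have hguniq : ∀ α ∈ Q, ∀ f ∈ p.ground, f.rel = α.rel →
      f = ⟨α.rel, fun A => (α.args A).eval fun x => (τ x).getD 0⟩ := by
    intro α hα f hf h
    obtain ⟨β, hβ, -, rfl⟩ := mem_groundFacts.1 hf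
    rw [hQ β hβ α hα h]
  have htagid : ∀ f : Fact S, f.rel ∉ rels → p.tag f = f := by
    intro f hf
    have : ∀ A, A ∉ p.tagged f.rel := fun A hA => hf (mem_tagged_plan.1 hA).1
    simp [Plan.tag, this]
  have hvars : ∀ α ∈ P, ∀ A y, (α.args A).asg τ = .var y → y ∈ Q'.vars := fun α hα A y hy =>
    ⟨α.asg τ, Finset.mem_image_of_mem _ hα, A, hy⟩
  refine ⟨consistent_plan, hgrel, ?_, ?_⟩
  · intro f hf g hg h
    obtain ⟨α, hα, -, rfl⟩ := mem_groundFacts.1 hf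
    exact (hguniq α hα g hg h.symm).symm
  intro J hJ
  constructor
  · rintro ⟨h, hh⟩
    have hmatch : ∀ α ∈ P, ∃ u : Fin (S.arity α.rel) → ℕ, Fact.mk α.rel u ∈ J ∧
        ∀ A, (α.args A).eval h = if A ∈ p.tagged α.rel then code u else u A := by
      intro α hα
      obtain ⟨⟨R, u⟩, hf, he⟩ := Finset.mem_image.1 (hh α (hP.subset hα))
      have hR : R = α.rel := congrArg Fact.rel he
      subst hR
      rcases Finset.mem_union.1 hf with hf | hf
      · refine ⟨u, hf, fun A => ?_⟩
        simp only [Plan.tag, Fact.mk.injEq, heq_eq_eq, true_and] at he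
        exact (congrFun he A).symm
      · exact (hgrel _ hf (Finset.mem_image_of_mem _ hα)).elim
    have hground : ∀ α ∈ Q, α ∉ P → ∀ A,
        (α.args A).eval h = (α.args A).eval fun x => (τ x).getD 0 := by
      intro α hα hαP A
      obtain ⟨f, hf, he⟩ := Finset.mem_image.1 (hh α hα)
      have hrel : f.rel = α.rel := congrArg Fact.rel he
      have hn : f.rel ∉ rels := fun h => hαP ((rel_mem_iff hQ hP.subset hα).1 (hrel ▸ h))
      rcases Finset.mem_union.1 hf with hf | hf
      · exact (hn (hJ f hf).1).elim
      · rw [htagid f hn, hguniq α hα f hf hrel] at he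
        simp only [Fact.mk.injEq, heq_eq_eq, true_and] at he
        exact (congrFun he A).symm
    -- If the forced occurrence is in `P`, it is ungoverned, so `Matches` prescribes the constant.
    -- Otherwise the ground fact contains it.
    have hforced : ∀ x c, τ x = some c → h x = c := by
      intro x c hx
      obtain ⟨⟨R, t⟩, hα, A, hA, hf⟩ := hP.forced x c hx
      obtain rfl : t = T R := eq_of_heq (Atom.mk.inj (hT _ hα)).2
      by_cases hαP : (⟨R, T R⟩ : Atom S) ∈ P
      · obtain ⟨u, hu, he⟩ := hmatch _ hαP
        have hng : A ∉ p.gov R := by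
          rw [mem_gov_plan]
          rintro ⟨X, hX⟩
          exact hf.not_governs hF hch hfin (Finset.mem_image_of_mem _ hαP) hX
        have hnt : A ∉ p.tagged R := fun h =>
          hng (mem_gov_plan.2 ((mem_tagged_plan.1 h).2.governs hF))
        have h1 := he A
        rw [if_neg hnt, hA] at h1
        have h2 := (hJ _ hu).2 A hng c (by
          change (T R A).asg τ = .const c
          rw [show T R A = .var x from hA]
          simp [Term.asg, hx])
        exact h1.trans h2
      · have := hground _ hα hαP A
        rw [hA] at this
        simpa [Term.eval, hx] using this
    have hmatch' : ∀ R, ∃ u : Fin (S.arity R) → ℕ, R ∈ rels → Fact.mk R u ∈ J ∧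
        ∀ A, (T' R A).eval h = if A ∈ p.tagged R then code u else u A := by
      intro R
      by_cases hR : R ∈ rels
      · obtain ⟨u, hu, he⟩ := hmatch _ (hmemP R hR)
        refine ⟨u, fun _ => ⟨hu, fun A => ?_⟩⟩
        rw [← he A]
        exact Term.eval_asg fun x c _ hx => hforced x c hx
      · exact ⟨fun _ => 0, fun h => (hR h).elim⟩
    choose u hu using hmatch'
    classical
    -- `q y s` says that `y` stands at the identifier position `s`. Such variables get back the
    -- entries that the identifiers have replaced.
    let q : ℕ → (R : Fin S.numRel) × Fin (S.arity R) → Prop := fun y s =>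
      s.2 ∈ p.tagged s.1 ∧ T' s.1 s.2 = .var y
    have hq : ∀ y s, q y s → s.1 ∈ rels ∧ ¬ Q'.Liaison y := by
      intro y s hs
      obtain ⟨h1, h2⟩ := mem_tagged_plan.1 hs.1
      obtain ⟨z, hz, hzl⟩ := h2.loose
      rw [show z = y from Term.var.inj (hz.symm.trans hs.2)] at hzl
      exact ⟨h1, hzl⟩
    refine ⟨fun y => if H : ∃ s, q y s then u H.choose.1 H.choose.2 else h y, fun R hR => ?_⟩
    obtain ⟨huJ, hue⟩ := hu R hR
    convert huJ using 2
    funext A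
    rcases (T' R A).const_or_var with ⟨c, hc⟩ | ⟨y, hy⟩
    · change (T' R A).eval _ = _
      rw [hc]
      have hnt : A ∉ p.tagged R := fun h => by
        obtain ⟨z, hz, -⟩ := (mem_tagged_plan.1 h).2.loose
        exact absurd (hc.symm.trans hz) (by simp)
      have := hue A
      rw [if_neg hnt, hc] at this
      exact this
    · change (T' R A).eval _ = _
      rw [hy]
      change (if H : ∃ s, q y s then u H.choose.1 H.choose.2 else h y) = u R A
      split_ifs with H
      · have hs := H.choose_spec
        obtain ⟨h1, h2⟩ := hq y _ hs
        rw [occurrence_unique himg h2 h1 (t := ⟨R, A⟩) hR hs.2 hy]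
      · have hnt : A ∉ p.tagged R := fun h => H ⟨⟨R, A⟩, h, hy⟩
        have := hue A
        rw [if_neg hnt, hy] at this
        exact this
  · rintro ⟨h, hh⟩
    classical
    let q : ℕ → (R : Fin S.numRel) × Fin (S.arity R) → Prop := fun y s =>
      s.2 ∈ p.tagged s.1 ∧ T' s.1 s.2 = .var y
    have hq : ∀ y s, q y s → s.1 ∈ rels ∧ ¬ Q'.Liaison y := by
      intro y s hs
      obtain ⟨h1, h2⟩ := mem_tagged_plan.1 hs.1
      obtain ⟨z, hz, hzl⟩ := h2.loose
      rw [show z = y from Term.var.inj (hz.symm.trans hs.2)] at hzl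
      exact ⟨h1, hzl⟩
    have hqP : ∀ y s, q y s → y ∈ Q'.vars ∧ τ y = none := by
      intro y s hs
      have := hmemP s.1 (hq y s hs).1
      exact ⟨hvars _ this s.2 y hs.2, (Term.asg_eq_var.1 hs.2).2⟩
    -- Variables at identifier positions get the code of the fact that their atom is mapped to, and
    -- the other variables of `Q'` keep their values. All remaining ones follow `τ`, with the
    -- default `0` that the ground facts use.
    let h' : ℕ → ℕ := fun y =>
      if H : ∃ s, q y s then code fun A => (T' H.choose.1 A).eval h
      else if y ∈ Q'.vars then h y else (τ y).getD 0
    have hvτ : ∀ y ∈ Q'.vars, τ y = none := by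
      rintro y ⟨α, hα, A, hA⟩
      obtain ⟨β, -, rfl⟩ := Finset.mem_image.1 hα
      exact (Term.asg_eq_var.1 hA).2
    have hsome : ∀ y c, τ y = some c → h' y = c := by
      intro y c hy
      have H : ¬ ∃ s, q y s := by
        rintro ⟨s, hs⟩
        simp [(hqP y s hs).2] at hy
      have hv : y ∉ Q'.vars := fun hv => by simp [hvτ y hv] at hy
      simp only [h', H, hv, hy, dif_neg, if_false, Option.getD_some, not_false_eq_true]
    refine ⟨h', fun α hα => ?_⟩
    by_cases hαP : α ∈ P
    · have hR : α.rel ∈ rels := Finset.mem_image_of_mem _ hαP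
      refine Finset.mem_image.2 ⟨_, Finset.mem_union_left _ (hh α.rel hR), ?_⟩
      simp only [Plan.tag, Fact.mk.injEq, heq_eq_eq, true_and]
      funext A
      have harg : α.args A = T α.rel A := congrFun (eq_of_heq (Atom.mk.inj (hT α hα)).2) A
      rw [harg, ← Term.eval_asg (τ := τ) (h := h') fun x c _ hx => hsome x c hx]
      change (if A ∈ p.tagged α.rel then code fun A => (T' α.rel A).eval h
        else (T' α.rel A).eval h) = (T' α.rel A).eval h'
      rcases (T' α.rel A).const_or_var with ⟨c, hc⟩ | ⟨y, hy⟩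
      · have hnt : A ∉ p.tagged α.rel := fun h => by
          obtain ⟨z, hz, -⟩ := (mem_tagged_plan.1 h).2.loose
          exact absurd (hc.symm.trans hz) (by simp)
        rw [if_neg hnt, hc]
        rfl
      · rw [hy]
        change _ = h' y
        by_cases ht : A ∈ p.tagged α.rel
        · have H : ∃ s, q y s := ⟨⟨α.rel, A⟩, ht, hy⟩
          obtain ⟨h1, h2⟩ := hq y _ H.choose_spec
          rw [if_pos ht]
          simp only [h', dif_pos H]
          rw [occurrence_unique himg h2 h1 (t := ⟨α.rel, A⟩) hR H.choose_spec.2 hy]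
        · have H : ¬ ∃ s, q y s := by
            rintro ⟨s, hs⟩
            obtain ⟨h1, h2⟩ := hq y s hs
            have := occurrence_unique himg h2 h1 (t := ⟨α.rel, A⟩) hR hs.2 hy
            subst this
            exact ht hs.1
          have hv : y ∈ Q'.vars := hvars α hαP A y (by rw [harg]; exact hy)
          rw [if_neg ht]
          simp only [h', dif_neg H, if_pos hv]
          rfl
    · have hg : (⟨α.rel, fun A => (α.args A).eval fun x => (τ x).getD 0⟩ : Fact S) ∈ p.ground :=
        mem_groundFacts.2 ⟨α, hα, hαP, rfl⟩
      refine Finset.mem_image.2 ⟨_, Finset.mem_union_right _ hg, ?_⟩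
      rw [htagid _ (hgrel _ hg)]
      simp only [Fact.mk.injEq, heq_eq_eq, true_and]
      funext A
      cases hA : α.args A with
      | const c => rfl
      | var y =>
        change (τ y).getD 0 = h' y
        have hv : y ∉ Q'.vars := by
          rintro ⟨β, hβ, B, hB⟩
          obtain ⟨γ, hγ, rfl⟩ := Finset.mem_image.1 hβ
          obtain ⟨hB, hy⟩ := Term.asg_eq_var.1 hB
          exact hP.disjoint γ hγ α hα hαP B A y hB hA hy
        have H : ¬ ∃ s, q y s := fun ⟨s, hs⟩ => hv (hqP y s hs).1
        simp only [h', dif_neg H, if_neg hv]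

end Correctness

end CQA

theorem mainTheorem4 (S : CQA.Schema) (F : CQA.FDSet S) (hcanon : CQA.Canonical F)
    (hchain : CQA.LHSChain F) (Q : CQA.CQ S) (hQ : CQA.CQ.SelfJoinFree Q)
    (hns : ¬ CQA.Safe F Q) :
    ∃ (S' : CQA.Schema) (F' : CQA.FDSet S') (Q' : CQA.CQ S'),
      CQA.PrimaryKeys F' ∧ CQA.Canonical F' ∧ CQA.CQ.SelfJoinFree Q' ∧ ¬ CQA.Safe F' Q' ∧
      CQA.CookReducible (CQA.RelFreq F' Q') (CQA.RelFreq F Q) := by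
  obtain ⟨τ, P, hP, hfin⟩ := CQA.exists_final_part hchain hns
  obtain ⟨T, hT⟩ := hQ.exists_args
  -- The common arity of the target schema is the largest arity of the source schema.
  have hM : ∀ R, S.arity R ≤ Finset.univ.sup S.arity := fun R =>
    Finset.le_sup (Finset.mem_univ R)
  exact ⟨CQA.splitSchema S (Finset.univ.sup S.arity), CQA.splitFDs S _, _,
    CQA.primaryKeys_splitFDs, CQA.canonical_splitFDs, CQA.Split.selfJoinFree_query _ _,
    (CQA.final_plan (CQA.image_asg_eq fun α hα => hT α (hP.subset hα)) hfin).not_safe,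
    (CQA.correct_plan hcanon hchain hM hQ hT hP hfin).cookReducible⟩
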